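/- **Setting.** Let $G$ be a real Lie group with semisimple Lie algebra $\mathfrak g=\mathfrak g_{-k}\oplus\dots\oplus\mathfrak g_k$, $[\mathfrak g_i,\mathfrak g_j]\subset\mathfrak g_{i+j}$, such that no simple ideal of $\mathfrak g$ is contained in $\mathfrak g_0$ and $\mathfrak g_-=\mathfrak g_{-k}\oplus\dots\oplus\mathfrak g_{-1}$ is generated by $\mathfrak g_{-1}$; put $\mathfrak g_+=\mathfrak g_1\oplus\dots\oplus\mathfrak g_k$. Let $G_0\subset G$ be the closed subgroup of all $g$ such that $\mathrm{Ad}(g)$ preserves every $\mathfrak g_i$. Let $p_0:\mathcal G_0\to M$ be a regular infinitesimal flag structure: a smooth principal $G_0$-bundle together with a filtration $TM=T^{-k}M\supset\dots\supset T^{-1}M\supset T^0M=0$ by smooth subbundles and smooth $G_0$-equivariant frames $T^i_xM/T^{i+1}_xM\cong\mathfrak g_i$ ($i<0$) parametrized by $u\in p_0^{-1}(x)$, such that $[\Gamma(T^iM),\Gamma(T^jM)]\subset\Gamma(T^{i+j}M)$ for $i,j<0$ and the bracket so induced on the associated graded bundle is the one given by the Lie bracket of $\mathfrak g$. Let $\tau\in\Omega^1(\mathcal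 G_0,\mathfrak g)$ be a Weyl form, i.e. a smooth one-form with $(r^g)^*\tau=\mathrm{Ad}(g^{-1})\circ\tau$ for $g\in G_0$, with $\tau(\zeta_A)=A$ for the fundamental vector fields $\zeta_A$, $A\in\mathfrak g_0$, and such that for $i<0$ the restriction of the component $\tau_i$ to $T^i\mathcal G_0=(Tp_0)^{-1}(T^iM)$ is the map $T^i\mathcal G_0\to\mathfrak g_i$ given by the frames. Write $\tau_-,\tau_{\le 0},\tau_+$ for the components of $\tau$ in $\mathfrak g_-$, $\mathfrak g_-\oplus\mathfrak g_0$, $\mathfrak g_+$. Let $\mathcal A=\mathcal G_0\times_{G_0}\mathfrak g$, $\mathcal A_i=\mathcal G_0\times_{G_0}\mathfrak g_i$, $\mathcal A_\pm=\mathcal G_0\times_{G_0}\mathfrak g_\pm$, and let $\{\ ,\ \}$ be the bracket on $\mathcal A$ induced by the Lie bracket of $\mathfrak g$. Elements of $\mathcal A$ over $x$ are regarded as $G_0$-equivariant functions $p_0^{-1}(x)\to\mathfrak g$, and $TM\cong\mathcal A_-$ via $\tau_-$. * The *Rho tensor* is the section $\mathsf P$ of $L(\mathcal A_-,\mathcal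 A_+)$ to which $\tau_+$ descends. * The *Weyl curvature* is the section $W$ of $L(\Lambda^2\mathcal A_-,\mathcal A)$ to which the two-form $d\tau(\xi,\eta)+[\tau(\xi),\tau(\eta)]$ on $\mathcal G_0$ descends. * The *total curvature* is the section $K$ of $L(\Lambda^2\mathcal A_-,\mathcal A)$ whose value on $\xi,\eta$ at $u\in\mathcal G_0$ is $$\bigl(d\tau_{\le 0}+d\tau_+\bigr)(\xi^h,\eta^h)+[\tau_{\le0}(\xi^h),\tau_{\le0}(\eta^h)]+[\tau_+(\xi^h),\tau_+(\eta^h)],$$ where $\xi^h,\eta^h\in T_u\mathcal G_0$ are the horizontal lifts, with respect to the principal connection $\tau_0$, of the tangent vectors of $M$ corresponding to $\xi,\eta$. For $\Phi\in L(\Lambda^2\mathcal A_-,\mathcal A)$ and $\ell\in\mathbb Z$, the homogeneous component $\Phi^{(\ell)}$ is the bilinear map such that $\Phi^{(\ell)}(\xi,\eta)$ is the $\mathcal A_{i+j+\ell}$-component of $\Phi(\xi,\eta)$ for $\xi\in\mathcal A_i$, $\eta\in\mathcal A_j$, $i,j<0$. **Proposition 4.12.** For every Weyl form $\tau$, $\mathsf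 P$, $K$ and $W$ are well defined and uniquely determined by these descriptions, and for all $x\in M$ and all $\xi,\eta$ in the fibre of $\mathcal A_-$ over $x$, $$W(\xi,\eta)=K(\xi,\eta)+\{\mathsf P(\xi),\eta\}-\{\mathsf P(\eta),\xi\}.$$ In particular, $W^{(i)}=K^{(i)}$ for all $i\le 1$. -/

import Mathlib

open scoped Manifold ContDiff

noncomputable section

/-! ### Graded Lie algebras -/

/-- An (effective) `|k|`-grading `L = L_{-k} ⊕ ⋯ ⊕ L_k` of a real Lie algebra: no simple ideal
is contained in `L_0`, and `L_- = L_{-k} ⊕ ⋯ ⊕ L_{-1}` is generated by `L_{-1}`. -/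
structure KGrading (k : ℕ) (L : Type*) [LieRing L] [LieAlgebra ℝ L] where
  /-- the homogeneous components `L_i` -/
  part : ℤ → Submodule ℝ L
  isInternal : DirectSum.IsInternal part
  part_eq_bot : ∀ i : ℤ, (k : ℤ) < |i| → part i = ⊥
  lie_mem : ∀ {i j : ℤ} {X Y : L}, X ∈ part i → Y ∈ part j → ⁅X, Y⁆ ∈ part (i + j)
  effective : ∀ I : LieIdeal ℝ L, LieAlgebra.IsSimple ℝ I → ¬ I.toSubmodule ≤ part 0
  generated : (LieSubalgebra.lieSpan ℝ L (part (-1) : Set L)).toSubmodule =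
    ⨆ i : Set.Iio (0 : ℤ), part i

namespace KGrading

variable {k : ℕ} {L : Type*} [LieRing L] [LieAlgebra ℝ L] (𝔤 : KGrading k L)

theorem bijective_coe : Function.Bijective (DirectSum.coeLinearMap 𝔤.part) := 𝔤.isInternal

/-- The projection of `L` onto its component of degree `i`, as an endomorphism of `L`. -/
def proj (i : ℤ) : L →ₗ[ℝ] L :=
  (𝔤.part i).subtype ∘ₗ DirectSum.component ℝ ℤ (fun j => 𝔤.part j) i ∘ₗ
    (LinearEquiv.ofBijective (DirectSum.coeLinearMap 𝔤.part) 𝔤.bijective_coe).symm.toLinearMap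

/-- The projection onto `L_- = L_{-k} ⊕ ⋯ ⊕ L_{-1}`. -/
def projNeg : L →ₗ[ℝ] L := ∑ i ∈ Finset.Ico (-(k : ℤ)) 0, 𝔤.proj i

/-- The projection onto `L_{≤ 0} = L_{-k} ⊕ ⋯ ⊕ L_0`. -/
def projNonpos : L →ₗ[ℝ] L := ∑ i ∈ Finset.Icc (-(k : ℤ)) 0, 𝔤.proj i

/-- The projection onto `L_+ = L_1 ⊕ ⋯ ⊕ L_k`. -/
def projPos : L →ₗ[ℝ] L := ∑ i ∈ Finset.Icc (1 : ℤ) k, 𝔤.proj i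

/-- `L_- = L_{-k} ⊕ ⋯ ⊕ L_{-1}`. -/
def neg : Submodule ℝ L := ⨆ i : Set.Iio (0 : ℤ), 𝔤.part i

/-- `L_+ = L_1 ⊕ ⋯ ⊕ L_k`. -/
def pos : Submodule ℝ L := ⨆ i : Set.Ioi (0 : ℤ), 𝔤.part i

theorem proj_mem (i : ℤ) (X : L) : 𝔤.proj i X ∈ 𝔤.part i := Subtype.coe_prop _

theorem proj_of_mem {i : ℤ} {X : L} (hX : X ∈ 𝔤.part i) (j : ℤ) :
    𝔤.proj j X = if i = j then X else 0 := by
  have h : (LinearEquiv.ofBijective (DirectSum.coeLinearMap 𝔤.part) 𝔤.bijective_coe).symm X =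
      DirectSum.lof ℝ ℤ (fun j => 𝔤.part j) i ⟨X, hX⟩ := by
    rw [LinearEquiv.symm_apply_eq]
    simp
  simp only [proj, LinearMap.comp_apply, LinearEquiv.coe_coe, h]
  split_ifs with hij
  · subst hij
    simp
  · rw [DirectSum.component.of, dif_neg hij]
    simp

/-- A linear endomorphism preserving every component commutes with the projections. -/
theorem proj_comm {f : L →ₗ[ℝ] L} (hf : ∀ i, ∀ X ∈ 𝔤.part i, f X ∈ 𝔤.part i) (i : ℤ) (X : L) :
    𝔤.proj i (f X) = f (𝔤.proj i X) := by
  have hX : X ∈ ⨆ j, 𝔤.part j := by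
    rw [𝔤.isInternal.submodule_iSup_eq_top]; trivial
  induction hX using Submodule.iSup_induction' with
  | mem j x hx =>
    rw [𝔤.proj_of_mem hx, 𝔤.proj_of_mem (hf j x hx)]
    split_ifs <;> simp
  | zero => simp
  | add x y _ _ hx hy => simp [hx, hy]

theorem proj_mem_neg {i : ℤ} (X : L) (hX : X ∈ 𝔤.neg) : 𝔤.proj i X ∈ 𝔤.neg := by
  have key : ∀ j (x : L), j < 0 → x ∈ 𝔤.part j → x ∈ 𝔤.neg := fun j x hj hx =>
    Submodule.mem_iSup_of_mem (⟨j, hj⟩ : Set.Iio (0 : ℤ)) hx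
  unfold neg at hX
  induction hX using Submodule.iSup_induction' with
  | mem j x hx =>
    rw [𝔤.proj_of_mem hx]
    split_ifs
    · exact key j x j.2 hx
    · exact zero_mem _
  | zero => simp
  | add x y _ _ hx hy => rw [map_add]; exact add_mem hx hy

end KGrading

/-! ### Lie groups, the adjoint action, and the group `G₀` -/

section LieGroups

variable {E : Type*} [NormedAddCommGroup E] [NormedSpace ℝ E]
  {G : Type*} [TopologicalSpace G] [ChartedSpace E G] [Group G]

instance lieGroupMinSmoothness [LieGroup 𝓘(ℝ, E) ∞ G] :
    LieGroup 𝓘(ℝ, E) (minSmoothness ℝ 3) G :=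
  LieGroup.of_le (n := ∞) (by rw [minSmoothness_of_isRCLikeNormedField]; exact ENat.LEInfty.out)

/-- The adjoint action `Ad g : T₁G → T₁G`, the derivative at `1` of `h ↦ g h g⁻¹`. -/
def Ad (g : G) : GroupLieAlgebra 𝓘(ℝ, E) G →L[ℝ] GroupLieAlgebra 𝓘(ℝ, E) G :=
  mfderiv 𝓘(ℝ, E) 𝓘(ℝ, E) (fun h : G => g * h * g⁻¹) 1

theorem Ad_one (X : GroupLieAlgebra 𝓘(ℝ, E) G) : Ad (1 : G) X = X := by
  have : (fun h : G => 1 * h * 1⁻¹) = id := by ext; simp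
  unfold Ad
  rw [this, mfderiv_id]
  rfl

variable [LieGroup 𝓘(ℝ, E) ∞ G]

theorem mdifferentiable_conj (g : G) :
    MDifferentiable 𝓘(ℝ, E) 𝓘(ℝ, E) (fun h : G => g * h * g⁻¹) := by
  have h : ContMDiff 𝓘(ℝ, E) 𝓘(ℝ, E) ∞ (fun h : G => g * h * g⁻¹) :=
    (contMDiff_mul_right (a := g⁻¹)).comp (contMDiff_mul_left (a := g))
  exact h.mdifferentiable (by simp)

theorem Ad_mul (g h : G) (X : GroupLieAlgebra 𝓘(ℝ, E) G) : Ad (g * h) X = Ad g (Ad h X) := by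
  have e : (fun x : G => g * h * x * (g * h)⁻¹) =
      (fun x : G => g * x * g⁻¹) ∘ (fun x : G => h * x * h⁻¹) := by
    ext x; simp [mul_assoc]
  have e1 : h * 1 * h⁻¹ = 1 := by simp
  have key : ∀ (y : G) (_ : y = 1) (v : E),
      (mfderiv 𝓘(ℝ, E) 𝓘(ℝ, E) (fun x : G => g * x * g⁻¹) y : E → E) v =
        (mfderiv 𝓘(ℝ, E) 𝓘(ℝ, E) (fun x : G => g * x * g⁻¹) 1 : E → E) v := by
    rintro y rfl v; rfl
  unfold Ad
  rw [e, mfderiv_comp (I' := 𝓘(ℝ, E)) 1 (mdifferentiable_conj g _) (mdifferentiable_conj h _)]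
  exact key _ e1 _

theorem mfderiv_conj_mulInvariant (g h : G) (X : GroupLieAlgebra 𝓘(ℝ, E) G) :
    mfderiv 𝓘(ℝ, E) 𝓘(ℝ, E) (fun x : G => g * x * g⁻¹) h (mulInvariantVectorField X h) =
      mulInvariantVectorField (Ad g X) (g * h * g⁻¹) := by
  have e : (fun x : G => g * x * g⁻¹) ∘ (fun x : G => h * x) =
      (fun x : G => g * h * g⁻¹ * x) ∘ (fun x : G => g * x * g⁻¹) := by
    ext x; simp [mul_assoc]
  have ml : ∀ (a y : G), MDifferentiableAt 𝓘(ℝ, E) 𝓘(ℝ, E) (fun x : G => a * x) y := fun a y =>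
    (contMDiff_mul_left (I := 𝓘(ℝ, E)) (n := ∞) (a := a)).mdifferentiable (by simp) y
  have h1 := mfderiv_comp (I := 𝓘(ℝ, E)) (I' := 𝓘(ℝ, E)) (I'' := 𝓘(ℝ, E)) (1 : G)
    (mdifferentiable_conj g (h * 1)) (ml h 1)
  have h2 := mfderiv_comp (I := 𝓘(ℝ, E)) (I' := 𝓘(ℝ, E)) (I'' := 𝓘(ℝ, E)) (1 : G)
    (ml (g * h * g⁻¹) (g * 1 * g⁻¹)) (mdifferentiable_conj g 1)
  rw [e] at h1
  have h3 := DFunLike.congr_fun (h1.symm.trans h2) X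
  have k1 : ∀ (y : G) (_ : y = h) (v : E),
      (mfderiv 𝓘(ℝ, E) 𝓘(ℝ, E) (fun x : G => g * x * g⁻¹) y : E → E) v =
        (mfderiv 𝓘(ℝ, E) 𝓘(ℝ, E) (fun x : G => g * x * g⁻¹) h : E → E) v := by
    rintro y rfl v; rfl
  have k2 : ∀ (y : G) (_ : y = 1) (v : E),
      (mfderiv 𝓘(ℝ, E) 𝓘(ℝ, E) (fun x : G => g * h * g⁻¹ * x) y : E → E) v =
        (mfderiv 𝓘(ℝ, E) 𝓘(ℝ, E) (fun x : G => g * h * g⁻¹ * x) 1 : E → E) v := by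
    rintro y rfl v; rfl
  exact ((k1 (h * 1) (mul_one h) _).symm.trans h3).trans (k2 _ (by simp) _)

theorem Ad_lie [CompleteSpace E] (g : G) (X Y : GroupLieAlgebra 𝓘(ℝ, E) G) :
    Ad g ⁅X, Y⁆ = ⁅Ad g X, Ad g Y⁆ := by
  have inv : ∀ h : G, (mfderiv 𝓘(ℝ, E) 𝓘(ℝ, E) (fun x : G => g * x * g⁻¹) h).IsInvertible := by
    intro h
    let c : Diffeomorph 𝓘(ℝ, E) 𝓘(ℝ, E) G G ∞ :=
      { toFun := fun x => g * x * g⁻¹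
        invFun := fun x => g⁻¹ * x * g
        left_inv := fun x => by simp [mul_assoc]
        right_inv := fun x => by simp [mul_assoc]
        contMDiff_toFun := (contMDiff_mul_right (a := g⁻¹)).comp (contMDiff_mul_left (a := g))
        contMDiff_invFun := (contMDiff_mul_right (a := g)).comp (contMDiff_mul_left (a := g⁻¹)) }
    exact ⟨c.mfderivToContinuousLinearEquiv (by simp) h, rfl⟩
  have pull : ∀ Z : GroupLieAlgebra 𝓘(ℝ, E) G,
      VectorField.mpullback 𝓘(ℝ, E) 𝓘(ℝ, E) (fun x : G => g * x * g⁻¹)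
        (mulInvariantVectorField (Ad g Z)) = mulInvariantVectorField Z := by
    intro Z
    ext h
    rw [VectorField.mpullback_apply, ← mfderiv_conj_mulInvariant]
    exact (inv h).inverse_apply_self _
  have hc : ContMDiff 𝓘(ℝ, E) 𝓘(ℝ, E) ∞ (fun h : G => g * h * g⁻¹) :=
    (contMDiff_mul_right (a := g⁻¹)).comp (contMDiff_mul_left (a := g))
  have key := VectorField.mpullback_mlieBracket (n := ∞) (x₀ := (1 : G))
    (mdifferentiableAt_mulInvariantVectorField (Ad g X))
    (mdifferentiableAt_mulInvariantVectorField (Ad g Y)) (hc 1) (by rw [minSmoothness_of_isRCLikeNormedField]; exact ENat.LEInfty.out)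
  rw [pull, pull, VectorField.mpullback_apply, (inv 1).inverse_apply_eq] at key
  have k : ∀ (y : G) (_ : y = 1),
      (VectorField.mlieBracket 𝓘(ℝ, E) (mulInvariantVectorField (Ad g X))
        (mulInvariantVectorField (Ad g Y)) y : E) =
      (VectorField.mlieBracket 𝓘(ℝ, E) (mulInvariantVectorField (Ad g X))
        (mulInvariantVectorField (Ad g Y)) 1 : E) := by
    rintro y rfl; rfl
  exact key.symm.trans (k _ (by simp))

/-- The Lie algebra `T₁G` as a normed space: the identity map to the model space `E` of `G`. -/
def lieToModel (X : GroupLieAlgebra 𝓘(ℝ, E) G) : E := X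

variable [CompleteSpace E] {k : ℕ}

/-- The subgroup `G₀ ⊆ G` of all elements whose adjoint action leaves every component of the
grading invariant, as a topological group with the subspace topology. -/
def leviSubgroup (𝔤 : KGrading k (GroupLieAlgebra 𝓘(ℝ, E) G)) : Subgroup G where
  carrier := {g | ∀ i, (𝔤.part i).map (Ad g).toLinearMap = 𝔤.part i}
  one_mem' i := by
    have : (Ad (1 : G)).toLinearMap = (LinearMap.id : GroupLieAlgebra 𝓘(ℝ, E) G →ₗ[ℝ] _) :=
      LinearMap.ext Ad_one
    rw [this, Submodule.map_id]
  mul_mem' {g h} hg hh i := by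
    have : (Ad (g * h)).toLinearMap = (Ad g).toLinearMap ∘ₗ
        ((Ad h).toLinearMap : GroupLieAlgebra 𝓘(ℝ, E) G →ₗ[ℝ] _) :=
      LinearMap.ext (Ad_mul g h)
    rw [this, Submodule.map_comp, hh i, hg i]
  inv_mem' {g} hg i := by
    have : (Ad g⁻¹).toLinearMap ∘ₗ (Ad g).toLinearMap =
        (LinearMap.id : GroupLieAlgebra 𝓘(ℝ, E) G →ₗ[ℝ] _) :=
      LinearMap.ext fun X => by
        have h := Ad_mul g⁻¹ g X
        rw [inv_mul_cancel, Ad_one] at h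
        exact h.symm
    conv_lhs => rw [← hg i, ← Submodule.map_comp, this, Submodule.map_id]

theorem Ad_mem_part (𝔤 : KGrading k (GroupLieAlgebra 𝓘(ℝ, E) G)) (g : leviSubgroup 𝔤) (i : ℤ)
    (X : GroupLieAlgebra 𝓘(ℝ, E) G) (hX : X ∈ 𝔤.part i) : Ad (g : G) X ∈ 𝔤.part i := by
  rw [← g.2 i]
  exact Submodule.mem_map_of_mem hX

end LieGroups

/-! ### Principal bundles -/

/-- A smooth principal bundle `P → M` with structure group `H` (acting from the right); `EH`, `EP`
and `EM` are the vector spaces on which the manifolds `H`, `P` and `M` are modelled. -/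
structure SmoothPrincipalBundle
    (EH : Type*) [NormedAddCommGroup EH] [NormedSpace ℝ EH]
    (EP : Type*) [NormedAddCommGroup EP] [NormedSpace ℝ EP]
    (EM : Type*) [NormedAddCommGroup EM] [NormedSpace ℝ EM]
    (H : Type*) [TopologicalSpace H] [ChartedSpace EH H] [Group H]
    (P : Type*) [TopologicalSpace P] [ChartedSpace EP P]
    (M : Type*) [TopologicalSpace M] [ChartedSpace EM M] where
  /-- the bundle projection -/
  proj : P → M
  /-- the principal right action -/
  act : P → H → P
  act_one : ∀ u, act u 1 = u
  act_mul : ∀ u g h, act u (g * h) = act (act u g) h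
  contMDiff_act : ContMDiff (𝓘(ℝ, EP).prod 𝓘(ℝ, EH)) 𝓘(ℝ, EP) ∞
    (fun q : P × H => act q.1 q.2)
  proj_act : ∀ u g, proj (act u g) = proj u
  /-- around every point of `M` there is an equivariant smooth local trivialization -/
  exists_trivialization : ∀ x : M, ∃ (U : Set M) (φ : OpenPartialHomeomorph P (M × H)),
    IsOpen U ∧ x ∈ U ∧ φ.source = proj ⁻¹' U ∧ φ.target = U ×ˢ Set.univ ∧
    ContMDiffOn 𝓘(ℝ, EP) (𝓘(ℝ, EM).prod 𝓘(ℝ, EH)) ∞ φ φ.source ∧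
    ContMDiffOn (𝓘(ℝ, EM).prod 𝓘(ℝ, EH)) 𝓘(ℝ, EP) ∞ φ.symm φ.target ∧
    (∀ u ∈ φ.source, (φ u).1 = proj u) ∧
    ∀ u ∈ φ.source, ∀ g, (φ (act u g)).2 = (φ u).2 * g

namespace SmoothPrincipalBundle

variable {EH : Type*} [NormedAddCommGroup EH] [NormedSpace ℝ EH]
  {EP : Type*} [NormedAddCommGroup EP] [NormedSpace ℝ EP]
  {EM : Type*} [NormedAddCommGroup EM] [NormedSpace ℝ EM]
  {H : Type*} [TopologicalSpace H] [ChartedSpace EH H] [Group H]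
  {P : Type*} [TopologicalSpace P] [ChartedSpace EP P]
  {M : Type*} [TopologicalSpace M] [ChartedSpace EM M]
  (Q : SmoothPrincipalBundle EH EP EM H P M)

/-- The fibre of the principal bundle over `x`. -/
def Fibre (x : M) : Type _ := {u : P // Q.proj u = x}

/-- The right action of the structure group on a fibre. -/
def fibreAct {x : M} (u : Q.Fibre x) (g : H) : Q.Fibre x :=
  ⟨Q.act u.1 g, (Q.proj_act u.1 g).trans u.2⟩

/-- The value at `u` of the fundamental vector field generated by `A` in the Lie algebra `T₁H`,
i.e. the derivative of `g ↦ u · g` at `1` in the direction `A`. -/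
def fundamental (A : GroupLieAlgebra 𝓘(ℝ, EH) H) (u : P) : TangentSpace 𝓘(ℝ, EP) u :=
  (mfderiv 𝓘(ℝ, EH) 𝓘(ℝ, EP) (fun g : H => Q.act u g) 1 : EH → EP) A

end SmoothPrincipalBundle

/-! ### Regular infinitesimal flag structures and Weyl forms -/

section Flags

variable {k : ℕ}
  {E : Type*} [NormedAddCommGroup E] [NormedSpace ℝ E] [CompleteSpace E]
  {G : Type*} [TopologicalSpace G] [ChartedSpace E G] [Group G] [LieGroup 𝓘(ℝ, E) ∞ G]
  {𝔤 : KGrading k (GroupLieAlgebra 𝓘(ℝ, E) G)}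
  {E₀ : Type*} [NormedAddCommGroup E₀] [NormedSpace ℝ E₀] [ChartedSpace E₀ (leviSubgroup 𝔤)]
  {EP : Type*} [NormedAddCommGroup EP] [NormedSpace ℝ EP]
  {EM : Type*} [NormedAddCommGroup EM] [NormedSpace ℝ EM]
  {P : Type*} [TopologicalSpace P] [ChartedSpace EP P] [IsManifold 𝓘(ℝ, EP) ∞ P]
  {M : Type*} [TopologicalSpace M] [ChartedSpace EM M] [IsManifold 𝓘(ℝ, EM) ∞ M]

/-- The given manifold structure on `G₀` makes it an embedded submanifold of `G`: the inclusion is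
a smooth immersion (it is a topological embedding since `G₀` has the subspace topology). -/
structure IsLieSubgroup (E₀ : Type*) [NormedAddCommGroup E₀] [NormedSpace ℝ E₀]
    (𝔤 : KGrading k (GroupLieAlgebra 𝓘(ℝ, E) G)) [ChartedSpace E₀ (leviSubgroup 𝔤)] : Prop where
  contMDiff_val : ContMDiff 𝓘(ℝ, E₀) 𝓘(ℝ, E) ∞ (Subtype.val : leviSubgroup 𝔤 → G)
  injective_mfderiv : ∀ g : leviSubgroup 𝔤, Function.Injective
    (mfderiv 𝓘(ℝ, E₀) 𝓘(ℝ, E) (Subtype.val : leviSubgroup 𝔤 → G) g)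

/-- The vector field `V` on a manifold `M` is smooth on the set `U`. -/
def SmoothFieldOn (V : ∀ x : M, TangentSpace 𝓘(ℝ, EM) x) (U : Set M) : Prop :=
  ContMDiffOn 𝓘(ℝ, EM) 𝓘(ℝ, EM).tangent ∞
    (fun x => (⟨x, V x⟩ : TangentBundle 𝓘(ℝ, EM) M)) U

/-- A regular infinitesimal flag structure on `M` with underlying principal `G₀`-bundle `Q`:
a filtration `TM = T^{-k}M ⊇ ⋯ ⊇ T^{-1}M ⊇ T^0M = 0` of the tangent bundle by smooth subbundles and
a reduction of the associated graded bundle to `G₀`, i.e. every `u` in the fibre of `Q` over `x`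
is a frame `T^i_xM / T^{i+1}_xM ≅ 𝔤_i`, `i < 0`, smoothly and `G₀`-equivariantly. Regularity means
that the Lie bracket of vector fields is compatible with the filtration, and the bracket it induces
on the associated graded bundle is the algebraic bracket induced by the Lie bracket of `𝔤`. -/
structure RegularFlagStructure
    (Q : SmoothPrincipalBundle E₀ EP EM (leviSubgroup 𝔤) P M) where
  /-- the filtration: `fil i x = T^i_xM` -/
  fil : ℤ → ∀ x : M, Submodule ℝ (TangentSpace 𝓘(ℝ, EM) x)
  fil_antitone : ∀ x, Antitone fun i => fil i x
  fil_eq_top : ∀ i x, i ≤ -(k : ℤ) → fil i x = ⊤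
  fil_eq_bot : ∀ i x, 0 ≤ i → fil i x = ⊥
  /-- each `T^iM` has smooth local frames -/
  fil_smooth : ∀ i (x : M), ∃ (U : Set M) (n : ℕ) (b : Fin n → ∀ y : M, TangentSpace 𝓘(ℝ, EM) y),
    IsOpen U ∧ x ∈ U ∧ (∀ a, SmoothFieldOn (b a) U) ∧
    ∀ y ∈ U, LinearIndependent ℝ (fun a => b a y) ∧
      Submodule.span ℝ (Set.range fun a => b a y) = fil i y
  /-- the isomorphism `T^i_xM / T^{i+1}_xM ≅ 𝔤_i` given by a point of the fibre over `x` -/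
  frame : ∀ i : ℤ, i < 0 → ∀ (x : M), Q.Fibre x →
    ((fil i x ⧸ (fil (i + 1) x).submoduleOf (fil i x)) ≃ₗ[ℝ] 𝔤.part i)
  frame_act : ∀ i hi x (u : Q.Fibre x) (g : leviSubgroup 𝔤) c,
    (frame i hi x (Q.fibreAct u g) c : GroupLieAlgebra 𝓘(ℝ, E) G) =
      Ad ((g⁻¹ : leviSubgroup 𝔤) : G) (frame i hi x u c : GroupLieAlgebra 𝓘(ℝ, E) G)
  frame_smooth : ∀ i hi (U : Set M) (V : ∀ x, fil i x), IsOpen U →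
    SmoothFieldOn (fun x => (V x : TangentSpace 𝓘(ℝ, EM) x)) U →
    ContMDiffOn 𝓘(ℝ, EP) 𝓘(ℝ, E) ∞
      (fun u : P => lieToModel (frame i hi (Q.proj u) ⟨u, rfl⟩
        (Submodule.Quotient.mk (V (Q.proj u))) : GroupLieAlgebra 𝓘(ℝ, E) G))
      (Q.proj ⁻¹' U)
  regular : ∀ i j (hi : i < 0) (hj : j < 0) (U : Set M) (V : ∀ x, fil i x) (V' : ∀ x, fil j x),
    IsOpen U →
    SmoothFieldOn (fun x => (V x : TangentSpace 𝓘(ℝ, EM) x)) U →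
    SmoothFieldOn (fun x => (V' x : TangentSpace 𝓘(ℝ, EM) x)) U →
    ∀ x ∈ U, ∃ h : VectorField.mlieBracket 𝓘(ℝ, EM)
        (fun x => (V x : TangentSpace 𝓘(ℝ, EM) x)) (fun x => (V' x : TangentSpace 𝓘(ℝ, EM) x)) x
          ∈ fil (i + j) x,
      ∀ u : Q.Fibre x,
        (frame (i + j) (add_neg hi hj) x u (Submodule.Quotient.mk ⟨_, h⟩) :
          GroupLieAlgebra 𝓘(ℝ, E) G) =
        ⁅(frame i hi x u (Submodule.Quotient.mk (V x)) : GroupLieAlgebra 𝓘(ℝ, E) G),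
          (frame j hj x u (Submodule.Quotient.mk (V' x)) : GroupLieAlgebra 𝓘(ℝ, E) G)⁆

/-- A Weyl form: a smooth `G₀`-equivariant one-form `τ` on `P` with values in the Lie algebra of
`G`, which reproduces the generators of fundamental vector fields, and whose component of degree
`i < 0` restricts on `T^iP = (T proj)⁻¹(T^iM)` to the frame form of the flag structure. -/
structure WeylForm {Q : SmoothPrincipalBundle E₀ EP EM (leviSubgroup 𝔤) P M}
    (F : RegularFlagStructure Q) where
  /-- the underlying one-form -/
  form : ∀ u : P, TangentSpace 𝓘(ℝ, EP) u →L[ℝ] GroupLieAlgebra 𝓘(ℝ, E) G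
  smooth : ContMDiff 𝓘(ℝ, EP).tangent 𝓘(ℝ, E) ∞
    (fun v : TangentBundle 𝓘(ℝ, EP) P => lieToModel (form v.1 v.2))
  equivariant : ∀ (g : leviSubgroup 𝔤) (u : P) (ξ : TangentSpace 𝓘(ℝ, EP) u),
    form (Q.act u g) (mfderiv 𝓘(ℝ, EP) 𝓘(ℝ, EP) (fun v => Q.act v g) u ξ) =
      Ad ((g⁻¹ : leviSubgroup 𝔤) : G) (form u ξ)
  form_fundamental : ∀ (u : P) (A : GroupLieAlgebra 𝓘(ℝ, E₀) (leviSubgroup 𝔤)),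
    form u (Q.fundamental A u) =
      mfderiv 𝓘(ℝ, E₀) 𝓘(ℝ, E) (Subtype.val : leviSubgroup 𝔤 → G) 1 A
  form_eq_frame : ∀ (i : ℤ) (hi : i < 0) (u : P) (ξ : TangentSpace 𝓘(ℝ, EP) u)
    (h : mfderiv 𝓘(ℝ, EP) 𝓘(ℝ, EM) Q.proj u ξ ∈ F.fil i (Q.proj u)),
    𝔤.proj i (form u ξ) = F.frame i hi (Q.proj u) ⟨u, rfl⟩ (Submodule.Quotient.mk ⟨_, h⟩)

/-! ### Curvatures -/

/-- The exterior derivative of a one-form with values in the Lie algebra of `G`: `dα(ξ, η)` is the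
derivative of `α(η')` in the direction `ξ` minus the derivative of `α(ξ')` in the direction `η`,
where `ξ'`, `η'` are the extensions of the tangent vectors `ξ`, `η` at `u` which are constant in the
chart at `u` (so that `[ξ', η'] = 0`). -/
def extDerivForm (α : ∀ u : P, TangentSpace 𝓘(ℝ, EP) u →ₗ[ℝ] GroupLieAlgebra 𝓘(ℝ, E) G)
    (u : P) (ξ η : TangentSpace 𝓘(ℝ, EP) u) : GroupLieAlgebra 𝓘(ℝ, E) G :=
  let φ := extChartAt 𝓘(ℝ, EP) u
  let c : TangentSpace 𝓘(ℝ, EP) u → EP := fun ζ => mfderiv 𝓘(ℝ, EP) 𝓘(ℝ, EP) φ u ζ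
  let f : EP → EP → E := fun v y =>
    lieToModel (α (φ.symm y) (mfderiv 𝓘(ℝ, EP) 𝓘(ℝ, EP) φ.symm y v))
  (fderiv ℝ (f (c η)) (φ u) (c ξ) - fderiv ℝ (f (c ξ)) (φ u) (c η) : E)

/-- The two-form `dα(ξ, η) + [α(ξ), α(η)]`. -/
def structureForm (α : ∀ u : P, TangentSpace 𝓘(ℝ, EP) u →ₗ[ℝ] GroupLieAlgebra 𝓘(ℝ, E) G)
    (u : P) (ξ η : TangentSpace 𝓘(ℝ, EP) u) : GroupLieAlgebra 𝓘(ℝ, E) G :=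
  extDerivForm α u ξ η + ⁅α u ξ, α u η⁆

/-- The adjoint tractor fibre `A_x`, i.e. the fibre over `x` of the associated bundle `P ×_{G₀} 𝔤`,
as the space of `G₀`-equivariant maps from the fibre of `P` over `x` to the Lie algebra of `G`
(the class of `(u, X)` is the equivariant map which takes the value `X` at `u`). -/
def adjointFibre (Q : SmoothPrincipalBundle E₀ EP EM (leviSubgroup 𝔤) P M) (x : M) :
    Submodule ℝ (Q.Fibre x → GroupLieAlgebra 𝓘(ℝ, E) G) where
  carrier := {f | ∀ u (g : leviSubgroup 𝔤),
    f (Q.fibreAct u g) = Ad ((g⁻¹ : leviSubgroup 𝔤) : G) (f u)}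
  add_mem' {f f'} hf hf' u g := by
    rw [Pi.add_apply, Pi.add_apply, hf, hf', map_add]
  zero_mem' u g := by rw [Pi.zero_apply, Pi.zero_apply, map_zero]
  smul_mem' c f hf u g := by rw [Pi.smul_apply, Pi.smul_apply, hf, map_smul]

/-- The algebraic bracket on `A_x`, which is induced by the Lie bracket of `𝔤`. -/
instance adjointBracket (Q : SmoothPrincipalBundle E₀ EP EM (leviSubgroup 𝔤) P M) (x : M) :
    Bracket (adjointFibre Q x) (adjointFibre Q x) where
  bracket f f' := ⟨fun u => ⁅f.1 u, f'.1 u⁆, fun u g => by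
    change ⁅f.1 (Q.fibreAct u g), f'.1 (Q.fibreAct u g)⁆ = Ad _ ⁅f.1 u, f'.1 u⁆
    rw [f.2 u g, f'.2 u g, Ad_lie]⟩

/-- The part `A_-` of the adjoint tractor fibre associated to `𝔤_-`. -/
def adjointNeg (Q : SmoothPrincipalBundle E₀ EP EM (leviSubgroup 𝔤) P M) (x : M) :
    Submodule ℝ (adjointFibre Q x) where
  carrier := {f | ∀ u, f.1 u ∈ 𝔤.neg}
  add_mem' hf hf' u := add_mem (hf u) (hf' u)
  zero_mem' _ := zero_mem _
  smul_mem' c _ hf u := Submodule.smul_mem _ c (hf u)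

/-- The part `A_+` of the adjoint tractor fibre associated to `𝔤_+`. -/
def adjointPos (Q : SmoothPrincipalBundle E₀ EP EM (leviSubgroup 𝔤) P M) (x : M) :
    Submodule ℝ (adjointFibre Q x) where
  carrier := {f | ∀ u, f.1 u ∈ 𝔤.pos}
  add_mem' hf hf' u := add_mem (hf u) (hf' u)
  zero_mem' _ := zero_mem _
  smul_mem' c _ hf u := Submodule.smul_mem _ c (hf u)

/-- The projection of `A_x` onto its component of degree `i`, as an endomorphism of `A_x`. -/
def adjointProj (Q : SmoothPrincipalBundle E₀ EP EM (leviSubgroup 𝔤) P M) (x : M) (i : ℤ) :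
    adjointFibre Q x →ₗ[ℝ] adjointFibre Q x where
  toFun f := ⟨fun u => 𝔤.proj i (f.1 u), fun u g => by
    change 𝔤.proj i (f.1 (Q.fibreAct u g)) = Ad _ (𝔤.proj i (f.1 u))
    rw [f.2 u g]
    exact 𝔤.proj_comm (f := (Ad ((g⁻¹ : leviSubgroup 𝔤) : G)).toLinearMap)
      (Ad_mem_part 𝔤 g⁻¹) i (f.1 u)⟩
  map_add' f f' := Subtype.ext <| funext fun u => map_add (𝔤.proj i) (f.1 u) (f'.1 u)
  map_smul' c f := Subtype.ext <| funext fun u => map_smul (𝔤.proj i) c (f.1 u)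

/-- The projection of `A_-` onto its component of degree `i`, as an endomorphism of `A_-`. -/
def adjointNegProj (Q : SmoothPrincipalBundle E₀ EP EM (leviSubgroup 𝔤) P M) (x : M) (i : ℤ) :
    adjointNeg Q x →ₗ[ℝ] adjointNeg Q x :=
  (adjointProj Q x i).restrict fun f hf u => 𝔤.proj_mem_neg (f.1 u) (hf u)

/-- The homogeneous component `Φ^{(ℓ)}` of degree `ℓ` at the point `x` of
`Φ ∈ L(Λ²A_-, A)`: for `ξ ∈ A_i` and `η ∈ A_j` with `i, j < 0`, `Φ^{(ℓ)}(ξ, η)` is the component of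
`Φ(ξ, η)` in `A_{i+j+ℓ}`, and this is extended bilinearly. -/
def homogeneousComponent {Q : SmoothPrincipalBundle E₀ EP EM (leviSubgroup 𝔤) P M} {x : M}
    (Φ : adjointNeg Q x [⋀^Fin 2]→ₗ[ℝ] adjointFibre Q x) (l : ℤ) (ξ η : adjointNeg Q x) :
    adjointFibre Q x :=
  ∑ i ∈ Finset.Ico (-(k : ℤ)) 0, ∑ j ∈ Finset.Ico (-(k : ℤ)) 0,
    adjointProj Q x (i + j + l) (Φ ![adjointNegProj Q x i ξ, adjointNegProj Q x j η])

namespace WeylForm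

variable {Q : SmoothPrincipalBundle E₀ EP EM (leviSubgroup 𝔤) P M} {F : RegularFlagStructure Q}
  (τ : WeylForm F)

/-- The component `τ_- = τ_{-k} + ⋯ + τ_{-1}` of a Weyl form. -/
def neg (u : P) : TangentSpace 𝓘(ℝ, EP) u →ₗ[ℝ] GroupLieAlgebra 𝓘(ℝ, E) G :=
  𝔤.projNeg ∘ₗ (τ.form u).toLinearMap

/-- The component `τ_{≤0} = τ_{-k} + ⋯ + τ_0` of a Weyl form. -/
def nonpos (u : P) : TangentSpace 𝓘(ℝ, EP) u →ₗ[ℝ] GroupLieAlgebra 𝓘(ℝ, E) G :=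
  𝔤.projNonpos ∘ₗ (τ.form u).toLinearMap

/-- The component `τ_+ = τ_1 + ⋯ + τ_k` of a Weyl form. -/
def pos (u : P) : TangentSpace 𝓘(ℝ, EP) u →ₗ[ℝ] GroupLieAlgebra 𝓘(ℝ, E) G :=
  𝔤.projPos ∘ₗ (τ.form u).toLinearMap

/-- The Weyl curvature `W(ξ, η) = dτ(ξ, η) + [τ(ξ), τ(η)]` as a two-form on `P`. -/
def weylCurvatureForm (u : P) (ξ η : TangentSpace 𝓘(ℝ, EP) u) : GroupLieAlgebra 𝓘(ℝ, E) G :=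
  structureForm (fun v => (τ.form v).toLinearMap) u ξ η

/-- The total curvature `K = K_{≤0} + K_+` as a two-form on `P`, where
`K_{≤0} = dτ_{≤0} + [τ_{≤0}, τ_{≤0}]` and `K_+ = dτ_+ + [τ_+, τ_+]`. -/
def totalCurvatureForm (u : P) (ξ η : TangentSpace 𝓘(ℝ, EP) u) : GroupLieAlgebra 𝓘(ℝ, E) G :=
  structureForm τ.nonpos u ξ η + structureForm τ.pos u ξ η

/-- `Rho` is the Rho tensor of `τ`, i.e. the section of `L(A_-, A_+)` to which `τ_+` descends.
The identification of `T_xM` with the fibre of `A_-` makes `v` correspond to the equivariant map `ξ`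
with `ξ(u) = τ_-(v')` for all `u` over `x` and all lifts `v'` of `v` to `T_uP`. -/
def IsRhoTensor (Rho : ∀ x : M, adjointNeg Q x →ₗ[ℝ] adjointPos Q x) : Prop :=
  ∀ (x : M) (ξ : adjointNeg Q x) (u : Q.Fibre x) (v : TangentSpace 𝓘(ℝ, EP) u.1),
    τ.neg u.1 v = ξ.1.1 u → (Rho x ξ).1.1 u = τ.pos u.1 v

/-- `W` is the Weyl curvature of `τ` as a section of `L(Λ²A_-, A)`: the two-form on `P` descends to
`W`, i.e. `W(ξ, η)` may be computed at any `u` from arbitrary lifts to `T_uP` of the tangent vectors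
of `M` corresponding to `ξ` and `η`. -/
def IsWeylCurvature (W : ∀ x : M, adjointNeg Q x [⋀^Fin 2]→ₗ[ℝ] adjointFibre Q x) : Prop :=
  ∀ (x : M) (ξ η : adjointNeg Q x) (u : Q.Fibre x) (v w : TangentSpace 𝓘(ℝ, EP) u.1),
    τ.neg u.1 v = ξ.1.1 u → τ.neg u.1 w = η.1.1 u →
      (W x ![ξ, η]).1 u = τ.weylCurvatureForm u.1 v w

/-- `K` is the total curvature of `τ` as a section of `L(Λ²A_-, A)`: `K(ξ, η)` is computed at any `u`
from the horizontal lifts, with respect to the principal connection `τ_0`, of the tangent vectors of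
`M` corresponding to `ξ` and `η`. (A tangent vector `v` at `u` is such a lift if and only if
`τ_{≤0}(v) = ξ(u)`. The two-form `dτ_+` on `P` is not horizontal, so that arbitrary lifts are not
possible here; on horizontal lifts it is the covariant exterior derivative of `τ_+`.) -/
def IsTotalCurvature (K : ∀ x : M, adjointNeg Q x [⋀^Fin 2]→ₗ[ℝ] adjointFibre Q x) : Prop :=
  ∀ (x : M) (ξ η : adjointNeg Q x) (u : Q.Fibre x) (v w : TangentSpace 𝓘(ℝ, EP) u.1),
    τ.nonpos u.1 v = ξ.1.1 u → τ.nonpos u.1 w = η.1.1 u →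
      (K x ![ξ, η]).1 u = τ.totalCurvatureForm u.1 v w

end WeylForm

end Flags

end

/-! The formula itself is algebra. On a horizontal lift the Weyl form is `τ = τ_{≤0} + τ_+`, where
`τ_{≤0}` reads off `ξ(u)` and `τ_+` reads off `P(ξ)(u)`. Since `dτ_{≤0} + dτ_+ = dτ`, the forms
defining `W` and `K` differ only in the brackets: expanding `[τ, τ]` produces, besides the two
brackets kept in `K`, the mixed terms `[τ_+, τ_{≤0}]`, which are the two brackets with `P`
(`weylBilin_eq_totalBilin`). The statement on homogeneous components follows because `P` has values
of positive degree.

The work lies in showing that the three objects exist and are unique. At every `u`, `τ_{≤0}` maps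
`T_uP` isomorphically onto `𝔤_{≤0}` (`injective_nonpos`, `exists_nonpos_eq`): the frames control the
negative degrees step by step along the filtration, and the fundamental fields control degree `0`.
Hence horizontal lifts exist, are unique, and are permuted by the right action. Existence gives
uniqueness of `P`, `K`, `W`; uniqueness of the lifts and equivariance of `τ` and `dτ` give existence
of `K`.

Since `P` and `W` are described by arbitrary lifts, they also require that `τ_+` and `dτ + [τ, τ]`
vanish on vertical vectors. For `τ_+` this holds because fundamental vectors have `τ`-values in
degree `0`. For the two-form it is the infinitesimal equivariance `dτ(ζ_A, ·) = -[A, τ]`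
(`extDerivForm_fundamental`), obtained by differentiating `Ad(g⁻¹)` at `1`.

Two facts about Lie groups carry this: the derivative of `Ad` at `1` is `ad`
(`hasFDerivAt_AdModel_chart`), and the Lie algebra of `G₀` is exactly `𝔤_0`
(`IsLieSubgroup.leviDeriv_mem`, `IsLieSubgroup.exists_leviDeriv_eq`). One inclusion of the latter
uses that a semisimple Lie algebra has trivial centre, the other that `Ad` preserves the grading
along integral curves of left invariant fields of degree `0`. -/

noncomputable section

/-! ### Derivatives between manifolds, read as maps of model spaces -/

section ModelDerivative

open Topology Filter

variable {E₁ : Type*} [NormedAddCommGroup E₁] [NormedSpace ℝ E₁]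
  {E₂ : Type*} [NormedAddCommGroup E₂] [NormedSpace ℝ E₂]
  {E₃ : Type*} [NormedAddCommGroup E₃] [NormedSpace ℝ E₃]
  {M₁ : Type*} [TopologicalSpace M₁] [ChartedSpace E₁ M₁]
  {M₂ : Type*} [TopologicalSpace M₂] [ChartedSpace E₂ M₂]
  {M₃ : Type*} [TopologicalSpace M₃] [ChartedSpace E₃ M₃]

variable (E₁ E₂) in
/-- The derivative of a map between manifolds, as a map between their model spaces. -/
def mfderivModel (f : M₁ → M₂) (x : M₁) : E₁ →L[ℝ] E₂ :=
  mfderiv 𝓘(ℝ, E₁) 𝓘(ℝ, E₂) f x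

/-- The derivative of `f` at `x` is the map `f'` between the model spaces. -/
def HasModelDerivAt (f : M₁ → M₂) (x : M₁) (f' : E₁ →L[ℝ] E₂) : Prop :=
  HasMFDerivAt 𝓘(ℝ, E₁) 𝓘(ℝ, E₂) f x f'

theorem MDifferentiableAt.hasModelDerivAt {f : M₁ → M₂} {x : M₁}
    (hf : MDifferentiableAt 𝓘(ℝ, E₁) 𝓘(ℝ, E₂) f x) : HasModelDerivAt f x (mfderivModel E₁ E₂ f x) :=
  hf.hasMFDerivAt

theorem HasModelDerivAt.continuousAt {f : M₁ → M₂} {x : M₁} {f' : E₁ →L[ℝ] E₂}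
    (h : HasModelDerivAt f x f') : ContinuousAt f x := h.1

theorem HasModelDerivAt.eq {f : M₁ → M₂} {x : M₁} {f' : E₁ →L[ℝ] E₂}
    (h : HasModelDerivAt f x f') : mfderivModel E₁ E₂ f x = f' := HasMFDerivAt.mfderiv h

/-- The intermediate point enters through an equation: derivatives are maps of model spaces here, so
no transport between tangent spaces is needed when two expressions denote the same point. -/
theorem HasModelDerivAt.comp {g : M₂ → M₃} {f : M₁ → M₂} {x : M₁} {y : M₂} {g' : E₂ →L[ℝ] E₃}
    {f' : E₁ →L[ℝ] E₂} (hg : HasModelDerivAt g y g') (hf : HasModelDerivAt f x f')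
    (hy : f x = y) : HasModelDerivAt (fun z => g (f z)) x (g'.comp f') := by
  subst hy
  exact HasMFDerivAt.comp x hg hf

theorem HasModelDerivAt.congr {f g : M₁ → M₂} {x : M₁} {f' : E₁ →L[ℝ] E₂}
    (h : HasModelDerivAt f x f') (hg : g =ᶠ[𝓝 x] f) : HasModelDerivAt g x f' :=
  HasMFDerivAt.congr_of_eventuallyEq h hg

theorem hasModelDerivAt_iff_hasFDerivAt {f : E₁ → E₂} {x : E₁} {f' : E₁ →L[ℝ] E₂} :
    HasModelDerivAt f x f' ↔ HasFDerivAt f f' x := hasMFDerivAt_iff_hasFDerivAt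

theorem hasModelDerivAt_id (x : M₁) : HasModelDerivAt (fun y : M₁ => y) x
    (ContinuousLinearMap.id ℝ E₁) := hasMFDerivAt_id x

theorem hasModelDerivAt_const (c : M₂) (x : M₁) :
    HasModelDerivAt (fun _ : M₁ => c) x (0 : E₁ →L[ℝ] E₂) := hasMFDerivAt_const c x

section Charts

variable [IsManifold 𝓘(ℝ, E₁) 1 M₁]

theorem hasModelDerivAt_extChartAt {x y : M₁} (hy : y ∈ (extChartAt 𝓘(ℝ, E₁) x).source) :
    HasModelDerivAt (extChartAt 𝓘(ℝ, E₁) x) y (mfderivModel E₁ E₁ (extChartAt 𝓘(ℝ, E₁) x) y) :=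
  (mdifferentiableAt_extChartAt (I := 𝓘(ℝ, E₁)) (by simpa using hy)).hasModelDerivAt

theorem hasModelDerivAt_extChartAt_symm {x : M₁} {y : E₁}
    (hy : y ∈ (extChartAt 𝓘(ℝ, E₁) x).target) :
    HasModelDerivAt (extChartAt 𝓘(ℝ, E₁) x).symm y
      (mfderivModel E₁ E₁ (extChartAt 𝓘(ℝ, E₁) x).symm y) := by
  have h := mdifferentiableWithinAt_extChartAt_symm (I := 𝓘(ℝ, E₁)) hy
  rw [modelWithCornersSelf_coe, Set.range_id, mdifferentiableWithinAt_univ] at h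
  exact h.hasModelDerivAt

theorem mfderivModel_extChartAt_self (x : M₁) :
    mfderivModel E₁ E₁ (extChartAt 𝓘(ℝ, E₁) x) x = ContinuousLinearMap.id ℝ E₁ :=
  mfderiv_extChartAt_self (H := E₁) (I := 𝓘(ℝ, E₁)) (x := x)

theorem hasModelDerivAt_extChartAt_self (x : M₁) :
    HasModelDerivAt (extChartAt 𝓘(ℝ, E₁) x) x (ContinuousLinearMap.id ℝ E₁) := by
  rw [← mfderivModel_extChartAt_self x]
  exact hasModelDerivAt_extChartAt (mem_extChartAt_source (I := 𝓘(ℝ, E₁)) x)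

theorem hasModelDerivAt_extChartAt_symm_self (x : M₁) :
    HasModelDerivAt (extChartAt 𝓘(ℝ, E₁) x).symm (extChartAt 𝓘(ℝ, E₁) x x)
      (ContinuousLinearMap.id ℝ E₁) := by
  have h' : mfderivModel E₁ E₁ (extChartAt 𝓘(ℝ, E₁) x).symm (extChartAt 𝓘(ℝ, E₁) x x) =
      ContinuousLinearMap.id ℝ E₁ := by
    have h := mfderivWithin_range_extChartAt_symm (H := E₁) (I := 𝓘(ℝ, E₁)) (x := x)
    rw [modelWithCornersSelf_coe, Set.range_id, mfderivWithin_univ] at h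
    exact h
  rw [← h']
  exact hasModelDerivAt_extChartAt_symm (mem_extChartAt_target (I := 𝓘(ℝ, E₁)) x)

theorem mfderivModel_symm_comp_extChartAt {x : M₁} {y : E₁}
    (hy : y ∈ (extChartAt 𝓘(ℝ, E₁) x).target) :
    (mfderivModel E₁ E₁ (extChartAt 𝓘(ℝ, E₁) x).symm y).comp
      (mfderivModel E₁ E₁ (extChartAt 𝓘(ℝ, E₁) x) ((extChartAt 𝓘(ℝ, E₁) x).symm y)) =
      ContinuousLinearMap.id ℝ E₁ := by
  have h := mfderivWithin_extChartAt_symm_comp_mfderiv_extChartAt (I := 𝓘(ℝ, E₁)) hy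
  rw [modelWithCornersSelf_coe, Set.range_id, mfderivWithin_univ] at h
  exact h

/-- The derivative of a map, expressed in charts. -/
theorem HasModelDerivAt.hasFDerivAt_chart [IsManifold 𝓘(ℝ, E₂) 1 M₂] {x : M₁} {f : M₁ → M₂}
    {a : M₂} {f' : E₁ →L[ℝ] E₂} (hf : HasModelDerivAt f x f')
    (ha : f x ∈ (extChartAt 𝓘(ℝ, E₂) a).source) :
    HasFDerivAt (fun y => extChartAt 𝓘(ℝ, E₂) a (f ((extChartAt 𝓘(ℝ, E₁) x).symm y)))
      ((mfderivModel E₂ E₂ (extChartAt 𝓘(ℝ, E₂) a) (f x)).comp f') (extChartAt 𝓘(ℝ, E₁) x x) := by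
  have h1 := hf.comp (hasModelDerivAt_extChartAt_symm_self x) (extChartAt_to_inv (I := 𝓘(ℝ, E₁)) x)
  rw [ContinuousLinearMap.comp_id] at h1
  exact hasModelDerivAt_iff_hasFDerivAt.1 ((hasModelDerivAt_extChartAt ha).comp h1
    (congrArg f (extChartAt_to_inv (I := 𝓘(ℝ, E₁)) x)))

end Charts

theorem contDiffAt_of_contMDiffAt_prod {n : ℕ∞ω} {f : E₁ × E₂ → E₃} {p : E₁ × E₂}
    (hf : ContMDiffAt (𝓘(ℝ, E₁).prod 𝓘(ℝ, E₂)) 𝓘(ℝ, E₃) n f p) : ContDiffAt ℝ n f p := by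
  rw [← modelWithCornersSelf_prod, chartedSpaceSelf_prod] at hf
  exact hf.contDiffAt

theorem fderiv_prodMk_right {f : E₁ × E₂ → E₃} {x : E₁} {y : E₂}
    (hf : DifferentiableAt ℝ f (x, y)) (Z : E₂) :
    fderiv ℝ (fun y' => f (x, y')) y Z = fderiv ℝ f (x, y) (0, Z) := by
  have h := hf.hasFDerivAt.comp y (hasFDerivAt_prodMk_right x y)
  have h' : fderiv ℝ (fun y' => f (x, y')) y = _ := h.fderiv
  rw [h']
  simp

theorem fderiv_prodMk_left {f : E₁ × E₂ → E₃} {x : E₁} {y : E₂}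
    (hf : DifferentiableAt ℝ f (x, y)) (Z : E₁) :
    fderiv ℝ (fun x' => f (x', y)) x Z = fderiv ℝ f (x, y) (Z, 0) := by
  have h := hf.hasFDerivAt.comp (f := fun x' => (x', y)) x (hasFDerivAt_prodMk_left x y)
  have h' : fderiv ℝ (fun x' => f (x', y)) x = _ := h.fderiv
  rw [h']
  simp

variable {f : E₁ × E₁ → E₂} {e : E₁}

theorem ContDiffAt.eventually_differentiableAt_left
    (hf : ContDiffAt ℝ ∞ f (e, e)) : ∀ᶠ x in 𝓝 e, DifferentiableAt ℝ f (x, e) := by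
  have h := (hf.of_le (m := 1) (by exact ENat.LEInfty.out)).eventually (by simp)
  have hc : ContinuousAt (fun x : E₁ => (x, e)) e := by fun_prop
  filter_upwards [hc.eventually h] with x hx using hx.differentiableAt (by simp)

theorem ContDiffAt.eventually_differentiableAt_right
    (hf : ContDiffAt ℝ ∞ f (e, e)) : ∀ᶠ x in 𝓝 e, DifferentiableAt ℝ f (e, x) := by
  have h := (hf.of_le (m := 1) (by exact ENat.LEInfty.out)).eventually (by simp)
  have hc : ContinuousAt (fun x : E₁ => (e, x)) e := by fun_prop
  filter_upwards [hc.eventually h] with x hx using hx.differentiableAt (by simp)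

/-- On a slice only one block of the second derivative is seen. For the multiplication of a Lie
group these blocks encode the bracket. -/
theorem ContDiffAt.hasFDerivAt_fderiv_left (hf : ContDiffAt ℝ ∞ f (e, e)) :
    HasFDerivAt (fun x => fderiv ℝ f (x, e))
      ((fderiv ℝ (fderiv ℝ f) (e, e)).comp (ContinuousLinearMap.inl ℝ E₁ E₁)) e := by
  have h : DifferentiableAt ℝ (fderiv ℝ f) (e, e) :=
    (hf.fderiv_right (m := 1) (by rw [one_add_one_eq_two]; exact ENat.LEInfty.out)).differentiableAt
      (by simp)
  exact h.hasFDerivAt.comp (f := fun x' => (x', e)) e (hasFDerivAt_prodMk_left e e)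

theorem ContDiffAt.hasFDerivAt_fderiv_right (hf : ContDiffAt ℝ ∞ f (e, e)) :
    HasFDerivAt (fun x => fderiv ℝ f (e, x))
      ((fderiv ℝ (fderiv ℝ f) (e, e)).comp (ContinuousLinearMap.inr ℝ E₁ E₁)) e := by
  have h : DifferentiableAt ℝ (fderiv ℝ f) (e, e) :=
    (hf.fderiv_right (m := 1) (by rw [one_add_one_eq_two]; exact ENat.LEInfty.out)).differentiableAt
      (by simp)
  exact h.hasFDerivAt.comp e (hasFDerivAt_prodMk_right e e)

end ModelDerivative

/-! ### The derivative of `Ad` at the unit, from the second derivative of the multiplication -/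

section AdjointDerivative

open Topology Filter

variable {E : Type*} [NormedAddCommGroup E] [NormedSpace ℝ E]
  {G : Type*} [TopologicalSpace G] [ChartedSpace E G] [Group G]

variable (E G) in
/-- The multiplication of a Lie group in the chart at `1`. -/
def mulChart (p : E × E) : E :=
  extChartAt 𝓘(ℝ, E) (1 : G)
    ((extChartAt 𝓘(ℝ, E) (1 : G)).symm p.1 * (extChartAt 𝓘(ℝ, E) (1 : G)).symm p.2)

variable (E G) in
/-- The conjugation `(g, h) ↦ g h g⁻¹` of a Lie group in the chart at `1`. -/
def conjChart (p : E × E) : E :=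
  extChartAt 𝓘(ℝ, E) (1 : G)
    ((extChartAt 𝓘(ℝ, E) (1 : G)).symm p.1 * (extChartAt 𝓘(ℝ, E) (1 : G)).symm p.2 *
      ((extChartAt 𝓘(ℝ, E) (1 : G)).symm p.1)⁻¹)

variable (E G) in
/-- The image of the unit element in the chart at `1`. -/
def unitChart : E := extChartAt 𝓘(ℝ, E) (1 : G) 1

/-- The adjoint action as an endomorphism of the model space. -/
def AdModel (g : G) : E →L[ℝ] E := Ad g

theorem extChartAt_symm_unit : (extChartAt 𝓘(ℝ, E) (1 : G)).symm (unitChart E G) = 1 :=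
  extChartAt_to_inv (I := 𝓘(ℝ, E)) (1 : G)

theorem mulChart_unit_right {x : E} (hx : x ∈ (extChartAt 𝓘(ℝ, E) (1 : G)).target) :
    mulChart E G (x, unitChart E G) = x := by
  simp only [mulChart, extChartAt_symm_unit, mul_one]
  exact (extChartAt 𝓘(ℝ, E) (1 : G)).right_inv hx

theorem mulChart_unit_left {x : E} (hx : x ∈ (extChartAt 𝓘(ℝ, E) (1 : G)).target) :
    mulChart E G (unitChart E G, x) = x := by
  simp only [mulChart, extChartAt_symm_unit, one_mul]
  exact (extChartAt 𝓘(ℝ, E) (1 : G)).right_inv hx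

variable [LieGroup 𝓘(ℝ, E) ∞ G]

variable (E G) in
theorem isManifold_infty_of_lieGroup : IsManifold 𝓘(ℝ, E) ∞ G :=
  (inferInstance : ContMDiffMul 𝓘(ℝ, E) ∞ G).toIsManifold

variable (E G) in
theorem isManifold_one_of_lieGroup : IsManifold 𝓘(ℝ, E) 1 G :=
  have := isManifold_infty_of_lieGroup E G
  IsManifold.of_le (n := ∞) ENat.LEInfty.out

theorem hasModelDerivAt_conj (g : G) :
    HasModelDerivAt (fun h : G => g * h * g⁻¹) 1 (AdModel g : E →L[ℝ] E) :=
  (mdifferentiable_conj g 1).hasModelDerivAt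

theorem hasModelDerivAt_mul_left (g h : G) :
    HasModelDerivAt (fun y : G => g * y) h (mfderivModel E E (fun y : G => g * y) h) :=
  ((contMDiff_mul_left (I := 𝓘(ℝ, E)) (n := ∞)).mdifferentiable (by simp) h).hasModelDerivAt

theorem contMDiffAt_extChartAt_symm_unit :
    ContMDiffAt 𝓘(ℝ, E) 𝓘(ℝ, E) ∞ (extChartAt 𝓘(ℝ, E) (1 : G)).symm (unitChart E G) :=
  have := isManifold_infty_of_lieGroup E G
  (contMDiffOn_extChartAt_symm (n := ∞) (I := 𝓘(ℝ, E)) (1 : G)).contMDiffAt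
    (extChartAt_target_mem_nhds (1 : G))

theorem contDiffAt_mulChart :
    ContDiffAt ℝ ∞ (mulChart E G) (unitChart E G, unitChart E G) := by
  have := isManifold_infty_of_lieGroup E G
  apply contDiffAt_of_contMDiffAt_prod
  have hs := contMDiffAt_extChartAt_symm_unit (E := E) (G := G)
  have h1 : ContMDiffAt (𝓘(ℝ, E).prod 𝓘(ℝ, E)) 𝓘(ℝ, E) ∞
      (fun p : E × E => (extChartAt 𝓘(ℝ, E) (1 : G)).symm p.1) (unitChart E G, unitChart E G) :=
    ContMDiffAt.comp (unitChart E G, unitChart E G) hs contMDiffAt_fst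
  have h2 : ContMDiffAt (𝓘(ℝ, E).prod 𝓘(ℝ, E)) 𝓘(ℝ, E) ∞
      (fun p : E × E => (extChartAt 𝓘(ℝ, E) (1 : G)).symm p.2) (unitChart E G, unitChart E G) :=
    ContMDiffAt.comp (unitChart E G, unitChart E G) hs contMDiffAt_snd
  refine ContMDiffAt.comp (unitChart E G, unitChart E G) ?_ (h1.mul h2)
  simp only [extChartAt_symm_unit, mul_one]
  exact contMDiffAt_extChartAt

theorem contDiffAt_conjChart :
    ContDiffAt ℝ ∞ (conjChart E G) (unitChart E G, unitChart E G) := by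
  have := isManifold_infty_of_lieGroup E G
  apply contDiffAt_of_contMDiffAt_prod
  have hs := contMDiffAt_extChartAt_symm_unit (E := E) (G := G)
  have h1 : ContMDiffAt (𝓘(ℝ, E).prod 𝓘(ℝ, E)) 𝓘(ℝ, E) ∞
      (fun p : E × E => (extChartAt 𝓘(ℝ, E) (1 : G)).symm p.1) (unitChart E G, unitChart E G) :=
    ContMDiffAt.comp (unitChart E G, unitChart E G) hs contMDiffAt_fst
  have h2 : ContMDiffAt (𝓘(ℝ, E).prod 𝓘(ℝ, E)) 𝓘(ℝ, E) ∞
      (fun p : E × E => (extChartAt 𝓘(ℝ, E) (1 : G)).symm p.2) (unitChart E G, unitChart E G) :=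
    ContMDiffAt.comp (unitChart E G, unitChart E G) hs contMDiffAt_snd
  refine ContMDiffAt.comp (unitChart E G, unitChart E G) ?_ ((h1.mul h2).mul h1.inv)
  simp only [extChartAt_symm_unit, mul_one, inv_one]
  exact contMDiffAt_extChartAt

/-- Conjugation fixes `1`, where the chart has derivative the identity, so no chart factors remain.
-/
theorem hasFDerivAt_conj_chart (g : G) :
    HasFDerivAt (fun y => extChartAt 𝓘(ℝ, E) (1 : G)
      (g * (extChartAt 𝓘(ℝ, E) (1 : G)).symm y * g⁻¹)) (AdModel g) (unitChart E G) := by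
  have := isManifold_one_of_lieGroup E G
  have e : g * 1 * g⁻¹ = 1 := by simp
  have h := (hasModelDerivAt_conj (E := E) g).hasFDerivAt_chart (a := (1 : G))
    (by rw [e]; exact mem_extChartAt_source (1 : G))
  rw [e, mfderivModel_extChartAt_self, ContinuousLinearMap.id_comp] at h
  exact h

/-- This is where differentiability of `Ad` comes from: `Ad` is a partial derivative of the smooth
map `(g, h) ↦ g h g⁻¹`. -/
theorem eventually_AdModel_eq :
    ∀ᶠ x in 𝓝 (unitChart E G), AdModel ((extChartAt 𝓘(ℝ, E) (1 : G)).symm x) =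
      (fderiv ℝ (conjChart E G) (x, unitChart E G)).comp (ContinuousLinearMap.inr ℝ E E) := by
  filter_upwards [(contDiffAt_conjChart (E := E) (G := G)).eventually_differentiableAt_left]
    with x hx
  ext Z
  rw [← (hasFDerivAt_conj_chart _).fderiv]
  exact fderiv_prodMk_right hx Z

/-- A left invariant field at `g` is the derivative of `h ↦ g h` at `1`. Its chart expression is
thus a partial derivative of the multiplication, so that brackets of such fields become second
derivatives. -/
theorem mulInvariantVectorField_chart {x : E}
    (hx : x ∈ (extChartAt 𝓘(ℝ, E) (1 : G)).target)
    (hd : DifferentiableAt ℝ (mulChart E G) (x, unitChart E G)) (X : GroupLieAlgebra 𝓘(ℝ, E) G) :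
    (VectorField.mpullbackWithin 𝓘(ℝ, E) 𝓘(ℝ, E) (extChartAt 𝓘(ℝ, E) (1 : G)).symm
      (mulInvariantVectorField X) (Set.range 𝓘(ℝ, E)) x : E) =
      fderiv ℝ (mulChart E G) (x, unitChart E G) (0, lieToModel X) := by
  have := isManifold_one_of_lieGroup E G
  rw [VectorField.mpullbackWithin_apply]
  rw [ContinuousLinearMap.inverse_eq
    (mfderivWithin_extChartAt_symm_comp_mfderiv_extChartAt hx)
    (mfderiv_extChartAt_comp_mfderivWithin_extChartAt_symm hx)]
  rw [← fderiv_prodMk_right hd]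
  have e : (extChartAt 𝓘(ℝ, E) (1 : G)).symm x * 1 = (extChartAt 𝓘(ℝ, E) (1 : G)).symm x := by simp
  have h := (hasModelDerivAt_mul_left (E := E) ((extChartAt 𝓘(ℝ, E) (1 : G)).symm x)
    1).hasFDerivAt_chart (a := (1 : G))
    (by rw [e]; exact (extChartAt 𝓘(ℝ, E) (1 : G)).map_target hx)
  rw [e] at h
  exact (DFunLike.congr_fun h.fderiv (lieToModel X)).symm

theorem fderiv_mulChart_inl (X : E) :
    fderiv ℝ (mulChart E G) (unitChart E G, unitChart E G) (X, 0) = X := by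
  rw [← fderiv_prodMk_left ((contDiffAt_mulChart).differentiableAt (by simp))]
  have h : (fun x => mulChart E G (x, unitChart E G)) =ᶠ[𝓝 (unitChart E G)] id := by
    filter_upwards [extChartAt_target_mem_nhds (I := 𝓘(ℝ, E)) (1 : G)] with x hx
      using mulChart_unit_right hx
  rw [h.fderiv_eq, fderiv_id]
  rfl

theorem fderiv_mulChart_inr (X : E) :
    fderiv ℝ (mulChart E G) (unitChart E G, unitChart E G) (0, X) = X := by
  rw [← fderiv_prodMk_right ((contDiffAt_mulChart).differentiableAt (by simp))]
  have h : (fun x => mulChart E G (unitChart E G, x)) =ᶠ[𝓝 (unitChart E G)] id := by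
    filter_upwards [extChartAt_target_mem_nhds (I := 𝓘(ℝ, E)) (1 : G)] with x hx
      using mulChart_unit_left hx
  rw [h.fderiv_eq, fderiv_id]
  rfl

/-- The Lie bracket of `T₁G` in terms of the second derivative of the multiplication. -/
theorem lieToModel_lie [CompleteSpace E] (X Z : GroupLieAlgebra 𝓘(ℝ, E) G) :
    lieToModel ⁅X, Z⁆ =
      fderiv ℝ (fderiv ℝ (mulChart E G)) (unitChart E G, unitChart E G)
        (lieToModel X, 0) (0, lieToModel Z) -
      fderiv ℝ (fderiv ℝ (mulChart E G)) (unitChart E G, unitChart E G)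
        (lieToModel Z, 0) (0, lieToModel X) := by
  have hM := isManifold_one_of_lieGroup E G
  have hm := contDiffAt_mulChart (E := E) (G := G)
  let V : GroupLieAlgebra 𝓘(ℝ, E) G → E → E := fun X x =>
    VectorField.mpullbackWithin 𝓘(ℝ, E) 𝓘(ℝ, E) (extChartAt 𝓘(ℝ, E) (1 : G)).symm
      (mulInvariantVectorField X) (Set.range 𝓘(ℝ, E)) x
  have hV : ∀ X : GroupLieAlgebra 𝓘(ℝ, E) G, V X =ᶠ[𝓝 (unitChart E G)]
      fun x => fderiv ℝ (mulChart E G) (x, unitChart E G) (0, lieToModel X) := fun X => by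
    filter_upwards [extChartAt_target_mem_nhds (I := 𝓘(ℝ, E)) (1 : G),
      hm.eventually_differentiableAt_left] with x hx hd using mulInvariantVectorField_chart hx hd X
  have hb : lieToModel ⁅X, Z⁆ = VectorField.lieBracket ℝ
      (fun x => fderiv ℝ (mulChart E G) (x, unitChart E G) (0, lieToModel X))
      (fun x => fderiv ℝ (mulChart E G) (x, unitChart E G) (0, lieToModel Z)) (unitChart E G) := by
    rw [← (hV X).lieBracket_vectorField_eq (hV Z), ← VectorField.lieBracketWithin_univ]
    have h : (⁅X, Z⁆ : GroupLieAlgebra 𝓘(ℝ, E) G) = _ :=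
      VectorField.mlieBracketWithin_apply
    rw [h, mfderiv_extChartAt_self (H := E) (I := 𝓘(ℝ, E)) (x := (1 : G))]
    have hs : (extChartAt 𝓘(ℝ, E) (1 : G)).symm ⁻¹' Set.univ ∩ Set.range 𝓘(ℝ, E) =
        Set.univ := by simp
    rw [hs]
    exact DFunLike.congr_fun (ContinuousLinearMap.inverse_id (R := ℝ) (M := E)) _
  have hd : ∀ w : E × E, HasFDerivAt (fun x => fderiv ℝ (mulChart E G) (x, unitChart E G) w)
      _ (unitChart E G) := fun w => hm.hasFDerivAt_fderiv_left.clm_apply (hasFDerivAt_const w _)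
  -- At the unit the two fields take the values `X` and `Z`, so the bracket is the derivative of the
  -- second field along `X` minus that of the first along `Z`.
  rw [hb, VectorField.lieBracket, (hd _).fderiv, (hd _).fderiv, fderiv_mulChart_inr,
    fderiv_mulChart_inr]
  simp

/-- The derivative of the adjoint action at `1`, in the chart at `1`. -/
theorem hasFDerivAt_AdModel_chart [CompleteSpace E] :
    ∃ D : E →L[ℝ] E →L[ℝ] E,
      HasFDerivAt (fun x => AdModel ((extChartAt 𝓘(ℝ, E) (1 : G)).symm x)) D (unitChart E G) ∧
      ∀ X Z : GroupLieAlgebra 𝓘(ℝ, E) G, D (lieToModel X) (lieToModel Z) = lieToModel ⁅X, Z⁆ := by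
  have hm := contDiffAt_mulChart (E := E) (G := G)
  have hc := contDiffAt_conjChart (E := E) (G := G)
  obtain ⟨D, hD⟩ : ∃ D : E →L[ℝ] E →L[ℝ] E,
      HasFDerivAt (fun x => AdModel ((extChartAt 𝓘(ℝ, E) (1 : G)).symm x)) D (unitChart E G) :=
    ⟨_, (hc.hasFDerivAt_fderiv_left.clm_comp
      (hasFDerivAt_const (ContinuousLinearMap.inr ℝ E E) _)).congr_of_eventuallyEq
        eventually_AdModel_eq⟩
  refine ⟨D, hD, fun X Z => ?_⟩
  -- differentiate the derivative of `m (g h g⁻¹, g) = m (g, h)` in `h`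
  have key : ∀ᶠ x in 𝓝 (unitChart E G), fderiv ℝ (mulChart E G) (unitChart E G, x)
      (AdModel ((extChartAt 𝓘(ℝ, E) (1 : G)).symm x) (lieToModel Z), 0) =
      fderiv ℝ (mulChart E G) (x, unitChart E G) (0, lieToModel Z) := by
    filter_upwards [extChartAt_target_mem_nhds (I := 𝓘(ℝ, E)) (1 : G),
      hm.eventually_differentiableAt_left, hm.eventually_differentiableAt_right] with x hx hl hr
    rw [← fderiv_prodMk_right hl, ← fderiv_prodMk_left hr]
    set g := (extChartAt 𝓘(ℝ, E) (1 : G)).symm x with hg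
    have h1 := hasFDerivAt_conj_chart (E := E) g
    have hv : extChartAt 𝓘(ℝ, E) (1 : G) (g * (extChartAt 𝓘(ℝ, E) (1 : G)).symm (unitChart E G) *
        g⁻¹) = unitChart E G := by
      rw [extChartAt_symm_unit, mul_one, mul_inv_cancel]; rfl
    have hr' : DifferentiableAt ℝ (fun y => mulChart E G (y, x))
        (extChartAt 𝓘(ℝ, E) (1 : G) (g * (extChartAt 𝓘(ℝ, E) (1 : G)).symm (unitChart E G) *
          g⁻¹)) := by
      rw [hv]
      exact hr.comp (f := fun y : E => (y, x)) (unitChart E G) (by fun_prop)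
    have h2 := hr'.hasFDerivAt.comp (unitChart E G) h1
    rw [hv] at h2
    have h3 : (fun y => mulChart E G (x, y)) =ᶠ[𝓝 (unitChart E G)]
        ((fun y => mulChart E G (y, x)) ∘ fun y => extChartAt 𝓘(ℝ, E) (1 : G)
          (g * (extChartAt 𝓘(ℝ, E) (1 : G)).symm y * g⁻¹)) := by
      have hcont : ContinuousAt (fun y => g * (extChartAt 𝓘(ℝ, E) (1 : G)).symm y * g⁻¹)
          (unitChart E G) := by
        have : IsTopologicalGroup G := topologicalGroup_of_lieGroup 𝓘(ℝ, E) ∞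
        exact ((continuousAt_extChartAt_symm (I := 𝓘(ℝ, E)) (1 : G)).const_mul g).mul_const g⁻¹
      have hs : (extChartAt 𝓘(ℝ, E) (1 : G)).source ∈
          𝓝 (g * (extChartAt 𝓘(ℝ, E) (1 : G)).symm (unitChart E G) * g⁻¹) := by
        rw [extChartAt_symm_unit, mul_one, mul_inv_cancel]
        exact extChartAt_source_mem_nhds (1 : G)
      filter_upwards [hcont.eventually hs] with y hy
      simp only [mulChart, Function.comp]
      rw [(extChartAt 𝓘(ℝ, E) (1 : G)).left_inv hy, ← hg]
      simp
    rw [h3.fderiv_eq, h2.fderiv]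
    rfl
  -- Now differentiate `key` in `g` along `X`. The right side gives `D²m(X, 0)(0, Z)`, the left side
  -- `D²m(0, X)(Z, 0) + D X Z`, because `Ad 1 = id` and the first partial derivative of `m` at the
  -- unit is the identity. Symmetry of `D²m` turns the difference into the bracket formula
  -- `lieToModel_lie`.
  have hl := hm.hasFDerivAt_fderiv_left.clm_apply
    (hasFDerivAt_const ((0, lieToModel Z) : E × E) (unitChart E G))
  have hr := hm.hasFDerivAt_fderiv_right.clm_apply
    ((hD.clm_apply (hasFDerivAt_const (lieToModel Z) (unitChart E G))).prodMk
      (hasFDerivAt_const (0 : E) (unitChart E G)))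
  have hu := DFunLike.congr_fun ((hr.congr_of_eventuallyEq
    (Filter.EventuallyEq.symm key)).unique hl) (lieToModel X)
  have hA : AdModel (1 : G) (lieToModel Z) = lieToModel Z := Ad_one Z
  have hsymm := (hm.isSymmSndFDerivAt (n := ∞)
    (by rw [minSmoothness_of_isRCLikeNormedField]; exact ENat.LEInfty.out)).eq
    (0, lieToModel X) (lieToModel Z, 0)
  rw [extChartAt_symm_unit] at hu
  simp [hA, fderiv_mulChart_inl] at hu
  rw [lieToModel_lie, ← hu, ← hsymm]
  abel

end AdjointDerivative

/-! ### Degrees and projections in a graded Lie algebra -/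

namespace KGrading

variable {k : ℕ} {L : Type*} [LieRing L] [LieAlgebra ℝ L] (𝔤 : KGrading k L)

theorem proj_mem_self {i : ℤ} {X : L} (hX : X ∈ 𝔤.part i) : 𝔤.proj i X = X := by
  rw [𝔤.proj_of_mem hX, if_pos rfl]

theorem proj_mem_ne {i j : ℤ} {X : L} (hX : X ∈ 𝔤.part i) (hij : i ≠ j) : 𝔤.proj j X = 0 := by
  rw [𝔤.proj_of_mem hX, if_neg hij]

@[elab_as_elim]
theorem homogeneous_induction {p : L → Prop} (mem : ∀ i, ∀ X ∈ 𝔤.part i, p X)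
    (zero : p 0) (add : ∀ X Y, p X → p Y → p (X + Y)) (X : L) : p X := by
  have hX : X ∈ ⨆ j, 𝔤.part j := by
    rw [𝔤.isInternal.submodule_iSup_eq_top]; trivial
  induction hX using Submodule.iSup_induction' with
  | mem j x hx => exact mem j x hx
  | zero => exact zero
  | add x y _ _ hx hy => exact add x y hx hy

theorem sum_proj (X : L) : ∑ i ∈ Finset.Icc (-(k : ℤ)) k, 𝔤.proj i X = X := by
  refine 𝔤.homogeneous_induction (fun i X hX => ?_) (by simp) (fun X Y hX hY => ?_) X
  · simp only [𝔤.proj_of_mem hX]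
    rw [Finset.sum_ite_eq]
    split_ifs with h
    · rfl
    · have h' : (k : ℤ) < |i| := by
        rw [Finset.mem_Icc, ← abs_le] at h
        exact not_le.1 h
      rw [𝔤.part_eq_bot i h', Submodule.mem_bot] at hX
      exact hX.symm
  · simp only [map_add, Finset.sum_add_distrib, hX, hY]

theorem proj_eq_zero_of_lt {i : ℤ} (hi : (k : ℤ) < |i|) (X : L) : 𝔤.proj i X = 0 := by
  have h := 𝔤.proj_mem i X
  rwa [𝔤.part_eq_bot i hi, Submodule.mem_bot] at h

theorem ext_proj {X Y : L} (h : ∀ i, 𝔤.proj i X = 𝔤.proj i Y) : X = Y := by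
  rw [← 𝔤.sum_proj X, ← 𝔤.sum_proj Y]
  exact Finset.sum_congr rfl fun i _ => h i

theorem mem_part_of_proj {i : ℤ} {X : L} (h : ∀ j, j ≠ i → 𝔤.proj j X = 0) : X ∈ 𝔤.part i := by
  have : X = 𝔤.proj i X := 𝔤.ext_proj fun j => by
    by_cases hj : j = i
    · subst hj; rw [𝔤.proj_mem_self (𝔤.proj_mem j X)]
    · rw [h j hj, 𝔤.proj_mem_ne (𝔤.proj_mem i X) (Ne.symm hj)]
  rw [this]
  exact 𝔤.proj_mem i X

theorem proj_proj (i j : ℤ) (X : L) : 𝔤.proj j (𝔤.proj i X) = if i = j then 𝔤.proj i X else 0 :=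
  𝔤.proj_of_mem (𝔤.proj_mem i X) j

theorem proj_sum_proj (s : Finset ℤ) (j : ℤ) (X : L) :
    𝔤.proj j ((∑ i ∈ s, 𝔤.proj i) X) = if j ∈ s then 𝔤.proj j X else 0 := by
  simp only [LinearMap.sum_apply, map_sum, proj_proj]
  rw [Finset.sum_ite_eq']

/-- The bound `-k` of the sum disappears from the criterion because components of degree beyond `±k`
are zero. -/
theorem proj_projNeg (j : ℤ) (X : L) :
    𝔤.proj j (𝔤.projNeg X) = if j < 0 then 𝔤.proj j X else 0 := by
  rw [projNeg, proj_sum_proj]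
  by_cases hj : (k : ℤ) < |j|
  · simp [𝔤.proj_eq_zero_of_lt hj]
  · have : j ∈ Finset.Ico (-(k : ℤ)) 0 ↔ j < 0 := by
      rw [not_lt, abs_le] at hj
      simp [hj.1]
    simp only [this]

theorem proj_projNonpos (j : ℤ) (X : L) :
    𝔤.proj j (𝔤.projNonpos X) = if j ≤ 0 then 𝔤.proj j X else 0 := by
  rw [projNonpos, proj_sum_proj]
  by_cases hj : (k : ℤ) < |j|
  · simp [𝔤.proj_eq_zero_of_lt hj]
  · have : j ∈ Finset.Icc (-(k : ℤ)) 0 ↔ j ≤ 0 := by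
      rw [not_lt, abs_le] at hj
      simp [hj.1]
    simp only [this]

theorem proj_projPos (j : ℤ) (X : L) :
    𝔤.proj j (𝔤.projPos X) = if 0 < j then 𝔤.proj j X else 0 := by
  rw [projPos, proj_sum_proj]
  by_cases hj : (k : ℤ) < |j|
  · simp [𝔤.proj_eq_zero_of_lt hj]
  · have : j ∈ Finset.Icc (1 : ℤ) k ↔ 0 < j := by
      rw [not_lt, abs_le] at hj
      simp [hj.2]
      omega
    simp only [this]

theorem projNonpos_add_projPos (X : L) : 𝔤.projNonpos X + 𝔤.projPos X = X :=
  𝔤.ext_proj fun j => by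
    rw [map_add, proj_projNonpos, proj_projPos]
    split_ifs <;> first | omega | simp

theorem projNonpos_eq (X : L) : 𝔤.projNonpos X = 𝔤.projNeg X + 𝔤.proj 0 X :=
  𝔤.ext_proj fun j => by
    rw [map_add, proj_projNonpos, proj_projNeg, proj_proj]
    split_ifs with h1 h2 h3 h3 <;> first | omega | simp
    subst h3; rfl

theorem mem_neg_iff {X : L} : X ∈ 𝔤.neg ↔ ∀ i, 0 ≤ i → 𝔤.proj i X = 0 := by
  constructor
  · intro hX i hi
    unfold neg at hX
    induction hX using Submodule.iSup_induction' with
    | mem j x hx =>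
      obtain ⟨j, hj⟩ := j
      refine 𝔤.proj_mem_ne hx fun h => ?_
      subst h
      exact absurd hj (not_lt.2 hi)
    | zero => simp
    | add x y _ _ hx hy => rw [map_add, hx, hy, add_zero]
  · intro h
    rw [← 𝔤.sum_proj X]
    refine Submodule.sum_mem _ fun i _ => ?_
    by_cases hi : 0 ≤ i
    · rw [h i hi]; exact zero_mem _
    · exact Submodule.mem_iSup_of_mem (⟨i, not_le.1 hi⟩ : Set.Iio (0 : ℤ)) (𝔤.proj_mem i X)

theorem mem_pos_iff {X : L} : X ∈ 𝔤.pos ↔ ∀ i, i ≤ 0 → 𝔤.proj i X = 0 := by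
  constructor
  · intro hX i hi
    unfold pos at hX
    induction hX using Submodule.iSup_induction' with
    | mem j x hx =>
      obtain ⟨j, hj⟩ := j
      refine 𝔤.proj_mem_ne hx fun h => ?_
      subst h
      exact absurd hj (not_lt.2 hi)
    | zero => simp
    | add x y _ _ hx hy => rw [map_add, hx, hy, add_zero]
  · intro h
    rw [← 𝔤.sum_proj X]
    refine Submodule.sum_mem _ fun i _ => ?_
    by_cases hi : i ≤ 0
    · rw [h i hi]; exact zero_mem _
    · exact Submodule.mem_iSup_of_mem (⟨i, not_le.1 hi⟩ : Set.Ioi (0 : ℤ)) (𝔤.proj_mem i X)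

theorem projPos_mem (X : L) : 𝔤.projPos X ∈ 𝔤.pos :=
  𝔤.mem_pos_iff.2 fun i hi => by rw [proj_projPos, if_neg (not_lt.2 hi)]

theorem projNeg_of_mem {X : L} (hX : X ∈ 𝔤.neg) : 𝔤.projNeg X = X :=
  𝔤.ext_proj fun j => by
    rw [proj_projNeg]
    split_ifs with h
    · rfl
    · exact (𝔤.mem_neg_iff.1 hX j (not_lt.1 h)).symm

/-- A linear endomorphism preserving every component commutes with finite sums of projections. -/
theorem sum_proj_comm (s : Finset ℤ) {f : L →ₗ[ℝ] L}
    (hf : ∀ i, ∀ X ∈ 𝔤.part i, f X ∈ 𝔤.part i) (X : L) :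
    (∑ i ∈ s, 𝔤.proj i) (f X) = f ((∑ i ∈ s, 𝔤.proj i) X) := by
  simp only [LinearMap.sum_apply, map_sum, 𝔤.proj_comm hf]

/-- The bracket with an element of `L_+` raises the degree of elements of `L_j`. -/
theorem proj_lie_pos_eq_zero {X Y : L} {j m : ℤ} (hX : X ∈ 𝔤.pos) (hY : Y ∈ 𝔤.part j)
    (hm : m ≤ j) : 𝔤.proj m ⁅X, Y⁆ = 0 := by
  unfold pos at hX
  induction hX using Submodule.iSup_induction' with
  | mem i x hx =>
    obtain ⟨i, hi⟩ := i
    rw [Set.mem_Ioi] at hi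
    exact 𝔤.proj_mem_ne (𝔤.lie_mem hx hY) (by dsimp only; omega)
  | zero => simp
  | add x y _ _ hx hy => rw [add_lie, map_add, hx, hy, add_zero]

/-- In a semisimple graded Lie algebra, an element whose adjoint action preserves every component
has degree `0`. -/
theorem mem_part_zero [LieAlgebra.IsSemisimple ℝ L] {X : L}
    (h : ∀ i, ∀ Y ∈ 𝔤.part i, ⁅X, Y⁆ ∈ 𝔤.part i) : X ∈ 𝔤.part 0 := by
  refine 𝔤.mem_part_of_proj fun j hj => ?_
  -- For `Y` of degree `i`, the component of `⁅X, Y⁆` in degree `i + j` is the bracket of `Y` with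
  -- the component of `X` in degree `j`. It vanishes since `⁅X, Y⁆` has degree `i` and `j ≠ 0`. So
  -- this component of `X` is central, hence zero.
  have key : ∀ Y : L, ⁅𝔤.proj j X, Y⁆ = 0 := fun Y => by
    refine 𝔤.homogeneous_induction (fun i Y hY => ?_) (lie_zero _) (fun X Y hX hY => ?_) Y
    · have h1 : ∀ X', 𝔤.proj (i + j) ⁅X', Y⁆ = ⁅𝔤.proj j X', Y⁆ := fun X' => by
        refine 𝔤.homogeneous_induction (fun m Z hZ => ?_) (by simp) (fun A B hA hB => ?_) X'
        · rw [𝔤.proj_of_mem (𝔤.lie_mem hZ hY), 𝔤.proj_of_mem hZ]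
          by_cases hm : m = j
          · subst hm; rw [if_pos (add_comm _ _), if_pos rfl]
          · rw [if_neg (by omega), if_neg hm, zero_lie]
        · rw [add_lie, map_add, map_add, add_lie, hA, hB]
      rw [← h1]
      exact 𝔤.proj_mem_ne (h i Y hY) (by omega)
    · rw [lie_add, hX, hY, add_zero]
  have hc : 𝔤.proj j X ∈ LieAlgebra.center ℝ L := fun Y => by
    rw [← lie_skew, key Y, neg_zero]
  rw [LieAlgebra.center_eq_bot] at hc
  simpa using hc

end KGrading

/-! ### Tangency to immersed submanifolds, and `Ad` along curves -/

section AdjointRepresentation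

open Topology Filter

/-- The velocity of a curve in an immersed submanifold, whose position in the submanifold is
continuous, is tangent to the submanifold. -/
theorem mem_range_of_hasDerivAt_comp {E₁ E₂ : Type*} [NormedAddCommGroup E₁] [NormedSpace ℝ E₁]
    [FiniteDimensional ℝ E₁] [NormedAddCommGroup E₂] [NormedSpace ℝ E₂] [FiniteDimensional ℝ E₂]
    {f : E₁ → E₂} {f' : E₁ →L[ℝ] E₂} {a : ℝ → E₁} {v : E₂}
    (hf : HasFDerivAt f f' (a 0)) (hinj : Function.Injective f') (ha : ContinuousAt a 0)
    (hv : HasDerivAt (fun t => f (a t)) v 0) : ∃ w, f' w = v := by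
  have hker : LinearMap.ker (f' : E₁ →ₗ[ℝ] E₂) = ⊥ := LinearMap.ker_eq_bot.2 hinj
  obtain ⟨g, hg⟩ := (f' : E₁ →ₗ[ℝ] E₂).exists_leftInverse_of_injective hker
  obtain ⟨C, -, hC⟩ := (f' : E₁ →ₗ[ℝ] E₂).exists_antilipschitzWith hker
  -- An injective linear map in finite dimension is bounded below, so increments of `a` are
  -- controlled by increments of `f ∘ a`. This lets continuity of `a` replace differentiability.
  have hO : (fun t => a t - a 0) =O[𝓝 0] fun t => f (a t) - f (a 0) :=
    (hf.isTheta_sub (hC.isUniformInducing f'.uniformContinuous).isInducing).isBigO_symm.comp_tendsto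
      ha
  have hO' : (fun t => a t - a 0) =O[𝓝 0] fun t : ℝ => t - 0 := hO.trans hv.isBigO_sub
  have ho : (fun t => f (a t) - f (a 0) - f' (a t - a 0)) =o[𝓝 0] fun t : ℝ => t - 0 :=
    (hf.isLittleO.comp_tendsto ha).trans_isBigO hO'
  -- The kernel of `q` is the range of `f'`, because `g` is a left inverse of `f'`. It remains to
  -- see `q v = 0`, where `q v` is the velocity of `q ∘ f ∘ a`; only the remainder of order `o(t)`
  -- survives `q`.
  let q : E₂ →L[ℝ] E₂ :=
    ContinuousLinearMap.id ℝ E₂ - f'.comp (LinearMap.toContinuousLinearMap g)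
  have hq : ∀ w, q (f' w) = 0 := fun w => by
    have h : g (f' w) = w := LinearMap.congr_fun hg w
    simp [q, h]
  have h0 : HasDerivAt (fun t => q (f (a t))) 0 0 := by
    rw [hasDerivAt_iff_isLittleO]
    have h := (q.isBigO_comp (fun t => f (a t) - f (a 0) - f' (a t - a 0)) (𝓝 0)).trans_isLittleO ho
    simpa only [map_sub, hq, sub_zero, smul_zero] using h
  have h1 : HasDerivAt (fun t => q (f (a t))) (q v) 0 := q.hasFDerivAt.comp_hasDerivAt 0 hv
  have h2 := h1.unique h0
  exact ⟨g v, (sub_eq_zero.1 h2).symm⟩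

variable {E : Type*} [NormedAddCommGroup E] [NormedSpace ℝ E]
  {G : Type*} [TopologicalSpace G] [ChartedSpace E G] [Group G] [LieGroup 𝓘(ℝ, E) ∞ G]

omit [LieGroup 𝓘(ℝ, E) ∞ G] in
theorem AdModel_one : AdModel (1 : G) = ContinuousLinearMap.id ℝ E :=
  ContinuousLinearMap.ext fun X => Ad_one X

theorem AdModel_mul (g h : G) : (AdModel (g * h) : E →L[ℝ] E) = (AdModel g).comp (AdModel h) :=
  ContinuousLinearMap.ext fun X => Ad_mul g h X

omit [LieGroup 𝓘(ℝ, E) ∞ G] in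
/-- The value at `g` of a left invariant vector field, as an element of the model space. -/
def leftField (X : GroupLieAlgebra 𝓘(ℝ, E) G) (g : G) : E := mulInvariantVectorField X g

/-- The derivative at `1` of left translations maps to invariant vector fields. -/
theorem mfderivModel_mul_left_inv (g : G) (X : GroupLieAlgebra 𝓘(ℝ, E) G) :
    mfderivModel E E (fun y : G => g⁻¹ * y) g (leftField X g) = lieToModel X := by
  have h := (hasModelDerivAt_mul_left (E := E) g⁻¹ g).comp (hasModelDerivAt_mul_left g 1)
    (mul_one g)
  have h' : HasModelDerivAt (fun z : G => g⁻¹ * (g * z)) 1 (ContinuousLinearMap.id ℝ E) := by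
    simp only [inv_mul_cancel_left]
    exact hasModelDerivAt_id 1
  exact DFunLike.congr_fun (h.eq.symm.trans h'.eq) (lieToModel X)

variable [CompleteSpace E]

variable (E G) in
/-- The adjoint representation of the Lie algebra `T₁G`, on the model space. -/
def adModel : E →L[ℝ] E →L[ℝ] E := (hasFDerivAt_AdModel_chart (E := E) (G := G)).choose

theorem adModel_apply (X Z : GroupLieAlgebra 𝓘(ℝ, E) G) :
    adModel E G (lieToModel X) (lieToModel Z) = lieToModel ⁅X, Z⁆ :=
  (hasFDerivAt_AdModel_chart (E := E) (G := G)).choose_spec.2 X Z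

/-- The derivative of `Ad` at `1` is `ad`. -/
theorem hasModelDerivAt_AdModel :
    HasModelDerivAt (AdModel : G → E →L[ℝ] E) 1 (adModel E G) := by
  have := isManifold_one_of_lieGroup E G
  have h := (hasFDerivAt_AdModel_chart (E := E) (G := G)).choose_spec.1
  have h' := (hasModelDerivAt_iff_hasFDerivAt.2 h).comp
    (hasModelDerivAt_extChartAt_self (1 : G)) rfl
  rw [ContinuousLinearMap.comp_id] at h'
  refine h'.congr ?_
  filter_upwards [extChartAt_source_mem_nhds (I := 𝓘(ℝ, E)) (1 : G)] with g hg
  rw [(extChartAt 𝓘(ℝ, E) (1 : G)).left_inv hg]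

/-- `Ad(g⁻¹)` is the inverse of `Ad(g)` in the algebra of endomorphisms, and inversion in this
algebra has derivative `-id` at `1`. -/
theorem hasModelDerivAt_AdModel_inv :
    HasModelDerivAt (fun g : G => (AdModel g⁻¹ : E →L[ℝ] E)) 1 (-adModel E G) := by
  have hu : ∀ g : G, (AdModel g⁻¹ : E →L[ℝ] E) = Ring.inverse (AdModel g) := fun g => by
    let U : (E →L[ℝ] E)ˣ := ⟨AdModel g, AdModel g⁻¹, by
      rw [ContinuousLinearMap.mul_def, ← AdModel_mul, mul_inv_cancel, AdModel_one]; rfl, by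
      rw [ContinuousLinearMap.mul_def, ← AdModel_mul, inv_mul_cancel, AdModel_one]; rfl⟩
    exact (Ring.inverse_unit U).symm
  simp only [hu]
  have h := (hasModelDerivAt_iff_hasFDerivAt.2
    (hasFDerivAt_ringInverse (𝕜 := ℝ) (1 : (E →L[ℝ] E)ˣ))).comp
    (hasModelDerivAt_AdModel (E := E) (G := G)) AdModel_one
  have e : -ContinuousLinearMap.mulLeftRight ℝ (E →L[ℝ] E) (↑(1 : (E →L[ℝ] E)ˣ)⁻¹)
      (↑(1 : (E →L[ℝ] E)ˣ)⁻¹) = -ContinuousLinearMap.id ℝ (E →L[ℝ] E) := by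
    refine ContinuousLinearMap.ext fun T => ?_
    simp
  rw [e, ContinuousLinearMap.neg_comp, ContinuousLinearMap.id_comp] at h
  exact h

/-- Write `Ad(γ(s)) = Ad(γ(t)) Ad(γ(t)⁻¹γ(s))`: the translated curve passes through `1` with
velocity `X`. Along an integral curve `Ad` therefore solves a linear differential equation. -/
theorem hasDerivAt_AdModel {γ : ℝ → G} {t : ℝ} {X : GroupLieAlgebra 𝓘(ℝ, E) G}
    (h : HasModelDerivAt γ t ((1 : ℝ →L[ℝ] ℝ).smulRight (leftField X (γ t)))) :
    HasDerivAt (fun s => (AdModel (γ s) : E →L[ℝ] E))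
      ((AdModel (γ t)).comp (adModel E G (lieToModel X))) t := by
  have h1 := hasModelDerivAt_AdModel.comp
    ((hasModelDerivAt_mul_left (E := E) (γ t)⁻¹ (γ t)).comp h rfl) (inv_mul_cancel (γ t))
  have h2 := hasModelDerivAt_iff_hasFDerivAt.1 h1
  have h3 := (hasFDerivAt_const (AdModel (γ t) : E →L[ℝ] E) t).clm_comp h2
  have e : (fun s => (AdModel (γ s) : E →L[ℝ] E)) =
      fun s => (AdModel (γ t)).comp (AdModel ((γ t)⁻¹ * γ s)) := by
    funext s
    rw [← AdModel_mul, mul_inv_cancel_left]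
  rw [e]
  convert h3.hasDerivAt using 1
  have h4 := mfderivModel_mul_left_inv (E := E) (γ t) X
  simp [h4]

variable [FiniteDimensional ℝ E]

omit [LieGroup 𝓘(ℝ, E) ∞ G] [CompleteSpace E] in
/-- A linear endomorphism of `T₁G` as an endomorphism of the model space. -/
def endModel (f : GroupLieAlgebra 𝓘(ℝ, E) G →ₗ[ℝ] GroupLieAlgebra 𝓘(ℝ, E) G) : E →L[ℝ] E :=
  LinearMap.toContinuousLinearMap (show E →ₗ[ℝ] E from f)

end AdjointRepresentation

/-! ### The Lie algebra of `G₀` is the degree `0` component -/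

section LeviSubgroup

open Topology Filter

variable {k : ℕ}
  {E : Type*} [NormedAddCommGroup E] [NormedSpace ℝ E] [CompleteSpace E]
  {G : Type*} [TopologicalSpace G] [ChartedSpace E G] [Group G] [LieGroup 𝓘(ℝ, E) ∞ G]
  {𝔤 : KGrading k (GroupLieAlgebra 𝓘(ℝ, E) G)}
  {E₀ : Type*} [NormedAddCommGroup E₀] [NormedSpace ℝ E₀] [ChartedSpace E₀ (leviSubgroup 𝔤)]

omit [CompleteSpace E] [LieGroup 𝓘(ℝ, E) ∞ G] in
/-- The identity map from the model space `E` of `G` to the Lie algebra `T₁G`. -/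
def modelToLie (X : E) : GroupLieAlgebra 𝓘(ℝ, E) G := X

variable (𝔤 E₀) in
/-- The derivative at `1` of the inclusion of the Levi subgroup, as a map of model spaces. -/
def leviDeriv : E₀ →L[ℝ] E := mfderivModel E₀ E (Subtype.val : leviSubgroup 𝔤 → G) 1

theorem IsLieSubgroup.hasModelDerivAt (h : IsLieSubgroup E₀ 𝔤) :
    HasModelDerivAt (Subtype.val : leviSubgroup 𝔤 → G) 1 (leviDeriv 𝔤 E₀) :=
  (h.contMDiff_val.mdifferentiable (by simp) 1).hasModelDerivAt

theorem IsLieSubgroup.injective_leviDeriv (h : IsLieSubgroup E₀ 𝔤) :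
    Function.Injective (leviDeriv 𝔤 E₀) := h.injective_mfderiv 1

variable [FiniteDimensional ℝ E]

/-- The elements of the Lie algebra of the Levi subgroup have degree `0`. -/
theorem IsLieSubgroup.leviDeriv_mem [LieAlgebra.IsSemisimple ℝ (GroupLieAlgebra 𝓘(ℝ, E) G)]
    (h : IsLieSubgroup E₀ 𝔤) (A : E₀) :
    modelToLie (G := G) (leviDeriv 𝔤 E₀ A) ∈ 𝔤.part 0 := by
  refine 𝔤.mem_part_zero fun i Y hY => 𝔤.mem_part_of_proj fun j hj => ?_
  -- `p` takes an endomorphism `T` to the component of `T Y` in degree `j ≠ i`. It vanishes on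
  -- `Ad(G₀)`, so its derivative, which gives the degree `j` component of `[A, Y]`, is zero.
  let p : (E →L[ℝ] E) →L[ℝ] E :=
    (endModel (𝔤.proj j)).comp (ContinuousLinearMap.apply ℝ E (lieToModel Y))
  have h1 := (hasModelDerivAt_iff_hasFDerivAt.2 (p.hasFDerivAt (x := AdModel (1 : G)))).comp
    (hasModelDerivAt_AdModel.comp h.hasModelDerivAt rfl) rfl
  have h2 : (fun g : leviSubgroup 𝔤 => p (AdModel (g : G))) = fun _ => 0 := by
    funext g
    exact 𝔤.proj_mem_ne (Ad_mem_part 𝔤 g i Y hY) (Ne.symm hj)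
  rw [h2] at h1
  have h3 := DFunLike.congr_fun (h1.eq.symm.trans (hasModelDerivAt_const _ _).eq) A
  have h4 : p (adModel E G (leviDeriv 𝔤 E₀ A)) = lieToModel (𝔤.proj j
      ⁅modelToLie (G := G) (leviDeriv 𝔤 E₀ A), Y⁆) :=
    congrArg (endModel (𝔤.proj j)) (adModel_apply (G := G) (modelToLie (leviDeriv 𝔤 E₀ A)) Y)
  exact h4.symm.trans h3

/-- Along an integral curve of the left invariant vector field generated by an element of degree
`0`, the adjoint action preserves the components of the grading. -/
theorem Ad_mem_part_of_curve {Y : GroupLieAlgebra 𝓘(ℝ, E) G} (hY : Y ∈ 𝔤.part 0) {γ : ℝ → G}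
    {ε : ℝ} (hε : 0 < ε) (hγ0 : γ 0 = 1)
    (hγ : ∀ t ∈ Set.Ioo (-ε) ε,
      HasModelDerivAt γ t ((1 : ℝ →L[ℝ] ℝ).smulRight (leftField Y (γ t))))
    {t : ℝ} (ht : t ∈ Set.Ioo (-ε) ε) {i : ℤ} {Z : GroupLieAlgebra 𝓘(ℝ, E) G}
    (hZ : Z ∈ 𝔤.part i) : Ad (γ t) Z ∈ 𝔤.part i := by
  refine 𝔤.mem_part_of_proj fun j hj => ?_
  -- The block of `Ad(γ(t))` from degree `i` to degree `j`. As `ad Y` commutes with the projections,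
  -- the block satisfies the linear equation `T' = T ∘ ad Y`; it starts at `0` because `j ≠ i`, so
  -- it stays `0`.
  let T : ℝ → E →L[ℝ] E := fun t =>
    (endModel (𝔤.proj j)).comp ((AdModel (γ t)).comp (endModel (𝔤.proj i)))
  let R : (E →L[ℝ] E) →L[ℝ] (E →L[ℝ] E) :=
    (ContinuousLinearMap.compL ℝ E E E).flip (adModel E G (lieToModel Y))
  have hcomm : (endModel (𝔤.proj i)).comp (adModel E G (lieToModel Y)) =
      (adModel E G (lieToModel Y)).comp (endModel (𝔤.proj i)) := by
    refine ContinuousLinearMap.ext fun X => ?_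
    have h := 𝔤.proj_comm (f := LieAlgebra.ad ℝ (GroupLieAlgebra 𝓘(ℝ, E) G) Y)
      (fun m X hX => by simpa using 𝔤.lie_mem hY hX) i (modelToLie X)
    have h1 := adModel_apply (G := G) Y (modelToLie X)
    have h2 := adModel_apply (G := G) Y (𝔤.proj i (modelToLie X))
    exact (congrArg (endModel (𝔤.proj i)) h1).trans ((congrArg lieToModel h).trans h2.symm)
  have hT : ∀ s ∈ Set.Ioo (-ε) ε, HasDerivAt T (R (T s)) s := fun s hs => by
    have h := (hasDerivAt_const s (endModel (𝔤.proj j))).clm_comp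
      ((hasDerivAt_AdModel (hγ s hs)).clm_comp (hasDerivAt_const s (endModel (𝔤.proj i))))
    convert h using 1
    simp [R, T, ContinuousLinearMap.comp_assoc, hcomm]
  have hT0 : T 0 = 0 := by
    refine ContinuousLinearMap.ext fun X => ?_
    have h : 𝔤.proj j (Ad (γ 0) (𝔤.proj i (modelToLie X))) = 0 := by
      rw [hγ0, Ad_one]
      exact 𝔤.proj_mem_ne (𝔤.proj_mem i _) (Ne.symm hj)
    exact h
  have huniq := ODE_solution_unique_of_mem_Ioo (v := fun _ => R) (s := fun _ => Set.univ)
    (K := ‖R‖₊) (f := T) (g := fun _ => 0) (t₀ := 0) (a := -ε) (b := ε)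
    (fun _ _ => R.lipschitz.lipschitzOnWith) ⟨by linarith, hε⟩
    (fun s hs => ⟨hT s hs, trivial⟩)
    (fun s _ => ⟨by rw [map_zero]; exact hasDerivAt_const s 0, trivial⟩) hT0
  have h := DFunLike.congr_fun (huniq ht) (lieToModel Z)
  have h1 : 𝔤.proj j (Ad (γ t) (𝔤.proj i Z)) = 0 := h
  rwa [𝔤.proj_mem_self hZ] at h1

/-- The definition of `G₀` asks for equality of subspaces; inclusion suffices because `Ad g` is
injective and the components are finite dimensional. -/
theorem mem_leviSubgroup_of_mem_part {g : G}
    (h : ∀ i, ∀ Z ∈ 𝔤.part i, Ad g Z ∈ 𝔤.part i) : g ∈ leviSubgroup 𝔤 := by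
  intro i
  have : FiniteDimensional ℝ (GroupLieAlgebra 𝓘(ℝ, E) G) := inferInstanceAs (FiniteDimensional ℝ E)
  refine Submodule.eq_of_le_of_finrank_eq ?_ ?_
  · rintro _ ⟨Z, hZ, rfl⟩
    exact h i Z hZ
  · have hinj : Function.Injective (Ad g).toLinearMap := fun X Y hXY => by
      have h1 := congrArg (Ad (E := E) g⁻¹) (show Ad g X = Ad g Y from hXY)
      rwa [← Ad_mul, ← Ad_mul, inv_mul_cancel, Ad_one, Ad_one] at h1
    exact (Submodule.equivMapOfInjective _ hinj _).finrank_eq.symm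

/-- Every element of degree `0` belongs to the Lie algebra of the Levi subgroup. -/
theorem IsLieSubgroup.exists_leviDeriv_eq [FiniteDimensional ℝ E₀]
    [LieGroup 𝓘(ℝ, E₀) ∞ (leviSubgroup 𝔤)]
    (h : IsLieSubgroup E₀ 𝔤) {Y : GroupLieAlgebra 𝓘(ℝ, E) G} (hY : Y ∈ 𝔤.part 0) :
    ∃ A : E₀, leviDeriv 𝔤 E₀ A = lieToModel Y := by
  have hM := isManifold_one_of_lieGroup E G
  have hM₀ := isManifold_one_of_lieGroup E₀ (leviSubgroup 𝔤)
  -- This local integral curve plays the role of `exp(tY)`.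
  obtain ⟨γ, hγ0, hγ⟩ := exists_isMIntegralCurveAt_of_contMDiffAt_boundaryless (I := 𝓘(ℝ, E))
    (x₀ := (1 : G)) (v := mulInvariantVectorField Y) 0
    ((contMDiffAt_mulInvariantVectorField Y).of_le
      (by rw [minSmoothness_of_isRCLikeNormedField]; exact one_le_two))
  obtain ⟨ε, hε, hball⟩ := Metric.eventually_nhds_iff_ball.1 hγ
  rw [Real.ball_eq_Ioo, zero_sub, zero_add] at hball
  have hγ' : ∀ t ∈ Set.Ioo (-ε) ε,
      HasModelDerivAt γ t ((1 : ℝ →L[ℝ] ℝ).smulRight (leftField Y (γ t))) := fun t ht => hball t ht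
  have hmem : ∀ t ∈ Set.Ioo (-ε) ε, γ t ∈ leviSubgroup 𝔤 := fun t ht =>
    mem_leviSubgroup_of_mem_part fun i Z hZ => Ad_mem_part_of_curve hY hε hγ0 hγ' ht hZ
  have hnhds : Set.Ioo (-ε) ε ∈ 𝓝 (0 : ℝ) := Ioo_mem_nhds (by linarith) hε
  classical
  -- The curve viewed in `G₀`; the default value `1` is never taken near `0`.
  let η : ℝ → leviSubgroup 𝔤 := fun t => if ht : γ t ∈ leviSubgroup 𝔤 then ⟨γ t, ht⟩ else 1
  have hη : ∀ t ∈ Set.Ioo (-ε) ε, (η t : G) = γ t := fun t ht => by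
    simp only [η, dif_pos (hmem t ht)]
  have h0 : (0 : ℝ) ∈ Set.Ioo (-ε) ε := mem_of_mem_nhds hnhds
  have hη0 : η 0 = 1 := Subtype.ext ((hη 0 h0).trans hγ0)
  -- The subspace topology gives continuity of `η` into `G₀`, which is all that
  -- `mem_range_of_hasDerivAt_comp` needs to place the velocity `Y` in the image of the Lie algebra
  -- of `G₀`.
  have hηc : ContinuousAt η 0 := by
    rw [Topology.IsInducing.subtypeVal.continuousAt_iff]
    refine (hγ' 0 h0).continuousAt.congr ?_
    filter_upwards [hnhds] with t ht using (hη t ht).symm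
  have hf := h.hasModelDerivAt.hasFDerivAt_chart (a := (1 : G))
    (mem_extChartAt_source (1 : G))
  have ha : ContinuousAt (fun t => extChartAt 𝓘(ℝ, E₀) (1 : leviSubgroup 𝔤) (η t)) 0 := by
    refine ContinuousAt.comp ?_ hηc
    rw [hη0]
    exact continuousAt_extChartAt _
  have hv := hasModelDerivAt_iff_hasFDerivAt.1
    ((hasModelDerivAt_extChartAt_self (1 : G)).comp (hγ' 0 h0) hγ0)
  refine mem_range_of_hasDerivAt_comp
    (f := fun y => extChartAt 𝓘(ℝ, E) (1 : G)
      ((extChartAt 𝓘(ℝ, E₀) (1 : leviSubgroup 𝔤)).symm y : leviSubgroup 𝔤))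
    (a := fun t => extChartAt 𝓘(ℝ, E₀) (1 : leviSubgroup 𝔤) (η t)) ?_ h.injective_leviDeriv ha ?_
  · rw [hη0]
    convert hf using 1
    exact ((congrArg (fun T => ContinuousLinearMap.comp T (leviDeriv 𝔤 E₀))
      (mfderivModel_extChartAt_self (1 : G))).trans (ContinuousLinearMap.id_comp _)).symm
  · have hY0 : leftField Y (γ 0) = lieToModel Y := by
      rw [hγ0]
      have h1 : HasModelDerivAt (fun y : G => 1 * y) 1 (ContinuousLinearMap.id ℝ E) := by
        simp only [one_mul]; exact hasModelDerivAt_id 1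
      exact DFunLike.congr_fun h1.eq (lieToModel Y)
    have hv' : HasDerivAt (fun t => extChartAt 𝓘(ℝ, E) (1 : G) (γ t)) (lieToModel Y) 0 := by
      convert hv.hasDerivAt using 1
      simp [hY0]
    refine hv'.congr_of_eventuallyEq ?_
    have hs : ∀ᶠ t in 𝓝 (0 : ℝ), η t ∈ (extChartAt 𝓘(ℝ, E₀) (1 : leviSubgroup 𝔤)).source := by
      refine hηc.eventually ?_
      rw [hη0]
      exact extChartAt_source_mem_nhds _
    filter_upwards [hnhds, hs] with t ht hst
    rw [(extChartAt 𝓘(ℝ, E₀) (1 : leviSubgroup 𝔤)).left_inv hst, hη t ht]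

end LeviSubgroup

/-! ### Naturality of the exterior derivative of vector-valued one-forms -/

section ExteriorDerivative

open Topology Filter

variable {E : Type*} [NormedAddCommGroup E] [NormedSpace ℝ E]
  {G : Type*} [TopologicalSpace G] [ChartedSpace E G] [Group G]
  {EP : Type*} [NormedAddCommGroup EP] [NormedSpace ℝ EP]
  {P : Type*} [TopologicalSpace P] [ChartedSpace EP P]

/-- A one-form with values in `T₁G` as a family of linear maps between the model spaces. -/
def formModel (α : ∀ u : P, TangentSpace 𝓘(ℝ, EP) u →ₗ[ℝ] GroupLieAlgebra 𝓘(ℝ, E) G) (u : P) :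
    EP →ₗ[ℝ] E := α u

/-- A one-form on `P` in the chart at `u`. -/
def formChart (α : ∀ u : P, TangentSpace 𝓘(ℝ, EP) u →ₗ[ℝ] GroupLieAlgebra 𝓘(ℝ, E) G) (u : P)
    (p : EP × EP) : E :=
  formModel α ((extChartAt 𝓘(ℝ, EP) u).symm p.1)
    (mfderivModel EP EP (extChartAt 𝓘(ℝ, EP) u).symm p.1 p.2)

variable [IsManifold 𝓘(ℝ, EP) ∞ P]

/-- Smoothness of a one-form with values in `T₁G`. -/
def SmoothForm (α : ∀ u : P, TangentSpace 𝓘(ℝ, EP) u →ₗ[ℝ] GroupLieAlgebra 𝓘(ℝ, E) G) : Prop :=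
  ContMDiff 𝓘(ℝ, EP).tangent 𝓘(ℝ, E) ∞
    (fun v : TangentBundle 𝓘(ℝ, EP) P => lieToModel (α v.1 v.2))

variable {α : ∀ u : P, TangentSpace 𝓘(ℝ, EP) u →ₗ[ℝ] GroupLieAlgebra 𝓘(ℝ, E) G}

omit [IsManifold 𝓘(ℝ, EP) ∞ P] in
theorem formChart_add (u : P) (y z z' : EP) :
    formChart α u (y, z + z') = formChart α u (y, z) + formChart α u (y, z') := by
  simp only [formChart, map_add]

omit [IsManifold 𝓘(ℝ, EP) ∞ P] in
theorem formChart_smul (u : P) (y : EP) (c : ℝ) (z : EP) :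
    formChart α u (y, c • z) = c • formChart α u (y, z) := by
  simp only [formChart, map_smul]

/-- Smoothness holds jointly in the point and the vector: the chart expression is the form, as a
smooth function on the tangent bundle, composed with the tangent map of the inverse chart. -/
theorem SmoothForm.contDiffAt_formChart (hα : SmoothForm α) {u : P} {y : EP}
    (hy : y ∈ (extChartAt 𝓘(ℝ, EP) u).target) (z : EP) :
    ContDiffAt ℝ ∞ (formChart α u) (y, z) := by
  have hM1 : IsManifold 𝓘(ℝ, EP) 1 P := IsManifold.of_le (n := ∞) ENat.LEInfty.out
  have hopen : IsOpen (extChartAt 𝓘(ℝ, EP) u).target := isOpen_extChartAt_target u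
  have h1 := ContMDiffOn.contMDiffOn_tangentMapWithin (m := ∞)
    (contMDiffOn_extChartAt_symm (I := 𝓘(ℝ, EP)) (n := ∞) u) le_rfl hopen.uniqueMDiffOn
  have h2 : ContMDiff (𝓘(ℝ, EP).prod 𝓘(ℝ, EP)) 𝓘(ℝ, EP).tangent ∞
      (fun p : EP × EP => (⟨p.1, p.2⟩ : TangentBundle 𝓘(ℝ, EP) EP)) := by
    rw [chartedSpaceSelf_prod]
    exact contMDiff_tangentBundleModelSpaceHomeomorph_symm (I := 𝓘(ℝ, EP))
  have h3 := (hα.comp_contMDiffOn h1).comp h2.contMDiffOn (s := Prod.fst ⁻¹'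
    (extChartAt 𝓘(ℝ, EP) u).target) (fun p hp => hp)
  have h4 : ContMDiffOn (𝓘(ℝ, EP).prod 𝓘(ℝ, EP)) 𝓘(ℝ, E) ∞ (formChart α u)
      (Prod.fst ⁻¹' (extChartAt 𝓘(ℝ, EP) u).target) := by
    refine ContMDiffOn.congr h3 fun p hp => ?_
    have e : mfderivWithin 𝓘(ℝ, EP) 𝓘(ℝ, EP) (extChartAt 𝓘(ℝ, EP) u).symm
        (extChartAt 𝓘(ℝ, EP) u).target p.1 =
        mfderiv 𝓘(ℝ, EP) 𝓘(ℝ, EP) (extChartAt 𝓘(ℝ, EP) u).symm p.1 :=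
      mfderivWithin_of_isOpen hopen hp
    exact congrArg (fun T : EP →L[ℝ] EP =>
      formModel α ((extChartAt 𝓘(ℝ, EP) u).symm p.1) (T p.2)) e.symm
  rw [← modelWithCornersSelf_prod, chartedSpaceSelf_prod] at h4
  exact h4.contDiffOn.contDiffAt ((hopen.preimage continuous_fst).mem_nhds hy)

/-- The exterior derivative of a one-form, computed in the chart at `u`. -/
theorem lieToModel_extDerivForm (u : P) (ξ η : EP) :
    lieToModel (extDerivForm α u ξ η) =
      fderiv ℝ (fun y => formChart α u (y, η)) (extChartAt 𝓘(ℝ, EP) u u) ξ -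
      fderiv ℝ (fun y => formChart α u (y, ξ)) (extChartAt 𝓘(ℝ, EP) u u) η := by
  have hM1 : IsManifold 𝓘(ℝ, EP) 1 P := IsManifold.of_le (n := ∞) ENat.LEInfty.out
  -- The chart at `u` has derivative the identity at `u` itself, so the chart representatives of the
  -- two arguments are the arguments.
  have e : ∀ ζ : EP, (mfderiv 𝓘(ℝ, EP) 𝓘(ℝ, EP) (extChartAt 𝓘(ℝ, EP) u) u : EP → EP) ζ = ζ :=
    fun ζ => DFunLike.congr_fun (mfderivModel_extChartAt_self (E₁ := EP) u) ζ
  have h : lieToModel (extDerivForm α u ξ η) =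
      fderiv ℝ (fun y => formChart α u (y, (mfderiv 𝓘(ℝ, EP) 𝓘(ℝ, EP)
        (extChartAt 𝓘(ℝ, EP) u) u : EP → EP) η)) (extChartAt 𝓘(ℝ, EP) u u)
        ((mfderiv 𝓘(ℝ, EP) 𝓘(ℝ, EP) (extChartAt 𝓘(ℝ, EP) u) u : EP → EP) ξ) -
      fderiv ℝ (fun y => formChart α u (y, (mfderiv 𝓘(ℝ, EP) 𝓘(ℝ, EP)
        (extChartAt 𝓘(ℝ, EP) u) u : EP → EP) ξ)) (extChartAt 𝓘(ℝ, EP) u u)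
        ((mfderiv 𝓘(ℝ, EP) 𝓘(ℝ, EP) (extChartAt 𝓘(ℝ, EP) u) u : EP → EP) η) := rfl
  rw [h]
  simp only [e]

theorem SmoothForm.differentiableAt_formChart_left (hα : SmoothForm α) (u : P) (z : EP) :
    DifferentiableAt ℝ (fun y => formChart α u (y, z)) (extChartAt 𝓘(ℝ, EP) u u) :=
  ((hα.contDiffAt_formChart (mem_extChartAt_target (I := 𝓘(ℝ, EP)) u) z).differentiableAt
    (by simp)).comp (f := fun y => (y, z)) _ (by fun_prop)

variable [FiniteDimensional ℝ EP]

omit [IsManifold 𝓘(ℝ, EP) ∞ P] in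
theorem fderiv_formChart_right (u : P) (y z z' : EP) :
    fderiv ℝ (fun z => formChart α u (y, z)) z z' = formChart α u (y, z') := by
  let T : EP →L[ℝ] E := LinearMap.toContinuousLinearMap
    (IsLinearMap.mk' (fun z => formChart α u (y, z))
      ⟨formChart_add u y, fun c z => formChart_smul u y c z⟩)
  exact DFunLike.congr_fun (T.hasFDerivAt (x := z)).fderiv z'

/-- The exterior derivative of a one-form may be computed from any smooth parametrization of a
neighbourhood, and more generally after a pullback along any smooth map. -/
theorem SmoothForm.extDerivForm_eq_of_map (hα : SmoothForm α)
    {N : Type*} [NormedAddCommGroup N] [NormedSpace ℝ N]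
    {F : N → P} {x₀ : N} (hF : ContMDiffAt 𝓘(ℝ, N) 𝓘(ℝ, EP) ∞ F x₀) (v w : N) :
    DifferentiableAt ℝ (fun x => formModel α (F x) (mfderivModel N EP F x w)) x₀ ∧
    lieToModel (extDerivForm α (F x₀) (mfderivModel N EP F x₀ v) (mfderivModel N EP F x₀ w)) =
      fderiv ℝ (fun x => formModel α (F x) (mfderivModel N EP F x w)) x₀ v -
      fderiv ℝ (fun x => formModel α (F x) (mfderivModel N EP F x v)) x₀ w := by
  have hM1 : IsManifold 𝓘(ℝ, EP) 1 P := IsManifold.of_le (n := ∞) ENat.LEInfty.out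
  set u := F x₀ with hu
  set φ := extChartAt 𝓘(ℝ, EP) u with hφ
  let ψ : N → EP := fun x => φ (F x)
  have hψ : ContDiffAt ℝ ∞ ψ x₀ := by
    rw [← contMDiffAt_iff_contDiffAt]
    exact ContMDiffAt.comp x₀ (contMDiffAt_extChartAt (x := u)) hF
  have hdF : ∀ᶠ x in 𝓝 x₀, MDifferentiableAt 𝓘(ℝ, N) 𝓘(ℝ, EP) F x := by
    have h1 : ContMDiffAt 𝓘(ℝ, N) 𝓘(ℝ, EP) 1 F x₀ := hF.of_le (by exact ENat.LEInfty.out)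
    filter_upwards [(contMDiffAt_iff_contMDiffAt_nhds (by simp)).1 h1] with x hx
      using hx.mdifferentiableAt (by simp)
  have hsrc : ∀ᶠ x in 𝓝 x₀, F x ∈ φ.source :=
    hF.continuousAt.eventually (extChartAt_source_mem_nhds u)
  have hfd : ∀ x, MDifferentiableAt 𝓘(ℝ, N) 𝓘(ℝ, EP) F x → F x ∈ φ.source →
      fderiv ℝ ψ x = (mfderivModel EP EP φ (F x)).comp (mfderivModel N EP F x) := fun x hx hs =>
    (hasModelDerivAt_iff_hasFDerivAt.1
      ((hasModelDerivAt_extChartAt hs).comp hx.hasModelDerivAt rfl)).fderiv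
  have hψ0 : fderiv ℝ ψ x₀ = mfderivModel N EP F x₀ := by
    rw [hfd x₀ hdF.self_of_nhds hsrc.self_of_nhds, ← hu, hφ, mfderivModel_extChartAt_self,
      ContinuousLinearMap.id_comp]
  -- The pulled back form is computed in the chart at `u` through `ψ = φ ∘ F`.
  have hpull : ∀ w : N, (fun x => formModel α (F x) (mfderivModel N EP F x w)) =ᶠ[𝓝 x₀]
      fun x => formChart α u (ψ x, fderiv ℝ ψ x w) := fun w => by
    filter_upwards [hdF, hsrc] with x hx hs
    have h1 := mfderivModel_symm_comp_extChartAt (φ.map_source hs)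
    have h2 : φ.symm (φ (F x)) = F x := φ.left_inv hs
    rw [h2] at h1
    have h3 : mfderivModel EP EP φ.symm (φ (F x)) (fderiv ℝ ψ x w) = mfderivModel N EP F x w := by
      rw [hfd x hx hs]
      exact DFunLike.congr_fun h1 (mfderivModel N EP F x w)
    simp only [formChart, ← hφ, ψ]
    rw [h3, h2]
  have hsnd : DifferentiableAt ℝ (fderiv ℝ ψ) x₀ :=
    (hψ.fderiv_right (m := 1)
      (by rw [one_add_one_eq_two]; exact ENat.LEInfty.out)).differentiableAt (by simp)
  have hdiff : ∀ w : N, DifferentiableAt ℝ (fun x => formChart α u (ψ x, fderiv ℝ ψ x w)) x₀ := by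
    intro w
    have hd : DifferentiableAt ℝ (formChart α u) (ψ x₀, fderiv ℝ ψ x₀ w) :=
      (hα.contDiffAt_formChart (mem_extChartAt_target u) _).differentiableAt (by simp)
    exact hd.comp x₀ ((hψ.differentiableAt (by simp)).prodMk
        (hsnd.clm_apply (differentiableAt_const w)))
  refine ⟨(hdiff w).congr_of_eventuallyEq (hpull w), ?_⟩
  -- The chain rule gives the term belonging to the exterior derivative at `u`, plus the form
  -- evaluated on `D²ψ(v, w)`. The latter is symmetric in `v` and `w` and cancels on
  -- antisymmetrizing.
  have hmain : ∀ v w : N, fderiv ℝ (fun x => formModel α (F x) (mfderivModel N EP F x w)) x₀ v =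
      fderiv ℝ (fun y => formChart α u (y, mfderivModel N EP F x₀ w)) (φ u)
        (mfderivModel N EP F x₀ v) + formChart α u (φ u, fderiv ℝ (fderiv ℝ ψ) x₀ v w) := by
    intro v w
    have hd : DifferentiableAt ℝ (formChart α u) (φ u, mfderivModel N EP F x₀ w) :=
      (hα.contDiffAt_formChart (mem_extChartAt_target u) _).differentiableAt (by simp)
    have h1 : HasFDerivAt (fun x => (ψ x, fderiv ℝ ψ x w)) _ x₀ :=
      (hψ.differentiableAt (by simp)).hasFDerivAt.prodMk
        (hsnd.hasFDerivAt.clm_apply (hasFDerivAt_const w x₀))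
    have hd' : DifferentiableAt ℝ (formChart α u) (ψ x₀, fderiv ℝ ψ x₀ w) := by
      rw [hψ0]; exact hd
    have h2 := hd'.hasFDerivAt.comp x₀ h1
    rw [(hpull w).fderiv_eq]
    have h3 : fderiv ℝ (fun x => formChart α u (ψ x, fderiv ℝ ψ x w)) x₀ = _ := h2.fderiv
    rw [h3, fderiv_prodMk_left hd,
      ← fderiv_formChart_right u (φ u) (mfderivModel N EP F x₀ w), fderiv_prodMk_right hd,
      ← map_add, hψ0]
    simp
    rfl
  rw [hmain, hmain, lieToModel_extDerivForm]
  have hsymm := (hψ.isSymmSndFDerivAt (n := ∞)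
    (by rw [minSmoothness_of_isRCLikeNormedField]; exact ENat.LEInfty.out)).eq v w
  rw [hsymm]
  abel

end ExteriorDerivative

/-! ### Bilinearity and constant linear maps -/

section FormAlgebra

/-- The alternating map in two variables given by an alternating bilinear map. -/
def alternatingOfBilinear {V W : Type*} [AddCommGroup V] [Module ℝ V] [AddCommGroup W] [Module ℝ W]
    (B : V →ₗ[ℝ] V →ₗ[ℝ] W) (hB : ∀ v, B v v = 0) : V [⋀^Fin 2]→ₗ[ℝ] W where
  toFun m := B (m 0) (m 1)
  map_update_add' m i x y := by
    fin_cases i <;> simp [Function.update]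
  map_update_smul' m i c x := by
    fin_cases i <;> simp [Function.update]
  map_eq_zero_of_eq' m i j h hij := by
    fin_cases i <;> fin_cases j <;> simp_all

variable {E : Type*} [NormedAddCommGroup E] [NormedSpace ℝ E]
  {G : Type*} [TopologicalSpace G] [ChartedSpace E G] [Group G]
  {EP : Type*} [NormedAddCommGroup EP] [NormedSpace ℝ EP]
  {P : Type*} [TopologicalSpace P] [ChartedSpace EP P] [IsManifold 𝓘(ℝ, EP) ∞ P]
  {α : ∀ u : P, TangentSpace 𝓘(ℝ, EP) u →ₗ[ℝ] GroupLieAlgebra 𝓘(ℝ, E) G}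

/-- A constant linear map, continuous by finite dimension, commutes with differentiation. With
grading projections for `T`, this yields `dτ_{≤0}` and `dτ_+` from `dτ`. -/
theorem SmoothForm.extDerivForm_comp [FiniteDimensional ℝ E] (hα : SmoothForm α)
    (T : GroupLieAlgebra 𝓘(ℝ, E) G →ₗ[ℝ] GroupLieAlgebra 𝓘(ℝ, E) G) (u : P) (ξ η : EP) :
    extDerivForm (fun u => T ∘ₗ α u) u ξ η = T (extDerivForm α u ξ η) := by
  have h : ∀ z : EP, fderiv ℝ (fun y => formChart (fun u => T ∘ₗ α u) u (y, z))
      (extChartAt 𝓘(ℝ, EP) u u) = (endModel T).comp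
        (fderiv ℝ (fun y => formChart α u (y, z)) (extChartAt 𝓘(ℝ, EP) u u)) := fun z =>
    ((endModel T).hasFDerivAt.comp _
      (hα.differentiableAt_formChart_left u z).hasFDerivAt).fderiv
  have h1 := lieToModel_extDerivForm (α := fun u => T ∘ₗ α u) u ξ η
  rw [h, h, ContinuousLinearMap.comp_apply, ContinuousLinearMap.comp_apply, ← map_sub,
    ← lieToModel_extDerivForm] at h1
  exact h1

theorem SmoothForm.fderiv_formChart_add (hα : SmoothForm α) (u : P) (z z' : EP) :
    fderiv ℝ (fun y => formChart α u (y, z + z')) (extChartAt 𝓘(ℝ, EP) u u) =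
      fderiv ℝ (fun y => formChart α u (y, z)) (extChartAt 𝓘(ℝ, EP) u u) +
      fderiv ℝ (fun y => formChart α u (y, z')) (extChartAt 𝓘(ℝ, EP) u u) := by
  simp only [formChart_add]
  exact fderiv_add (hα.differentiableAt_formChart_left u z)
    (hα.differentiableAt_formChart_left u z')

theorem SmoothForm.fderiv_formChart_smul (hα : SmoothForm α) (u : P) (c : ℝ) (z : EP) :
    fderiv ℝ (fun y => formChart α u (y, c • z)) (extChartAt 𝓘(ℝ, EP) u u) =
      c • fderiv ℝ (fun y => formChart α u (y, z)) (extChartAt 𝓘(ℝ, EP) u u) := by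
  simp only [formChart_smul]
  exact fderiv_const_smul (hα.differentiableAt_formChart_left u z) c

/-- The exterior derivative of a smooth one-form as a bilinear map. -/
def SmoothForm.extDerivBilin (hα : SmoothForm α) (u : P) :
    EP →ₗ[ℝ] EP →ₗ[ℝ] GroupLieAlgebra 𝓘(ℝ, E) G :=
  LinearMap.mk₂ ℝ (fun ξ η => modelToLie (lieToModel (extDerivForm α u ξ η)))
    (fun ξ ξ' η => by
      simp only [lieToModel_extDerivForm, hα.fderiv_formChart_add, map_add,
        _root_.add_apply]
      exact add_sub_add_comm _ _ _ _)
    (fun c ξ η => by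
      simp only [lieToModel_extDerivForm, hα.fderiv_formChart_smul, map_smul,
        _root_.smul_apply]
      exact (smul_sub _ _ _).symm)
    (fun ξ η η' => by
      simp only [lieToModel_extDerivForm, hα.fderiv_formChart_add, map_add,
        _root_.add_apply]
      exact add_sub_add_comm _ _ _ _)
    (fun c ξ η => by
      simp only [lieToModel_extDerivForm, hα.fderiv_formChart_smul, map_smul,
        _root_.smul_apply]
      exact (smul_sub _ _ _).symm)

theorem extDerivForm_self (u : P) (ξ : EP) : extDerivForm α u ξ ξ = 0 := by
  have h := lieToModel_extDerivForm (α := α) u ξ ξ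
  rw [sub_self] at h
  exact h

end FormAlgebra

/-! ### Partial derivatives on product manifolds -/

section ProductRule

variable {E₁ : Type*} [NormedAddCommGroup E₁] [NormedSpace ℝ E₁]
  {E₂ : Type*} [NormedAddCommGroup E₂] [NormedSpace ℝ E₂]
  {E₃ : Type*} [NormedAddCommGroup E₃] [NormedSpace ℝ E₃]
  {E₄ : Type*} [NormedAddCommGroup E₄] [NormedSpace ℝ E₄]
  {M₁ : Type*} [TopologicalSpace M₁] [ChartedSpace E₁ M₁]
  {M₂ : Type*} [TopologicalSpace M₂] [ChartedSpace E₂ M₂]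
  {M₃ : Type*} [TopologicalSpace M₃] [ChartedSpace E₃ M₃]
  {M₄ : Type*} [TopologicalSpace M₄] [ChartedSpace E₄ M₄]

/-- The product rule: the derivative of `z ↦ f (g₁ z, g₂ z)` in terms of the partial derivatives
of `f`. -/
theorem hasModelDerivAt_comp_prod {f : M₁ × M₂ → M₃} {g₁ : M₄ → M₁} {g₂ : M₄ → M₂} {x : M₄}
    {a : M₁} {b : M₂} {g₁' : E₄ →L[ℝ] E₁} {g₂' : E₄ →L[ℝ] E₂}
    (hf : MDifferentiableAt (𝓘(ℝ, E₁).prod 𝓘(ℝ, E₂)) 𝓘(ℝ, E₃) f (a, b))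
    (h₁ : HasModelDerivAt g₁ x g₁') (h₂ : HasModelDerivAt g₂ x g₂') (ha : g₁ x = a)
    (hb : g₂ x = b) :
    HasModelDerivAt (fun z => f (g₁ z, g₂ z)) x
      ((mfderivModel E₁ E₃ (fun z => f (z, b)) a).comp g₁' +
        (mfderivModel E₂ E₃ (fun z => f (a, z)) b).comp g₂') := by
  subst ha hb
  have h := HasMFDerivAt.comp x hf.hasMFDerivAt (HasMFDerivAt.prodMk h₁ h₂)
  let D : E₁ × E₂ →L[ℝ] E₃ := mfderiv (𝓘(ℝ, E₁).prod 𝓘(ℝ, E₂)) 𝓘(ℝ, E₃) f (g₁ x, g₂ x)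
  have e : D.comp (g₁'.prod g₂') = (mfderivModel E₁ E₃ (fun z => f (z, g₂ x)) (g₁ x)).comp g₁' +
      (mfderivModel E₂ E₃ (fun z => f (g₁ x, z)) (g₂ x)).comp g₂' :=
    ContinuousLinearMap.ext fun v =>
      mfderiv_prod_eq_add_apply (p := (g₁ x, g₂ x)) (v := (g₁' v, g₂' v)) hf
  rw [← e]
  exact h

end ProductRule

/-! ### Local sections and vertical vectors of a principal bundle -/

namespace SmoothPrincipalBundle

open Topology Filter

variable {EH : Type*} [NormedAddCommGroup EH] [NormedSpace ℝ EH]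
  {EP : Type*} [NormedAddCommGroup EP] [NormedSpace ℝ EP]
  {EM : Type*} [NormedAddCommGroup EM] [NormedSpace ℝ EM]
  {H : Type*} [TopologicalSpace H] [ChartedSpace EH H] [Group H]
  {P : Type*} [TopologicalSpace P] [ChartedSpace EP P]
  {M : Type*} [TopologicalSpace M] [ChartedSpace EM M]
  (Q : SmoothPrincipalBundle EH EP EM H P M)

theorem mdifferentiableAt_act (u : P) (g : H) :
    MDifferentiableAt (𝓘(ℝ, EP).prod 𝓘(ℝ, EH)) 𝓘(ℝ, EP) (fun q : P × H => Q.act q.1 q.2) (u, g) :=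
  Q.contMDiff_act.mdifferentiable (by simp) (u, g)

theorem contMDiff_act_right (g : H) :
    ContMDiff 𝓘(ℝ, EP) 𝓘(ℝ, EP) ∞ fun u => Q.act u g :=
  Q.contMDiff_act.comp (contMDiff_id.prodMk contMDiff_const)

theorem hasModelDerivAt_act_right (u : P) (g : H) :
    HasModelDerivAt (fun u => Q.act u g) u (mfderivModel EP EP (fun u => Q.act u g) u) :=
  ((Q.contMDiff_act_right g).mdifferentiable (by simp) u).hasModelDerivAt

/-- The fundamental vector field map at `u`, as a map of model spaces. -/
def fundamentalModel (u : P) : EH →L[ℝ] EP := mfderivModel EH EP (fun g => Q.act u g) 1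

variable [LieGroup 𝓘(ℝ, EH) ∞ H]

/-- Around every point of the bundle, the projection has a local section `s` through the point,
and every point of the bundle near `u` is of the form `s(x) · g`. -/
theorem exists_section (u : P) :
    ∃ (s : M → P) (q : P → H) (s' : EM →L[ℝ] EP) (q' : EP →L[ℝ] EH) (p' : EP →L[ℝ] EM),
      s (Q.proj u) = u ∧ q u = 1 ∧ HasModelDerivAt s (Q.proj u) s' ∧ HasModelDerivAt q u q' ∧
      HasModelDerivAt Q.proj u p' ∧ (∀ᶠ x in 𝓝 (Q.proj u), Q.proj (s x) = x) ∧
      ∀ᶠ v in 𝓝 u, Q.act (s (Q.proj v)) (q v) = v := by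
  obtain ⟨U, φ, hU, hxU, hsrc, htgt, hφ, hφs, hfst, hsnd⟩ := Q.exists_trivialization (Q.proj u)
  have hu : u ∈ φ.source := by rw [hsrc]; exact hxU
  have hφu : ContMDiffAt 𝓘(ℝ, EP) (𝓘(ℝ, EM).prod 𝓘(ℝ, EH)) ∞ φ u :=
    hφ.contMDiffAt (φ.open_source.mem_nhds hu)
  have hp : MDifferentiableAt 𝓘(ℝ, EP) 𝓘(ℝ, EM) Q.proj u := by
    have h : ContMDiffAt 𝓘(ℝ, EP) 𝓘(ℝ, EM) ∞ (fun v => (φ v).1) u :=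
      contMDiffAt_fst.comp u hφu
    refine (h.mdifferentiableAt (by simp)).congr_of_eventuallyEq ?_
    filter_upwards [φ.open_source.mem_nhds hu] with v hv using (hfst v hv).symm
  have hmul : ContMDiff 𝓘(ℝ, EH) 𝓘(ℝ, EH) ∞ (fun h : H => (φ u).2⁻¹ * h) := contMDiff_mul_left
  have hq : MDifferentiableAt 𝓘(ℝ, EP) 𝓘(ℝ, EH) (fun v => (φ u).2⁻¹ * (φ v).2) u := by
    have h : ContMDiffAt 𝓘(ℝ, EP) 𝓘(ℝ, EH) ∞ (fun v => (φ v).2) u :=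
      contMDiffAt_snd.comp u hφu
    exact (ContMDiffAt.comp u hmul.contMDiffAt h).mdifferentiableAt (by simp)
  have hmem : ∀ x ∈ U, (x, (φ u).2) ∈ φ.target := fun x hx => by
    rw [htgt]; exact ⟨hx, trivial⟩
  have hs : MDifferentiableAt 𝓘(ℝ, EM) 𝓘(ℝ, EP) (fun x => φ.symm (x, (φ u).2)) (Q.proj u) := by
    have h : ContMDiffAt (𝓘(ℝ, EM).prod 𝓘(ℝ, EH)) 𝓘(ℝ, EP) ∞ φ.symm (Q.proj u, (φ u).2) :=
      hφs.contMDiffAt (φ.open_target.mem_nhds (hmem _ hxU))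
    exact (ContMDiffAt.comp (Q.proj u) h
      (contMDiffAt_id.prodMk contMDiffAt_const)).mdifferentiableAt (by simp)
  have hproj : ∀ x ∈ U, Q.proj (φ.symm (x, (φ u).2)) = x := fun x hx => by
    rw [← hfst _ (φ.map_target (hmem x hx)), φ.right_inv (hmem x hx)]
  -- The section keeps the fibre coordinate of `u` constant, and `q(v)` is the fibre coordinate of
  -- `v` relative to that of `u`.
  refine ⟨fun x => φ.symm (x, (φ u).2), fun v => (φ u).2⁻¹ * (φ v).2, _, _, _, ?_, by simp,
    hs.hasModelDerivAt, hq.hasModelDerivAt, hp.hasModelDerivAt, ?_, ?_⟩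
  · have e : (Q.proj u, (φ u).2) = φ u := Prod.ext (hfst u hu).symm rfl
    simp only [e, φ.left_inv hu]
  · filter_upwards [hU.mem_nhds hxU] with x hx using hproj x hx
  · filter_upwards [φ.open_source.mem_nhds hu] with v hv
    have hvU : Q.proj v ∈ U := by rw [hsrc] at hv; exact hv
    have h1 : φ.symm (Q.proj v, (φ u).2) ∈ φ.source := φ.map_target (hmem _ hvU)
    have h2 : Q.act (φ.symm (Q.proj v, (φ u).2)) ((φ u).2⁻¹ * (φ v).2) ∈ φ.source := by
      rw [hsrc, Set.mem_preimage, Q.proj_act, hproj _ hvU]; exact hvU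
    refine φ.injOn h2 hv (Prod.ext ?_ ?_)
    · rw [hfst _ h2, Q.proj_act, hproj _ hvU, hfst v hv]
    · rw [hsnd _ h1, φ.right_inv (hmem _ hvU)]
      simp

/-- The projection of a principal bundle is a submersion. -/
theorem surjective_mfderiv_proj (u : P) (t : EM) : ∃ v : EP, mfderivModel EP EM Q.proj u v = t := by
  obtain ⟨s, q, s', q', p', hsu, hqu, hs, hq, hp, hps, hact⟩ := Q.exists_section u
  have h := (hp.comp hs hsu).eq.symm.trans
    ((hasModelDerivAt_id (Q.proj u)).congr hps).eq
  refine ⟨s' t, ?_⟩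
  rw [hp.eq]
  exact DFunLike.congr_fun h t

/-- Vertical tangent vectors are the values of fundamental vector fields. -/
theorem exists_fundamental_eq {u : P} {v : EP} (hv : mfderivModel EP EM Q.proj u v = 0) :
    ∃ A : EH, Q.fundamentalModel u A = v := by
  obtain ⟨s, q, s', q', p', hsu, hqu, hs, hq, hp, hps, hact⟩ := Q.exists_section u
  -- Differentiate `v = s(p(v)) · q(v)` at `u`. On a vertical vector the contribution of `s ∘ p`
  -- vanishes, leaving the fundamental vector generated by `q' v`.
  have h1 := hasModelDerivAt_comp_prod (Q.mdifferentiableAt_act u 1) (hs.comp hp rfl) hq hsu hqu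
  have h2 := h1.eq.symm.trans ((hasModelDerivAt_id u).congr hact).eq
  have h3 := DFunLike.congr_fun h2 v
  rw [hp.eq] at hv
  refine ⟨q' v, ?_⟩
  have h4 : mfderivModel EH EP (fun g => Q.act u g) 1 (q' v) = v := by simpa [hv] using h3
  exact h4

end SmoothPrincipalBundle

/-! ### `τ_{≤0}` is a pointwise isomorphism onto `𝔤_{≤0}` -/

section Coframe

variable {k : ℕ}
  {E : Type*} [NormedAddCommGroup E] [NormedSpace ℝ E] [CompleteSpace E]
  {G : Type*} [TopologicalSpace G] [ChartedSpace E G] [Group G] [LieGroup 𝓘(ℝ, E) ∞ G]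
  {𝔤 : KGrading k (GroupLieAlgebra 𝓘(ℝ, E) G)}
  {E₀ : Type*} [NormedAddCommGroup E₀] [NormedSpace ℝ E₀] [ChartedSpace E₀ (leviSubgroup 𝔤)]
  {EP : Type*} [NormedAddCommGroup EP] [NormedSpace ℝ EP]
  {EM : Type*} [NormedAddCommGroup EM] [NormedSpace ℝ EM]
  {P : Type*} [TopologicalSpace P] [ChartedSpace EP P] [IsManifold 𝓘(ℝ, EP) ∞ P]
  {M : Type*} [TopologicalSpace M] [ChartedSpace EM M] [IsManifold 𝓘(ℝ, EM) ∞ M]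
  {Q : SmoothPrincipalBundle E₀ EP EM (leviSubgroup 𝔤) P M} {F : RegularFlagStructure Q}
  (τ : WeylForm F)

namespace WeylForm

/-- A Weyl form at the point `u`, as a map on the model space. -/
def coframe (u : P) : EP →ₗ[ℝ] GroupLieAlgebra 𝓘(ℝ, E) G := (τ.form u).toLinearMap

theorem coframe_fundamental (u : P) (A : E₀) :
    τ.coframe u (Q.fundamentalModel u A) = modelToLie (leviDeriv 𝔤 E₀ A) :=
  τ.form_fundamental u A

theorem proj_coframe {i : ℤ} (hi : i < 0) {u : P} {v : EP} (t : F.fil i (Q.proj u))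
    (h : mfderivModel EP EM Q.proj u v = t.1) :
    𝔤.proj i (τ.coframe u v) =
      F.frame i hi (Q.proj u) ⟨u, rfl⟩ (Submodule.Quotient.mk t) := by
  obtain ⟨t, ht⟩ := t
  subst h
  exact τ.form_eq_frame i hi u v ht

theorem proj_coframe_eq_zero_iff {i : ℤ} (hi : i < 0) {u : P} {v : EP} (t : F.fil i (Q.proj u))
    (h : mfderivModel EP EM Q.proj u v = t.1) :
    𝔤.proj i (τ.coframe u v) = 0 ↔ t.1 ∈ F.fil (i + 1) (Q.proj u) := by
  rw [τ.proj_coframe hi t h, Submodule.coe_eq_zero, LinearEquiv.map_eq_zero_iff,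
    Submodule.Quotient.mk_eq_zero]
  rfl

/-- Climb the filtration: a vector in `T^i` whose component of degree `i` vanishes lies in
`T^{i+1}`, because the frame is injective. Starting from `T^{-k} = TM` this ends in `T^0 = 0`. -/
theorem mfderiv_proj_eq_zero {u : P} {v : EP} (h : ∀ i < 0, 𝔤.proj i (τ.coframe u v) = 0) :
    mfderivModel EP EM Q.proj u v = 0 := by
  have key : ∀ n : ℕ, ∃ t : F.fil (-(k : ℤ) + n) (Q.proj u),
      mfderivModel EP EM Q.proj u v = t.1 := by
    intro n
    induction n with
    | zero => exact ⟨⟨mfderivModel EP EM Q.proj u v, by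
        rw [F.fil_eq_top _ _ (by simp)]; trivial⟩, rfl⟩
    | succ n ih =>
      obtain ⟨t, ht⟩ := ih
      have e : -(k : ℤ) + (n + 1 : ℕ) = -(k : ℤ) + n + 1 := by push_cast; ring
      rw [e]
      rcases lt_or_ge (-(k : ℤ) + n) 0 with hn | hn
      · exact ⟨⟨t.1, (τ.proj_coframe_eq_zero_iff hn t ht).1 (h _ hn)⟩, ht⟩
      · have h0 : t.1 = 0 := (F.fil_eq_bot _ (Q.proj u) hn).le t.2
        exact ⟨0, ht.trans h0⟩
  obtain ⟨t, ht⟩ := key k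
  have h0 : t.1 = 0 := (F.fil_eq_bot _ (Q.proj u) (by simp)).le t.2
  exact ht.trans h0

variable [LieGroup 𝓘(ℝ, E₀) ∞ (leviSubgroup 𝔤)]

/-- Components are adjusted one degree at a time, upwards from `-k`. The correction in degree `-k +
n` is a lift of a vector in `T^{-k+n}`, which lies in `T^{i+1}` for every lower degree `i` and so
leaves the components already fixed unchanged. -/
theorem exists_proj_coframe_eq (u : P)
    (X : GroupLieAlgebra 𝓘(ℝ, E) G) :
    ∃ v : EP, ∀ i < 0, 𝔤.proj i (τ.coframe u v) = 𝔤.proj i X := by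
  have key : ∀ n : ℕ, ∃ v : EP, ∀ i < 0, i < -(k : ℤ) + n →
      𝔤.proj i (τ.coframe u v) = 𝔤.proj i X := by
    intro n
    induction n with
    | zero =>
      refine ⟨0, fun i hi hik => ?_⟩
      have hlt : (k : ℤ) < |i| := by rw [abs_of_neg hi]; push_cast at hik; linarith
      rw [𝔤.proj_eq_zero_of_lt hlt, 𝔤.proj_eq_zero_of_lt hlt]
    | succ n ih =>
      obtain ⟨v, hv⟩ := ih
      rcases lt_or_ge (-(k : ℤ) + n) 0 with hn | hn
      · obtain ⟨c, hc⟩ := (F.frame _ hn (Q.proj u) ⟨u, rfl⟩).surjective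
          ⟨𝔤.proj (-(k : ℤ) + n) (X - τ.coframe u v), 𝔤.proj_mem _ _⟩
        obtain ⟨t, rfl⟩ := Submodule.Quotient.mk_surjective _ c
        obtain ⟨w, hw⟩ := Q.surjective_mfderiv_proj u t.1
        refine ⟨v + w, fun i hi hin => ?_⟩
        rw [map_add, map_add]
        rcases (show i ≤ -(k : ℤ) + n by push_cast at hin; linarith).lt_or_eq with hlt | rfl
        · have hmem : t.1 ∈ F.fil (i + 1) (Q.proj u) :=
            F.fil_antitone (Q.proj u) (show i + 1 ≤ -(k : ℤ) + n by linarith) t.2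
          have hmem' : t.1 ∈ F.fil i (Q.proj u) :=
            F.fil_antitone (Q.proj u) (show i ≤ i + 1 by linarith) hmem
          rw [hv i hi hlt, (τ.proj_coframe_eq_zero_iff hi ⟨t.1, hmem'⟩ hw).2 hmem, add_zero]
        · rw [τ.proj_coframe hn t hw, hc]
          simp
      · exact ⟨v, fun i hi _ => hv i hi (hi.trans_le hn)⟩
  obtain ⟨v, hv⟩ := key k
  exact ⟨v, fun i hi => hv i hi (by simpa using hi)⟩

theorem exists_fundamental_eq {u : P} {v : EP} (h : 𝔤.projNeg (τ.coframe u v) = 0) :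
    ∃ A : E₀, Q.fundamentalModel u A = v := by
  refine Q.exists_fundamental_eq (τ.mfderiv_proj_eq_zero fun i hi => ?_)
  have := 𝔤.proj_projNeg i (τ.coframe u v)
  rwa [h, map_zero, if_pos hi, eq_comm] at this

variable [FiniteDimensional ℝ E]

/-- The negative components are matched first. Degree `0` is then corrected by a fundamental vector,
which exists because all of `𝔤_0` comes from `G₀` and which has no negative components. -/
theorem exists_nonpos_eq [FiniteDimensional ℝ E₀] (h₀ : IsLieSubgroup E₀ 𝔤) (u : P)
    (X : GroupLieAlgebra 𝓘(ℝ, E) G) :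
    ∃ v : EP, 𝔤.projNonpos (τ.coframe u v) = 𝔤.projNonpos X := by
  obtain ⟨v, hv⟩ := τ.exists_proj_coframe_eq u X
  obtain ⟨A, hA⟩ := h₀.exists_leviDeriv_eq (𝔤.proj_mem 0 (X - τ.coframe u v))
  have hA' : modelToLie (leviDeriv 𝔤 E₀ A) = 𝔤.proj 0 (X - τ.coframe u v) := hA
  refine ⟨v + Q.fundamentalModel u A, 𝔤.ext_proj fun i => ?_⟩
  rw [map_add, coframe_fundamental, hA', 𝔤.proj_projNonpos, 𝔤.proj_projNonpos]
  split_ifs with hi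
  · rw [map_add, 𝔤.proj_proj]
    rcases hi.lt_or_eq with hi | rfl
    · rw [hv i hi, if_neg hi.ne', add_zero]
    · simp
  · rfl

variable [LieAlgebra.IsSemisimple ℝ (GroupLieAlgebra 𝓘(ℝ, E) G)]

/-- A vector in the kernel is vertical, hence fundamental. Its generator has degree `0`, so it is
detected by `τ_0` and must be zero. -/
theorem injective_nonpos (h₀ : IsLieSubgroup E₀ 𝔤) (u : P) :
    Function.Injective (𝔤.projNonpos ∘ₗ τ.coframe u) := by
  rw [injective_iff_map_eq_zero]
  intro v hv
  have hp : ∀ i ≤ 0, 𝔤.proj i (τ.coframe u v) = 0 := fun i hi => by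
    have := 𝔤.proj_projNonpos i (τ.coframe u v)
    rwa [show 𝔤.projNonpos (τ.coframe u v) = 0 from hv, map_zero, if_pos hi, eq_comm] at this
  obtain ⟨A, rfl⟩ := Q.exists_fundamental_eq (τ.mfderiv_proj_eq_zero fun i hi => hp i hi.le)
  have h0 := hp 0 le_rfl
  rw [coframe_fundamental, 𝔤.proj_mem_self (h₀.leviDeriv_mem A)] at h0
  have hA : A = 0 := h₀.injective_leviDeriv (h0.trans (map_zero (leviDeriv 𝔤 E₀)).symm)
  rw [hA, map_zero]

/-- The horizontal lift to `T_uP` with respect to the principal connection `τ_0`, as a map on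
`𝔤_-`. -/
def horizontalLift (h₀ : IsLieSubgroup E₀ 𝔤) (u : P) : GroupLieAlgebra 𝓘(ℝ, E) G →ₗ[ℝ] EP :=
  (LinearMap.exists_leftInverse_of_injective (𝔤.projNonpos ∘ₗ τ.coframe u)
    (LinearMap.ker_eq_bot.2 (τ.injective_nonpos h₀ u))).choose

theorem horizontalLift_nonpos (h₀ : IsLieSubgroup E₀ 𝔤) (u : P) (v : EP) :
    τ.horizontalLift h₀ u (𝔤.projNonpos (τ.coframe u v)) = v :=
  LinearMap.congr_fun (LinearMap.exists_leftInverse_of_injective (𝔤.projNonpos ∘ₗ τ.coframe u)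
    (LinearMap.ker_eq_bot.2 (τ.injective_nonpos h₀ u))).choose_spec v

/-- A left inverse is a right inverse only on the range, and the range of `τ_{≤0}` contains `𝔤_-`.
-/
theorem nonpos_horizontalLift [FiniteDimensional ℝ E₀] (h₀ : IsLieSubgroup E₀ 𝔤) (u : P)
    {X : GroupLieAlgebra 𝓘(ℝ, E) G} (hX : X ∈ 𝔤.neg) : 𝔤.projNonpos (τ.coframe u (τ.horizontalLift h₀ u X)) = X := by
  have e : 𝔤.projNonpos X = X := by
    rw [𝔤.projNonpos_eq, 𝔤.projNeg_of_mem hX, 𝔤.mem_neg_iff.1 hX 0 le_rfl, add_zero]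
  obtain ⟨v, hv⟩ := τ.exists_nonpos_eq h₀ u X
  rw [e] at hv
  rw [← hv, horizontalLift_nonpos]

end WeylForm

end Coframe

/-! ### Equivariance of `dτ`, finite and infinitesimal -/

section StructureEquation

open Topology Filter

variable {k : ℕ}
  {E : Type*} [NormedAddCommGroup E] [NormedSpace ℝ E] [CompleteSpace E]
  {G : Type*} [TopologicalSpace G] [ChartedSpace E G] [Group G] [LieGroup 𝓘(ℝ, E) ∞ G]
  {𝔤 : KGrading k (GroupLieAlgebra 𝓘(ℝ, E) G)}
  {E₀ : Type*} [NormedAddCommGroup E₀] [NormedSpace ℝ E₀] [ChartedSpace E₀ (leviSubgroup 𝔤)]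
  {EP : Type*} [NormedAddCommGroup EP] [NormedSpace ℝ EP]
  {EM : Type*} [NormedAddCommGroup EM] [NormedSpace ℝ EM]
  {P : Type*} [TopologicalSpace P] [ChartedSpace EP P] [IsManifold 𝓘(ℝ, EP) ∞ P]
  {M : Type*} [TopologicalSpace M] [ChartedSpace EM M] [IsManifold 𝓘(ℝ, EM) ∞ M]
  {Q : SmoothPrincipalBundle E₀ EP EM (leviSubgroup 𝔤) P M} {F : RegularFlagStructure Q}
  (τ : WeylForm F)

namespace WeylForm

/-- The Weyl form as a one-form with linear values. -/
abbrev linearForm (u : P) : TangentSpace 𝓘(ℝ, EP) u →ₗ[ℝ] GroupLieAlgebra 𝓘(ℝ, E) G :=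
  (τ.form u).toLinearMap

theorem smoothForm : SmoothForm τ.linearForm := τ.smooth

theorem formModel_act (g : leviSubgroup 𝔤) (u : P) (w : EP) :
    formModel τ.linearForm (Q.act u g) (mfderivModel EP EP (fun v => Q.act v g) u w) =
      AdModel ((g⁻¹ : leviSubgroup 𝔤) : G) (formModel τ.linearForm u w) :=
  τ.equivariant g u w

theorem coframe_act (g : leviSubgroup 𝔤) (u : P) (w : EP) :
    τ.coframe (Q.act u g) (mfderivModel EP EP (fun v => Q.act v g) u w) =
      Ad ((g⁻¹ : leviSubgroup 𝔤) : G) (τ.coframe u w) :=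
  τ.equivariant g u w

variable [FiniteDimensional ℝ EP]

/-- Pull back along `y ↦ φ⁻¹(y) · g`. By equivariance of `τ` the pulled back form is `Ad(g⁻¹)`
applied to the chart expression of `τ`, and the constant map `Ad(g⁻¹)` passes through the
derivative. -/
theorem extDerivForm_act (g : leviSubgroup 𝔤) (u : P) (v w : EP) :
    lieToModel (extDerivForm τ.linearForm (Q.act u g)
      (mfderivModel EP EP (fun v => Q.act v g) u v)
      (mfderivModel EP EP (fun v => Q.act v g) u w)) =
      AdModel ((g⁻¹ : leviSubgroup 𝔤) : G) (lieToModel (extDerivForm τ.linearForm u v w)) := by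
  let φ := extChartAt 𝓘(ℝ, EP) u
  have hφu : φ.symm (φ u) = u := extChartAt_to_inv (I := 𝓘(ℝ, EP)) u
  have htgt : φ u ∈ φ.target := mem_extChartAt_target (I := 𝓘(ℝ, EP)) u
  have hd : ∀ y ∈ φ.target, HasModelDerivAt (fun y => Q.act (φ.symm y) g) y
      ((mfderivModel EP EP (fun v => Q.act v g) (φ.symm y)).comp
        (mfderivModel EP EP φ.symm y)) := fun y hy =>
    (Q.hasModelDerivAt_act_right (φ.symm y) g).comp (hasModelDerivAt_extChartAt_symm hy) rfl
  have hd0 : mfderivModel EP EP (fun y => Q.act (φ.symm y) g) (φ u) =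
      mfderivModel EP EP (fun v => Q.act v g) u :=
    ((Q.hasModelDerivAt_act_right u g).comp (hasModelDerivAt_extChartAt_symm_self u) hφu).eq
  have hs : ContMDiffAt 𝓘(ℝ, EP) 𝓘(ℝ, EP) ∞ (fun y => Q.act (φ.symm y) g) (φ u) :=
    ContMDiffAt.comp (φ u) (Q.contMDiff_act_right g).contMDiffAt
      ((contMDiffOn_extChartAt_symm (I := 𝓘(ℝ, EP)) (n := ∞) u).contMDiffAt
        ((isOpen_extChartAt_target (I := 𝓘(ℝ, EP)) u).mem_nhds htgt))
  have hf : ∀ z : EP, (fun y => formModel τ.linearForm (Q.act (φ.symm y) g)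
      (mfderivModel EP EP (fun y => Q.act (φ.symm y) g) y z)) =ᶠ[𝓝 (φ u)]
      fun y => AdModel ((g⁻¹ : leviSubgroup 𝔤) : G) (formChart τ.linearForm u (y, z)) := fun z => by
    filter_upwards [(isOpen_extChartAt_target (I := 𝓘(ℝ, EP)) u).mem_nhds htgt] with y hy
    rw [(hd y hy).eq]
    exact τ.formModel_act g (φ.symm y) _
  have hf' : ∀ z : EP, fderiv ℝ (fun y => formModel τ.linearForm (Q.act (φ.symm y) g)
      (mfderivModel EP EP (fun y => Q.act (φ.symm y) g) y z)) (φ u) =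
      (AdModel ((g⁻¹ : leviSubgroup 𝔤) : G)).comp
        (fderiv ℝ (fun y => formChart τ.linearForm u (y, z)) (φ u)) := fun z => by
    rw [(hf z).fderiv_eq]
    exact ((AdModel ((g⁻¹ : leviSubgroup 𝔤) : G)).hasFDerivAt.comp _
      (τ.smoothForm.differentiableAt_formChart_left u z).hasFDerivAt).fderiv
  have h := (τ.smoothForm.extDerivForm_eq_of_map hs v w).2
  rw [hf', hf', hd0] at h
  have key : ∀ (p : P) (_ : p = Q.act u g) (a b : EP),
      lieToModel (extDerivForm τ.linearForm p a b) =
        lieToModel (extDerivForm τ.linearForm (Q.act u g) a b) := by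
    rintro p rfl a b; rfl
  rw [key _ (by rw [hφu])] at h
  rw [lieToModel_extDerivForm u v w, map_sub]
  exact h

/-- The infinitesimal equivariance of a Weyl form. -/
theorem extDerivForm_fundamental [LieGroup 𝓘(ℝ, E₀) ∞ (leviSubgroup 𝔤)]
    (h₀ : IsLieSubgroup E₀ 𝔤) (u : P) (A : E₀) (w : EP) :
    extDerivForm τ.linearForm u (Q.fundamentalModel u A) w =
      -⁅(modelToLie (leviDeriv 𝔤 E₀ A) : GroupLieAlgebra 𝓘(ℝ, E) G), τ.coframe u w⁆ := by
  have hM₀ := isManifold_infty_of_lieGroup E₀ (leviSubgroup 𝔤)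
  let φ := extChartAt 𝓘(ℝ, EP) u
  let χ := extChartAt 𝓘(ℝ, E₀) (1 : leviSubgroup 𝔤)
  have hφu : φ.symm (φ u) = u := extChartAt_to_inv (I := 𝓘(ℝ, EP)) u
  have hφt : φ u ∈ φ.target := mem_extChartAt_target (I := 𝓘(ℝ, EP)) u
  have hχ1 : χ.symm (χ 1) = 1 := extChartAt_to_inv (I := 𝓘(ℝ, E₀)) (1 : leviSubgroup 𝔤)
  have hχt : χ 1 ∈ χ.target := mem_extChartAt_target (I := 𝓘(ℝ, E₀)) (1 : leviSubgroup 𝔤)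
  -- Near `u`, use the action as parametrization, with coordinate directions `(A, 0)` and `(0, w)`.
  -- The value of `τ` on the first is differentiated along `w` only, that is on the slice `g = 1`,
  -- where it is the constant `A`. Its value on the second is differentiated along `g` only, where
  -- equivariance makes it `Ad(g⁻¹)τ(w)`, with derivative `-[A, τ(w)]`.
  let f : E₀ × EP → P := fun p => Q.act (φ.symm p.2) (χ.symm p.1)
  have hs : ContMDiffAt 𝓘(ℝ, E₀ × EP) 𝓘(ℝ, EP) ∞ f (χ 1, φ u) := by
    rw [modelWithCornersSelf_prod, ← chartedSpaceSelf_prod]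
    have h1 : ContMDiffAt 𝓘(ℝ, EP) 𝓘(ℝ, EP) ∞ φ.symm (φ u) :=
      (contMDiffOn_extChartAt_symm (I := 𝓘(ℝ, EP)) (n := ∞) u).contMDiffAt
        ((isOpen_extChartAt_target (I := 𝓘(ℝ, EP)) u).mem_nhds hφt)
    have h2 : ContMDiffAt 𝓘(ℝ, E₀) 𝓘(ℝ, E₀) ∞ χ.symm (χ 1) :=
      (contMDiffOn_extChartAt_symm (I := 𝓘(ℝ, E₀)) (n := ∞) (1 : leviSubgroup 𝔤)).contMDiffAt
        ((isOpen_extChartAt_target (I := 𝓘(ℝ, E₀)) (1 : leviSubgroup 𝔤)).mem_nhds hχt)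
    have h3 : ContMDiffAt (𝓘(ℝ, E₀).prod 𝓘(ℝ, EP)) (𝓘(ℝ, EP).prod 𝓘(ℝ, E₀)) ∞
        (fun p : E₀ × EP => (φ.symm p.2, χ.symm p.1)) (χ 1, φ u) :=
      (ContMDiffAt.comp (χ 1, φ u) h1 contMDiffAt_snd).prodMk
        (ContMDiffAt.comp (χ 1, φ u) h2 contMDiffAt_fst)
    exact ContMDiffAt.comp (χ 1, φ u) Q.contMDiff_act.contMDiffAt h3
  have hd : ∀ a ∈ χ.target, ∀ y ∈ φ.target, ∀ (B : E₀) (z : EP),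
      mfderivModel (E₀ × EP) EP f (a, y) (B, z) =
        mfderivModel EP EP (fun v => Q.act v (χ.symm a)) (φ.symm y)
          (mfderivModel EP EP φ.symm y z) +
        mfderivModel E₀ EP (fun g => Q.act (φ.symm y) g) (χ.symm a)
          (mfderivModel E₀ E₀ χ.symm a B) := fun a ha y hy B z => by
    have h1 : HasModelDerivAt (fun p : E₀ × EP => φ.symm p.2) (a, y) _ :=
      (hasModelDerivAt_extChartAt_symm hy).comp
        (hasModelDerivAt_iff_hasFDerivAt.2 (hasFDerivAt_snd (𝕜 := ℝ) (p := (a, y)))) rfl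
    have h2 : HasModelDerivAt (fun p : E₀ × EP => χ.symm p.1) (a, y) _ :=
      (hasModelDerivAt_extChartAt_symm ha).comp
        (hasModelDerivAt_iff_hasFDerivAt.2 (hasFDerivAt_fst (𝕜 := ℝ) (p := (a, y)))) rfl
    exact DFunLike.congr_fun (hasModelDerivAt_comp_prod
      (Q.mdifferentiableAt_act (φ.symm y) (χ.symm a)) h1 h2 rfl rfl).eq (B, z)
  have hφ' : mfderivModel EP EP φ.symm (φ u) = ContinuousLinearMap.id ℝ EP :=
    (hasModelDerivAt_extChartAt_symm_self u).eq
  have hχ' : mfderivModel E₀ E₀ χ.symm (χ 1) = ContinuousLinearMap.id ℝ E₀ :=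
    (hasModelDerivAt_extChartAt_symm_self (1 : leviSubgroup 𝔤)).eq
  have hone : mfderivModel EP EP (fun v => Q.act v 1) u = ContinuousLinearMap.id ℝ EP :=
    ((hasModelDerivAt_id u).congr (Eventually.of_forall Q.act_one)).eq
  have hfA : ∀ y ∈ φ.target, formModel τ.linearForm (f (χ 1, y))
      (mfderivModel (E₀ × EP) EP f (χ 1, y) (A, 0)) = leviDeriv 𝔤 E₀ A := fun y hy => by
    rw [hd _ hχt y hy, hχ', hχ1, map_zero, map_zero, zero_add]
    have e : f (χ 1, y) = φ.symm y := by simp only [f, hχ1, Q.act_one]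
    rw [e]
    exact τ.coframe_fundamental (φ.symm y) A
  have hfw : ∀ a ∈ χ.target, formModel τ.linearForm (f (a, φ u))
      (mfderivModel (E₀ × EP) EP f (a, φ u) (0, w)) =
      AdModel (((χ.symm a : leviSubgroup 𝔤) : G)⁻¹) (formModel τ.linearForm u w) :=
      fun a ha => by
    rw [hd a ha _ hφt, hφ', map_zero, map_zero, add_zero]
    simp only [f, hφu]
    exact τ.formModel_act (χ.symm a) u w
  have hA := τ.smoothForm.extDerivForm_eq_of_map hs (0, w) (A, 0)
  have hw := τ.smoothForm.extDerivForm_eq_of_map hs (A, 0) (0, w)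
  have h1 : fderiv ℝ (fun x => formModel τ.linearForm (f x)
      (mfderivModel (E₀ × EP) EP f x (A, 0))) (χ 1, φ u) (0, w) = 0 := by
    rw [← fderiv_prodMk_right hA.1]
    have e : (fun y => formModel τ.linearForm (f (χ 1, y))
        (mfderivModel (E₀ × EP) EP f (χ 1, y) (A, 0))) =ᶠ[𝓝 (φ u)]
        fun _ => leviDeriv 𝔤 E₀ A := by
      filter_upwards [(isOpen_extChartAt_target (I := 𝓘(ℝ, EP)) u).mem_nhds hφt] with y hy
        using hfA y hy
    rw [e.fderiv_eq]
    simp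
  have h2 : fderiv ℝ (fun x => formModel τ.linearForm (f x)
      (mfderivModel (E₀ × EP) EP f x (0, w))) (χ 1, φ u) (A, 0) =
      -(adModel E G (leviDeriv 𝔤 E₀ A) (formModel τ.linearForm u w)) := by
    rw [← fderiv_prodMk_left hw.1]
    have e : (fun a => formModel τ.linearForm (f (a, φ u))
        (mfderivModel (E₀ × EP) EP f (a, φ u) (0, w))) =ᶠ[𝓝 (χ 1)]
        fun a => AdModel (((χ.symm a : leviSubgroup 𝔤) : G)⁻¹) (formModel τ.linearForm u w) := by
      filter_upwards [(isOpen_extChartAt_target (I := 𝓘(ℝ, E₀)) (1 : leviSubgroup 𝔤)).mem_nhds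
        hχt] with a ha using hfw a ha
    rw [e.fderiv_eq]
    have h3 := hasModelDerivAt_iff_hasFDerivAt.1
      ((hasModelDerivAt_AdModel_inv (E := E) (G := G)).comp
        (h₀.hasModelDerivAt.comp (hasModelDerivAt_extChartAt_symm_self (1 : leviSubgroup 𝔤)) hχ1)
        (by rw [extChartAt_to_inv]; rfl))
    have h4 := (ContinuousLinearMap.apply ℝ E (formModel τ.linearForm u w)).hasFDerivAt.comp _ h3
    exact DFunLike.congr_fun h4.fderiv A
  have h := hw.2
  rw [h1, h2, sub_zero, hd _ hχt _ hφt, hd _ hχt _ hφt, hφ', hχ'] at h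
  simp only [map_zero, zero_add, add_zero, ContinuousLinearMap.id_apply, hχ1, hφu, hone] at h
  have key : ∀ (p : P) (_ : p = u) (a b : EP),
      lieToModel (extDerivForm τ.linearForm p a b) =
        lieToModel (extDerivForm τ.linearForm u a b) := by
    rintro p rfl a b; rfl
  rw [key _ (by simp only [f, hχ1, hφu, Q.act_one])] at h
  exact h.trans (congrArg Neg.neg (adModel_apply (modelToLie (leviDeriv 𝔤 E₀ A)) (τ.coframe u w)))

end WeylForm

end StructureEquation

/-! ### Descent of `τ_+` and of the curvature forms to the base -/

section Curvature

variable {k : ℕ}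
  {E : Type*} [NormedAddCommGroup E] [NormedSpace ℝ E] [CompleteSpace E]
  {G : Type*} [TopologicalSpace G] [ChartedSpace E G] [Group G] [LieGroup 𝓘(ℝ, E) ∞ G]
  {𝔤 : KGrading k (GroupLieAlgebra 𝓘(ℝ, E) G)}
  {E₀ : Type*} [NormedAddCommGroup E₀] [NormedSpace ℝ E₀] [ChartedSpace E₀ (leviSubgroup 𝔤)]
  {EP : Type*} [NormedAddCommGroup EP] [NormedSpace ℝ EP]
  {EM : Type*} [NormedAddCommGroup EM] [NormedSpace ℝ EM]
  {P : Type*} [TopologicalSpace P] [ChartedSpace EP P] [IsManifold 𝓘(ℝ, EP) ∞ P]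
  {M : Type*} [TopologicalSpace M] [ChartedSpace EM M] [IsManifold 𝓘(ℝ, EM) ∞ M]
  {Q : SmoothPrincipalBundle E₀ EP EM (leviSubgroup 𝔤) P M} {F : RegularFlagStructure Q}
  (τ : WeylForm F)

variable (E G) in
/-- The Lie bracket of `T₁G` as a bilinear map. -/
def lieBilin : GroupLieAlgebra 𝓘(ℝ, E) G →ₗ[ℝ] GroupLieAlgebra 𝓘(ℝ, E) G →ₗ[ℝ]
    GroupLieAlgebra 𝓘(ℝ, E) G :=
  LinearMap.mk₂ ℝ (fun X Y => ⁅X, Y⁆) add_lie smul_lie lie_add fun c X Y => lie_smul c X Y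

theorem projNonpos_Ad (g : leviSubgroup 𝔤) (X : GroupLieAlgebra 𝓘(ℝ, E) G) :
    𝔤.projNonpos (Ad (g : G) X) = Ad (g : G) (𝔤.projNonpos X) :=
  𝔤.sum_proj_comm _ (f := (Ad (g : G)).toLinearMap) (Ad_mem_part 𝔤 g) X

theorem projPos_Ad (g : leviSubgroup 𝔤) (X : GroupLieAlgebra 𝓘(ℝ, E) G) :
    𝔤.projPos (Ad (g : G) X) = Ad (g : G) (𝔤.projPos X) :=
  𝔤.sum_proj_comm _ (f := (Ad (g : G)).toLinearMap) (Ad_mem_part 𝔤 g) X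

namespace WeylForm

/-- The two-form `dτ(v, w) + [τ(v), τ(w)]` at `u` as a bilinear map. -/
def weylBilin (u : P) : EP →ₗ[ℝ] EP →ₗ[ℝ] GroupLieAlgebra 𝓘(ℝ, E) G :=
  τ.smoothForm.extDerivBilin u + (lieBilin E G).compl₁₂ (τ.coframe u) (τ.coframe u)

theorem weylBilin_apply (u : P) (v w : EP) :
    τ.weylBilin u v w = extDerivForm τ.linearForm u v w + ⁅τ.coframe u v, τ.coframe u w⁆ := rfl

theorem weylBilin_self (u : P) (v : EP) : τ.weylBilin u v v = 0 := by
  rw [weylBilin_apply, extDerivForm_self, lie_self, add_zero]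

/-- The two-form defining the total curvature at `u` as a bilinear map. -/
def totalBilin (u : P) : EP →ₗ[ℝ] EP →ₗ[ℝ] GroupLieAlgebra 𝓘(ℝ, E) G :=
  τ.smoothForm.extDerivBilin u +
    (lieBilin E G).compl₁₂ (𝔤.projNonpos ∘ₗ τ.coframe u) (𝔤.projNonpos ∘ₗ τ.coframe u) +
    (lieBilin E G).compl₁₂ (𝔤.projPos ∘ₗ τ.coframe u) (𝔤.projPos ∘ₗ τ.coframe u)

theorem totalBilin_apply (u : P) (v w : EP) :
    τ.totalBilin u v w = extDerivForm τ.linearForm u v w +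
      ⁅𝔤.projNonpos (τ.coframe u v), 𝔤.projNonpos (τ.coframe u w)⁆ +
      ⁅𝔤.projPos (τ.coframe u v), 𝔤.projPos (τ.coframe u w)⁆ := rfl

theorem totalBilin_self (u : P) (v : EP) : τ.totalBilin u v v = 0 := by
  rw [totalBilin_apply, extDerivForm_self, lie_self, lie_self, add_zero, add_zero]

/-- The two projections add up to the identity, so `dτ_{≤0} + dτ_+` recombines to `dτ`. -/
theorem totalBilin_eq [FiniteDimensional ℝ E] (u : P) (v w : EP) :
    τ.totalBilin u v w = τ.totalCurvatureForm u v w := by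
  have h1 : extDerivForm τ.nonpos u v w = 𝔤.projNonpos (extDerivForm τ.linearForm u v w) :=
    τ.smoothForm.extDerivForm_comp 𝔤.projNonpos u v w
  have h2 : extDerivForm τ.pos u v w = 𝔤.projPos (extDerivForm τ.linearForm u v w) :=
    τ.smoothForm.extDerivForm_comp 𝔤.projPos u v w
  change _ = extDerivForm τ.nonpos u v w +
      ⁅𝔤.projNonpos (τ.coframe u v), 𝔤.projNonpos (τ.coframe u w)⁆ +
    (extDerivForm τ.pos u v w + ⁅𝔤.projPos (τ.coframe u v), 𝔤.projPos (τ.coframe u w)⁆)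
  rw [totalBilin_apply, h1, h2, add_add_add_comm, 𝔤.projNonpos_add_projPos, add_assoc]

/-- The difference of the Weyl curvature and the total curvature as forms on `P`. -/
theorem weylBilin_eq_totalBilin (u : P) (v w : EP) :
    τ.weylBilin u v w = τ.totalBilin u v w +
      ⁅𝔤.projPos (τ.coframe u v), 𝔤.projNonpos (τ.coframe u w)⁆ -
      ⁅𝔤.projPos (τ.coframe u w), 𝔤.projNonpos (τ.coframe u v)⁆ := by
  rw [weylBilin_apply, totalBilin_apply]
  -- Of the four brackets arising from `τ = τ_{≤0} + τ_+`, the two unmixed ones belong to the total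
  -- curvature.
  nth_rw 1 [← 𝔤.projNonpos_add_projPos (τ.coframe u v), ← 𝔤.projNonpos_add_projPos (τ.coframe u w)]
  rw [add_lie, lie_add, lie_add,
    ← lie_skew (𝔤.projNonpos (τ.coframe u v)) (𝔤.projPos (τ.coframe u w))]
  abel

section Equivariance

variable [FiniteDimensional ℝ EP]

theorem extDerivForm_act_eq (g : leviSubgroup 𝔤) (u : P) (v w : EP) :
    extDerivForm τ.linearForm (Q.act u g)
      (mfderivModel EP EP (fun v => Q.act v g) u v)
      (mfderivModel EP EP (fun v => Q.act v g) u w) =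
      Ad ((g⁻¹ : leviSubgroup 𝔤) : G) (extDerivForm τ.linearForm u v w) :=
  τ.extDerivForm_act g u v w

theorem weylBilin_act (g : leviSubgroup 𝔤) (u : P) (v w : EP) :
    τ.weylBilin (Q.act u g)
      (mfderivModel EP EP (fun v => Q.act v g) u v)
      (mfderivModel EP EP (fun v => Q.act v g) u w) =
      Ad ((g⁻¹ : leviSubgroup 𝔤) : G) (τ.weylBilin u v w) := by
  simp only [weylBilin_apply, extDerivForm_act_eq, coframe_act, map_add, Ad_lie]

theorem totalBilin_act (g : leviSubgroup 𝔤) (u : P) (v w : EP) :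
    τ.totalBilin (Q.act u g)
      (mfderivModel EP EP (fun v => Q.act v g) u v)
      (mfderivModel EP EP (fun v => Q.act v g) u w) =
      Ad ((g⁻¹ : leviSubgroup 𝔤) : G) (τ.totalBilin u v w) := by
  simp only [totalBilin_apply, extDerivForm_act_eq, coframe_act, map_add, Ad_lie, projNonpos_Ad,
    projPos_Ad]

variable [LieGroup 𝓘(ℝ, E₀) ∞ (leviSubgroup 𝔤)]

/-- The term `-[A, τ(w)]` from infinitesimal equivariance cancels `[τ(ζ_A), τ(w)]`. This is what
allows arbitrary lifts in the description of `W`. -/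
theorem weylBilin_fundamental_left (h₀ : IsLieSubgroup E₀ 𝔤) (u : P) (A : E₀) (w : EP) :
    τ.weylBilin u (Q.fundamentalModel u A) w = 0 := by
  rw [weylBilin_apply, τ.extDerivForm_fundamental h₀, coframe_fundamental, neg_add_cancel]

theorem weylBilin_fundamental_right (h₀ : IsLieSubgroup E₀ 𝔤) (u : P) (A : E₀) (w : EP) :
    τ.weylBilin u w (Q.fundamentalModel u A) = 0 := by
  have h := τ.weylBilin_self u (w + Q.fundamentalModel u A)
  simpa [weylBilin_self, τ.weylBilin_fundamental_left h₀] using h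

/-- The Weyl curvature form depends only on the projections of its arguments to `TM`. -/
theorem weylBilin_congr (h₀ : IsLieSubgroup E₀ 𝔤) {u : P} {v v' w w' : EP}
    (hv : 𝔤.projNeg (τ.coframe u v) = 𝔤.projNeg (τ.coframe u v'))
    (hw : 𝔤.projNeg (τ.coframe u w) = 𝔤.projNeg (τ.coframe u w')) :
    τ.weylBilin u v w = τ.weylBilin u v' w' := by
  obtain ⟨A, hA⟩ := τ.exists_fundamental_eq (u := u) (v := v - v') (by simp [hv])
  obtain ⟨B, hB⟩ := τ.exists_fundamental_eq (u := u) (v := w - w') (by simp [hw])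
  rw [← sub_add_cancel v v', ← sub_add_cancel w w', ← hA, ← hB]
  simp [τ.weylBilin_fundamental_left h₀, τ.weylBilin_fundamental_right h₀]

end Equivariance

/-- `τ_+` vanishes on vertical vectors. -/
theorem projPos_coframe_congr [FiniteDimensional ℝ E]
    [LieAlgebra.IsSemisimple ℝ (GroupLieAlgebra 𝓘(ℝ, E) G)]
    [LieGroup 𝓘(ℝ, E₀) ∞ (leviSubgroup 𝔤)] (h₀ : IsLieSubgroup E₀ 𝔤) {u : P} {v v' : EP}
    (hv : 𝔤.projNeg (τ.coframe u v) = 𝔤.projNeg (τ.coframe u v')) :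
    𝔤.projPos (τ.coframe u v) = 𝔤.projPos (τ.coframe u v') := by
  obtain ⟨A, hA⟩ := τ.exists_fundamental_eq (u := u) (v := v - v') (by simp [hv])
  rw [← sub_eq_zero, ← map_sub, ← map_sub, ← hA, coframe_fundamental]
  refine 𝔤.ext_proj fun i => ?_
  rw [𝔤.proj_projPos, map_zero]
  split_ifs with hi
  · exact 𝔤.proj_mem_ne (h₀.leviDeriv_mem A) hi.ne
  · rfl

section Lift

variable [FiniteDimensional ℝ E] [FiniteDimensional ℝ E₀]
  [LieAlgebra.IsSemisimple ℝ (GroupLieAlgebra 𝓘(ℝ, E) G)]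
  [LieGroup 𝓘(ℝ, E₀) ∞ (leviSubgroup 𝔤)] (h₀ : IsLieSubgroup E₀ 𝔤)

/-- Horizontal lifts are in particular lifts, so the descriptions of `P` and `W` may be tested on
them. -/
theorem neg_horizontalLift (u : P) {X : GroupLieAlgebra 𝓘(ℝ, E) G} (hX : X ∈ 𝔤.neg) :
    𝔤.projNeg (τ.coframe u (τ.horizontalLift h₀ u X)) = X := by
  refine Eq.trans (𝔤.ext_proj fun i => ?_) (𝔤.projNeg_of_mem hX)
  conv_rhs => rw [← τ.nonpos_horizontalLift h₀ u hX]
  simp only [𝔤.proj_projNeg, 𝔤.proj_projNonpos]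
  split_ifs <;> first | omega | rfl

/-- The translated vector has the required value of `τ_{≤0}` by equivariance, and a vector is
determined by that value. -/
theorem horizontalLift_act (g : leviSubgroup 𝔤) (u : P) {X : GroupLieAlgebra 𝓘(ℝ, E) G}
    (hX : X ∈ 𝔤.neg) :
    τ.horizontalLift h₀ (Q.act u g) (Ad ((g⁻¹ : leviSubgroup 𝔤) : G) X) =
      mfderivModel EP EP (fun v => Q.act v g) u (τ.horizontalLift h₀ u X) := by
  rw [← τ.horizontalLift_nonpos h₀ (Q.act u g)
    (mfderivModel EP EP (fun v => Q.act v g) u (τ.horizontalLift h₀ u X)), coframe_act,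
    projNonpos_Ad, τ.nonpos_horizontalLift h₀ u hX]

/-- Elements of `A_-` are lifted to horizontal tangent vectors equivariantly. -/
theorem horizontalLift_fibreAct {x : M} (ξ : adjointNeg Q x) (u : Q.Fibre x)
    (g : leviSubgroup 𝔤) :
    τ.horizontalLift h₀ (Q.act u.1 g) (ξ.1.1 (Q.fibreAct u g)) =
      mfderivModel EP EP (fun v => Q.act v g) u.1 (τ.horizontalLift h₀ u.1 (ξ.1.1 u)) := by
  rw [ξ.1.2 u g, τ.horizontalLift_act h₀ g u.1 (ξ.2 u)]

/-- The section of `L(Λ²A_-, A)` defined by the values of an equivariant two-form on horizontal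
lifts. -/
def descend (B : P → EP →ₗ[ℝ] EP →ₗ[ℝ] GroupLieAlgebra 𝓘(ℝ, E) G)
    (hB : ∀ (u : P) (v : EP), B u v v = 0)
    (hact : ∀ (g : leviSubgroup 𝔤) (u : P) (v w : EP),
      B (Q.act u g) (mfderivModel EP EP (fun v => Q.act v g) u v)
        (mfderivModel EP EP (fun v => Q.act v g) u w) =
        Ad ((g⁻¹ : leviSubgroup 𝔤) : G) (B u v w)) (x : M) :
    adjointNeg Q x [⋀^Fin 2]→ₗ[ℝ] adjointFibre Q x :=
  alternatingOfBilinear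
    (LinearMap.mk₂ ℝ
      (fun ξ η : adjointNeg Q x => (⟨fun u => B u.1 (τ.horizontalLift h₀ u.1 (ξ.1.1 u))
        (τ.horizontalLift h₀ u.1 (η.1.1 u)), fun u g => by
          have h := hact g u.1 (τ.horizontalLift h₀ u.1 (ξ.1.1 u))
            (τ.horizontalLift h₀ u.1 (η.1.1 u))
          rw [← τ.horizontalLift_fibreAct h₀ ξ u g, ← τ.horizontalLift_fibreAct h₀ η u g] at h
          exact h⟩ : adjointFibre Q x))
      (fun ξ ξ' η => Subtype.ext <| funext fun u => by
        change B u.1 (τ.horizontalLift h₀ u.1 (ξ.1.1 u + ξ'.1.1 u)) _ = _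
        rw [map_add, map_add]
        rfl)
      (fun c ξ η => Subtype.ext <| funext fun u => by
        change B u.1 (τ.horizontalLift h₀ u.1 (c • ξ.1.1 u)) _ = _
        rw [map_smul, map_smul]
        rfl)
      (fun ξ η η' => Subtype.ext <| funext fun u => by
        change B u.1 _ (τ.horizontalLift h₀ u.1 (η.1.1 u + η'.1.1 u)) = _
        rw [map_add, map_add]
        rfl)
      (fun c ξ η => Subtype.ext <| funext fun u => by
        change B u.1 _ (τ.horizontalLift h₀ u.1 (c • η.1.1 u)) = _
        rw [map_smul, map_smul]
        rfl))
    fun _ => Subtype.ext <| funext fun _ => hB _ _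

/-- A section of `L(A_-, A_+)` to which `τ_+` descends. -/
def rho (x : M) : adjointNeg Q x →ₗ[ℝ] adjointPos Q x where
  toFun ξ := ⟨⟨fun u => 𝔤.projPos (τ.coframe u.1 (τ.horizontalLift h₀ u.1 (ξ.1.1 u))),
    fun u g => by
      have h := τ.coframe_act g u.1 (τ.horizontalLift h₀ u.1 (ξ.1.1 u))
      rw [← τ.horizontalLift_fibreAct h₀ ξ u g] at h
      exact (congrArg 𝔤.projPos h).trans (projPos_Ad g⁻¹ _)⟩, fun u => 𝔤.projPos_mem _⟩
  map_add' ξ η := Subtype.ext <| Subtype.ext <| funext fun u => by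
    change 𝔤.projPos (τ.coframe u.1 (τ.horizontalLift h₀ u.1 (ξ.1.1 u + η.1.1 u))) = _
    rw [map_add, map_add, map_add]
    rfl
  map_smul' c ξ := Subtype.ext <| Subtype.ext <| funext fun u => by
    change 𝔤.projPos (τ.coframe u.1 (τ.horizontalLift h₀ u.1 (c • ξ.1.1 u))) = _
    rw [map_smul, map_smul, map_smul]
    rfl

theorem isRhoTensor_rho : τ.IsRhoTensor (τ.rho h₀) := fun _ ξ u _ hv =>
  τ.projPos_coframe_congr h₀ ((τ.neg_horizontalLift h₀ u.1 (ξ.2 u)).trans hv.symm)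

variable [FiniteDimensional ℝ EP]

/-- There is no freedom here: a vector with `τ_{≤0}(v) = ξ(u)` is the horizontal lift. -/
theorem isTotalCurvature_descend :
    τ.IsTotalCurvature (τ.descend h₀ τ.totalBilin τ.totalBilin_self τ.totalBilin_act) := by
  intro x ξ η u v w hv hw
  have hv' : 𝔤.projNonpos (τ.coframe u.1 v) = ξ.1.1 u := hv
  have hw' : 𝔤.projNonpos (τ.coframe u.1 w) = η.1.1 u := hw
  have h := congrArg₂ (fun a b => τ.totalBilin u.1 a b) (τ.horizontalLift_nonpos h₀ u.1 v)
    (τ.horizontalLift_nonpos h₀ u.1 w)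
  rw [hv', hw'] at h
  exact h.trans (τ.totalBilin_eq u.1 v w)

theorem isWeylCurvature_descend :
    τ.IsWeylCurvature (τ.descend h₀ τ.weylBilin τ.weylBilin_self τ.weylBilin_act) :=
  fun _ ξ η u _ _ hv hw => τ.weylBilin_congr h₀
    ((τ.neg_horizontalLift h₀ u.1 (ξ.2 u)).trans hv.symm)
    ((τ.neg_horizontalLift h₀ u.1 (η.2 u)).trans hw.symm)

end Lift

section Uniqueness

variable [FiniteDimensional ℝ E] [FiniteDimensional ℝ E₀]
  [LieAlgebra.IsSemisimple ℝ (GroupLieAlgebra 𝓘(ℝ, E) G)]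
  [LieGroup 𝓘(ℝ, E₀) ∞ (leviSubgroup 𝔤)] {τ}

/-- Since horizontal lifts exist at every point, the description forces the value; uniqueness
follows. The same applies to `K` and `W` below. -/
theorem IsRhoTensor.apply {R : ∀ x : M, adjointNeg Q x →ₗ[ℝ] adjointPos Q x}
    (hR : τ.IsRhoTensor R) (h₀ : IsLieSubgroup E₀ 𝔤) {x : M} (ξ : adjointNeg Q x)
    (u : Q.Fibre x) :
    (R x ξ).1.1 u = 𝔤.projPos (τ.coframe u.1 (τ.horizontalLift h₀ u.1 (ξ.1.1 u))) :=
  hR x ξ u _ (τ.neg_horizontalLift h₀ u.1 (ξ.2 u))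

theorem IsTotalCurvature.apply {K : ∀ x : M, adjointNeg Q x [⋀^Fin 2]→ₗ[ℝ] adjointFibre Q x}
    (hK : τ.IsTotalCurvature K) (h₀ : IsLieSubgroup E₀ 𝔤) {x : M} (ξ η : adjointNeg Q x)
    (u : Q.Fibre x) :
    (K x ![ξ, η]).1 u = τ.totalBilin u.1 (τ.horizontalLift h₀ u.1 (ξ.1.1 u))
      (τ.horizontalLift h₀ u.1 (η.1.1 u)) :=
  (hK x ξ η u _ _ (τ.nonpos_horizontalLift h₀ u.1 (ξ.2 u))
    (τ.nonpos_horizontalLift h₀ u.1 (η.2 u))).trans (τ.totalBilin_eq _ _ _).symm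

theorem IsWeylCurvature.apply {W : ∀ x : M, adjointNeg Q x [⋀^Fin 2]→ₗ[ℝ] adjointFibre Q x}
    (hW : τ.IsWeylCurvature W) (h₀ : IsLieSubgroup E₀ 𝔤) {x : M} (ξ η : adjointNeg Q x)
    (u : Q.Fibre x) :
    (W x ![ξ, η]).1 u = τ.weylBilin u.1 (τ.horizontalLift h₀ u.1 (ξ.1.1 u))
      (τ.horizontalLift h₀ u.1 (η.1.1 u)) :=
  hW x ξ η u _ _ (τ.neg_horizontalLift h₀ u.1 (ξ.2 u)) (τ.neg_horizontalLift h₀ u.1 (η.2 u))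

omit [FiniteDimensional ℝ E] [FiniteDimensional ℝ E₀]
  [LieAlgebra.IsSemisimple ℝ (GroupLieAlgebra 𝓘(ℝ, E) G)]
  [LieGroup 𝓘(ℝ, E₀) ∞ (leviSubgroup 𝔤)] [IsManifold 𝓘(ℝ, EP) ∞ P]
  [IsManifold 𝓘(ℝ, EM) ∞ M] in
theorem alternating_ext {Φ Ψ : ∀ x : M, adjointNeg Q x [⋀^Fin 2]→ₗ[ℝ] adjointFibre Q x}
    (h : ∀ (x : M) (ξ η : adjointNeg Q x) (u : Q.Fibre x),
      (Φ x ![ξ, η]).1 u = (Ψ x ![ξ, η]).1 u) : Φ = Ψ :=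
  funext fun x => AlternatingMap.ext fun m => Subtype.ext <| funext fun u => by
    have e : m = ![m 0, m 1] := by ext i; fin_cases i <;> rfl
    rw [e]
    exact h x _ _ u

/-- The relation between the Weyl curvature, the total curvature and the Rho tensor. -/
theorem IsWeylCurvature.eq_totalCurvature {R : ∀ x : M, adjointNeg Q x →ₗ[ℝ] adjointPos Q x}
    {K W : ∀ x : M, adjointNeg Q x [⋀^Fin 2]→ₗ[ℝ] adjointFibre Q x} (h₀ : IsLieSubgroup E₀ 𝔤)
    (hR : τ.IsRhoTensor R) (hK : τ.IsTotalCurvature K) (hW : τ.IsWeylCurvature W) {x : M}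
    (ξ η : adjointNeg Q x) :
    W x ![ξ, η] = K x ![ξ, η] + ⁅(R x ξ : adjointFibre Q x), (η : adjointFibre Q x)⁆
      - ⁅(R x η : adjointFibre Q x), (ξ : adjointFibre Q x)⁆ := by
  refine Subtype.ext <| funext fun u => ?_
  change (W x ![ξ, η]).1 u = (K x ![ξ, η]).1 u + ⁅(R x ξ).1.1 u, η.1.1 u⁆ -
    ⁅(R x η).1.1 u, ξ.1.1 u⁆
  -- Evaluated on horizontal lifts, `τ_{≤0}` returns `ξ(u)` and `η(u)` while `τ_+` returns the Rho
  -- tensor, so the mixed brackets become the algebraic brackets.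
  rw [hW.apply h₀, hK.apply h₀, hR.apply h₀, hR.apply h₀, weylBilin_eq_totalBilin,
    τ.nonpos_horizontalLift h₀ u.1 (ξ.2 u), τ.nonpos_horizontalLift h₀ u.1 (η.2 u)]

end Uniqueness

end WeylForm

omit [IsManifold 𝓘(ℝ, EP) ∞ P] [IsManifold 𝓘(ℝ, EM) ∞ M] in
/-- Bracketing a homogeneous element of degree `j` with an element of `A_+` has no components of
degree at most `j`. -/
theorem adjointProj_lie_pos {x : M} (f : adjointPos Q x) (η : adjointNeg Q x) {j m : ℤ}
    (hm : m ≤ j) :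
    adjointProj Q x m ⁅(f : adjointFibre Q x), (adjointNegProj Q x j η : adjointFibre Q x)⁆ = 0 :=
  Subtype.ext <| funext fun u => 𝔤.proj_lie_pos_eq_zero (f.2 u) (𝔤.proj_mem j (η.1.1 u)) hm

end Curvature

end

theorem proposition4p12 {k : ℕ}
    {E : Type*} [NormedAddCommGroup E] [NormedSpace ℝ E] [FiniteDimensional ℝ E] [CompleteSpace E]
    {G : Type*} [TopologicalSpace G] [ChartedSpace E G] [Group G] [LieGroup 𝓘(ℝ, E) ∞ G]
    [LieAlgebra.IsSemisimple ℝ (GroupLieAlgebra 𝓘(ℝ, E) G)]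
    {𝔤 : KGrading k (GroupLieAlgebra 𝓘(ℝ, E) G)}
    {E₀ : Type*} [NormedAddCommGroup E₀] [NormedSpace ℝ E₀] [FiniteDimensional ℝ E₀]
    [ChartedSpace E₀ (leviSubgroup 𝔤)] [LieGroup 𝓘(ℝ, E₀) ∞ (leviSubgroup 𝔤)]
    (hG₀ : IsLieSubgroup E₀ 𝔤)
    {EP : Type*} [NormedAddCommGroup EP] [NormedSpace ℝ EP] [FiniteDimensional ℝ EP]
    {P : Type*} [TopologicalSpace P] [ChartedSpace EP P] [IsManifold 𝓘(ℝ, EP) ∞ P]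
    {EM : Type*} [NormedAddCommGroup EM] [NormedSpace ℝ EM] [FiniteDimensional ℝ EM]
    {M : Type*} [TopologicalSpace M] [ChartedSpace EM M] [IsManifold 𝓘(ℝ, EM) ∞ M]
    {Q : SmoothPrincipalBundle E₀ EP EM (leviSubgroup 𝔤) P M}
    (F : RegularFlagStructure Q) (τ : WeylForm F) :
    (∃! Rho : ∀ x : M, adjointNeg Q x →ₗ[ℝ] adjointPos Q x, τ.IsRhoTensor Rho) ∧
    (∃! K : ∀ x : M, adjointNeg Q x [⋀^Fin 2]→ₗ[ℝ] adjointFibre Q x, τ.IsTotalCurvature K) ∧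
    (∃! W : ∀ x : M, adjointNeg Q x [⋀^Fin 2]→ₗ[ℝ] adjointFibre Q x, τ.IsWeylCurvature W) ∧
    ∀ (Rho : ∀ x : M, adjointNeg Q x →ₗ[ℝ] adjointPos Q x)
      (K W : ∀ x : M, adjointNeg Q x [⋀^Fin 2]→ₗ[ℝ] adjointFibre Q x),
      τ.IsRhoTensor Rho → τ.IsTotalCurvature K → τ.IsWeylCurvature W →
      (∀ (x : M) (ξ η : adjointNeg Q x),
        W x ![ξ, η] = K x ![ξ, η] + ⁅(Rho x ξ : adjointFibre Q x), (η : adjointFibre Q x)⁆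
          - ⁅(Rho x η : adjointFibre Q x), (ξ : adjointFibre Q x)⁆) ∧
      ∀ i : ℤ, i ≤ 1 → ∀ x : M,
        homogeneousComponent (W x) i = homogeneousComponent (K x) i := by
  refine ⟨⟨τ.rho hG₀, τ.isRhoTensor_rho hG₀, fun R hR => ?_⟩,
    ⟨_, τ.isTotalCurvature_descend hG₀, fun K hK => WeylForm.alternating_ext fun x ξ η u => ?_⟩,
    ⟨_, τ.isWeylCurvature_descend hG₀, fun W hW => WeylForm.alternating_ext fun x ξ η u => ?_⟩,
    fun R K W hR hK hW => ⟨fun x ξ η => hW.eq_totalCurvature hG₀ hR hK ξ η, fun l hl x => ?_⟩⟩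
  · exact funext fun x => LinearMap.ext fun ξ => Subtype.ext <| Subtype.ext <| funext fun u =>
      (hR.apply hG₀ ξ u).trans ((τ.isRhoTensor_rho hG₀).apply hG₀ ξ u).symm
  · exact (hK.apply hG₀ ξ η u).trans ((τ.isTotalCurvature_descend hG₀).apply hG₀ ξ η u).symm
  · exact (hW.apply hG₀ ξ η u).trans ((τ.isWeylCurvature_descend hG₀).apply hG₀ ξ η u).symm
  · refine funext fun ξ => funext fun η => Finset.sum_congr rfl fun i hi =>
      Finset.sum_congr rfl fun j hj => ?_
    rw [Finset.mem_Ico] at hi hj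
    -- As `i, j ≤ -1` and `l ≤ 1`, the degree `i + j + l` is at most `i` and at most `j`, whereas
    -- the brackets with the Rho tensor have components only in degrees above `j` and above `i`
    -- respectively.
    rw [hW.eq_totalCurvature hG₀ hR hK, map_sub, map_add, adjointProj_lie_pos _ _ (by omega),
      adjointProj_lie_pos _ _ (by omega), add_zero, sub_zero]
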